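/- Let $n\ge 2$ and let $T=\mathbb{R}^{2n+1}$ with its Euclidean metric, by which $T$ is identified with its dual, and with standard orthonormal basis $\theta^1,\dots,\theta^{2n+1}$. Let $\mathrm{SU}(n)\subset\mathrm{SO}(2n+1)$ act in the usual way on $\mathbb{R}^{2n}=\mathbb{C}^n$ (complex coordinates $x_{2k-1}+ix_{2k}$) and trivially on the last coordinate, and let $(\Lambda^*T)^{\mathrm{SU}(n)}$ be the algebra of invariant elements of the exterior algebra $\Lambda^*T$. It contains $$\alpha=\theta^{2n+1},\qquad F=\theta^{12}+\theta^{34}+\dots+\theta^{2n-1,2n},\qquad \Omega=\Omega^++i\Omega^-=(\theta^1+i\theta^2)\wedge\dots\wedge(\theta^{2n-1}+i\theta^{2n}),$$ where $\Omega^\pm$ are real. Let $N(\mathrm{SU}(n))$ be the normalizer of $\mathrm{SU}(n)$ in $\mathrm{SO}(2n+1)$; its elements $g$ map $(\Lambda^*T)^{\mathrm{SU}(n)}$ to itself and act on linear endomorphisms $f$ of it by $g\cdot f=g\circ f\circ g^{-1}$. Linear endomorphisms $f$ are extended complex linearly to complex-valued forms, so $f(\Omega)=f(\Omega^+)+if(\Omega^-)$.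 Let $f$ be a derivation of $(\Lambda^*T)^{\mathrm{SU}(n)}$, that is, a real linear endomorphism with $f(a\wedge b)=f(a)\wedge b+(-1)^p a\wedge f(b)$ whenever $a$ has degree $p$. Then $f$ is a differential operator (i.e. $f$ raises degrees by one and $f^2=0$) which extends to a derivation of degree one of the graded algebra $\Lambda^*T$ (not required to have square zero) if and only if at least one of the following holds for some real constants $\lambda,\mu$: (A) $f(\alpha)=0$, $f(F)=2\lambda\,\alpha\wedge F$, $f(\Omega)=n(\lambda-\mu i)\,\alpha\wedge\Omega$; (B) $f(\alpha)=\lambda F$, $f(F)=0$, $f(\Omega)=-\mu i\,\alpha\wedge\Omega$; (C) $n=2$, and for some $g\in N(\mathrm{SU}(2))$ the operator $g\cdot f$ has the form (A) or (B); (D) $n=3$, $f(\alpha)=0$, $f(F)=3\lambda\Omega^--3\mu\Omega^+$, $f(\Omega)=2(\lambda+i\mu)\,F\wedge F$. -/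

import Mathlib

open scoped TensorProduct

noncomputable section

namespace OddSU

/-! ### Graded algebras with an operator of degree one -/

/-- The graded Leibniz rule `f (a b) = f a b + (-1)^p a f b` for `a` of degree `p`. -/
def GradedLeibniz {A : Type*} [Ring A] [Algebra ℝ A] (𝒜 : ℕ → Submodule ℝ A)
    (f : A →ₗ[ℝ] A) : Prop :=
  ∀ (p : ℕ) (a : A), a ∈ 𝒜 p → ∀ b : A, f (a * b) = f a * b + (-1) ^ p * (a * f b)

/-- `f` raises the degree by one. -/
def HasDegreeOne {A : Type*} [Ring A] [Algebra ℝ A] (𝒜 : ℕ → Submodule ℝ A)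
    (f : A →ₗ[ℝ] A) : Prop :=
  ∀ (p : ℕ) (a : A), a ∈ 𝒜 p → f a ∈ 𝒜 (p + 1)

/-- `f` is a differential operator on `A`: `(A, f)` is a differential graded algebra. -/
structure IsDifferentialOperator {A : Type*} [Ring A] [Algebra ℝ A] (𝒜 : ℕ → Submodule ℝ A)
    (f : A →ₗ[ℝ] A) : Prop where
  sq_zero : ∀ a : A, f (f a) = 0
  leibniz : GradedLeibniz 𝒜 f
  degree_one : HasDegreeOne 𝒜 f

/-! ### The representation `T = ℝ^{2n+1}` of `SU(n)` -/

/-- `T = ℝ^{2n+1}` with its Euclidean metric. For `k : Fin n`, the indices `inl (k, 0)`,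
`inl (k, 1)` are the odd and the even index of the `k`-th pair `(1,2), (3,4), …, (2n-1,2n)`, and
`inr ()` is the last index `2n+1`. -/
abbrev T (n : ℕ) : Type := EuclideanSpace ℝ ((Fin n × Fin 2) ⊕ Unit)

/-- The standard orthonormal basis of `T`. -/
def e (n : ℕ) (i : (Fin n × Fin 2) ⊕ Unit) : T n := EuclideanSpace.single i 1

/-- The complex coordinates `z_k = x_{2k-1} + i x_{2k}` of a vector of `T`. -/
def z {n : ℕ} (v : T n) (k : Fin n) : ℂ :=
  (v (Sum.inl (k, 0)) : ℂ) + Complex.I * (v (Sum.inl (k, 1)) : ℂ)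

/-- `SU(n)` inside the orthogonal group `O(T)`: it acts in the usual way on `ℝ^{2n} = ℂ^n` and
trivially on the last coordinate. -/
def SU (n : ℕ) : Subgroup (T n ≃ₗᵢ[ℝ] T n) where
  carrier := {g | ∃ U ∈ Matrix.specialUnitaryGroup (Fin n) ℂ, ∀ v : T n,
    z (g v) = U.mulVec (z v) ∧ g v (Sum.inr ()) = v (Sum.inr ())}
  mul_mem' := by
    rintro a b ⟨U, hU, ha⟩ ⟨V, hV, hb⟩
    refine ⟨U * V, mul_mem hU hV, fun v => ⟨?_, ?_⟩⟩
    · rw [LinearIsometryEquiv.coe_mul, Function.comp_apply, (ha _).1, (hb _).1,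
        Matrix.mulVec_mulVec]
    · rw [LinearIsometryEquiv.coe_mul, Function.comp_apply, (ha _).2, (hb _).2]
  one_mem' := ⟨1, one_mem _, fun v => by simp⟩
  inv_mem' := by
    rintro a ⟨U, hU, ha⟩
    refine ⟨star U, (star (⟨U, hU⟩ : Matrix.specialUnitaryGroup (Fin n) ℂ)).2, fun v => ?_⟩
    have h := ha (a⁻¹ v)
    have hv : a (a⁻¹ v) = v := by
      rw [← Function.comp_apply (f := a), ← LinearIsometryEquiv.coe_mul]; simp
    rw [hv] at h
    refine ⟨?_, h.2.symm⟩
    rw [h.1, Matrix.mulVec_mulVec, Matrix.mem_unitaryGroup_iff'.1 hU.1, Matrix.one_mulVec]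

/-- The special orthogonal group `SO(T) = SO(2n+1)`. -/
def SO (n : ℕ) : Subgroup (T n ≃ₗᵢ[ℝ] T n) where
  carrier := {g | LinearMap.det (g.toLinearEquiv : T n →ₗ[ℝ] T n) = 1}
  mul_mem' := by
    intro a b ha hb
    have : ((a * b).toLinearEquiv : T n →ₗ[ℝ] T n)
        = (a.toLinearEquiv : T n →ₗ[ℝ] T n) ∘ₗ (b.toLinearEquiv : T n →ₗ[ℝ] T n) := rfl
    simp only [Set.mem_ofPred_eq] at ha hb ⊢
    rw [this, LinearMap.det_comp, ha, hb, one_mul]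
  one_mem' := LinearMap.det_id
  inv_mem' := by
    intro a ha
    have h : (a.toLinearEquiv : T n →ₗ[ℝ] T n) ∘ₗ (a⁻¹.toLinearEquiv : T n →ₗ[ℝ] T n)
        = LinearMap.id := LinearMap.ext fun v => a.apply_symm_apply v
    have h' := congrArg LinearMap.det h
    simp only [Set.mem_ofPred_eq] at ha ⊢
    rwa [LinearMap.det_comp, ha, one_mul, LinearMap.det_id] at h'

/-- The normalizer `N(SU(n))` of `SU(n)` in `SO(2n+1)`. -/
def N (n : ℕ) : Subgroup (T n ≃ₗᵢ[ℝ] T n) :=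
  SO n ⊓ Subgroup.normalizer (SU n : Set (T n ≃ₗᵢ[ℝ] T n))

/-! ### Exterior algebra and invariants -/

/-- The exterior algebra `Λ*T`, where `T` and its dual are identified by the metric. -/
abbrev Ext (n : ℕ) : Type := ExteriorAlgebra ℝ (T n)

/-- The degree `p` part `Λ^p T`. -/
def extGrading (n : ℕ) (p : ℕ) : Submodule ℝ (Ext n) := ⋀[ℝ]^p (T n)

/-- The action of `O(T)` on `Λ*T` by algebra automorphisms. -/
def act {n : ℕ} (g : T n ≃ₗᵢ[ℝ] T n) : Ext n →ₐ[ℝ] Ext n :=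
  ExteriorAlgebra.map (g.toLinearEquiv : T n →ₗ[ℝ] T n)

theorem act_mul {n : ℕ} (g h : T n ≃ₗᵢ[ℝ] T n) (a : Ext n) : act (g * h) a = act g (act h a) := by
  have : act (g * h) = (act g).comp (act h) := (ExteriorAlgebra.map_comp_map _ _).symm
  rw [this, AlgHom.comp_apply]

/-- The algebra `(Λ*T)^{SU(n)}` of invariant forms. -/
def Inv (n : ℕ) : Subalgebra ℝ (Ext n) where
  carrier := {a | ∀ g ∈ SU n, act g a = a}
  mul_mem' := fun ha hb g hg => by rw [map_mul, ha g hg, hb g hg]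
  add_mem' := fun ha hb g hg => by rw [map_add, ha g hg, hb g hg]
  algebraMap_mem' := fun r g _ => by rw [AlgHom.commutes]

/-- The grading induced on `(Λ*T)^{SU(n)}`. -/
def invGrading (n : ℕ) (p : ℕ) : Submodule ℝ (Inv n) :=
  (extGrading n p).comap (Inv n).val.toLinearMap

/-- `f` extends to a derivation of degree one of the graded algebra `Λ*T`. -/
def ExtendsToDerivation {n : ℕ} (f : Inv n →ₗ[ℝ] Inv n) : Prop :=
  ∃ F : Ext n →ₗ[ℝ] Ext n, HasDegreeOne (extGrading n) F ∧ GradedLeibniz (extGrading n) F ∧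
    ∀ a : Inv n, F (a : Ext n) = (f a : Ext n)

theorem act_mem_Inv {n : ℕ} {g : T n ≃ₗᵢ[ℝ] T n} (hg : g ∈ N n) {a : Ext n} (ha : a ∈ Inv n) :
    act g a ∈ Inv n := by
  intro h hh
  have h1 : g⁻¹ * h * g ∈ SU n := (Subgroup.mem_set_normalizer_iff''.1 hg.2 h).1 hh
  rw [← act_mul, show h * g = g * (g⁻¹ * h * g) by group, act_mul, ha _ h1]

/-- The action of an element of the normalizer on `(Λ*T)^{SU(n)}`. -/
def normAct {n : ℕ} (g : N n) : Inv n →ₗ[ℝ] Inv n :=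
  (act (g : T n ≃ₗᵢ[ℝ] T n)).toLinearMap.restrict (p := Subalgebra.toSubmodule (Inv n))
    (q := Subalgebra.toSubmodule (Inv n)) fun _ ha => act_mem_Inv g.2 ha

/-- The operator `g · f = g ∘ f ∘ g⁻¹` equivalent to `f` under the normalizer. -/
def conj {n : ℕ} (g : N n) (f : Inv n →ₗ[ℝ] Inv n) : Inv n →ₗ[ℝ] Inv n :=
  normAct g ∘ₗ f ∘ₗ normAct g⁻¹

/-! ### Complex-valued forms -/

/-- The algebra `ℂ ⊗ Λ*T` of complex-valued forms. -/
abbrev ExtC (n : ℕ) : Type := ℂ ⊗[ℝ] Ext n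

/-- The complex form `a + i b`. -/
def cplx {n : ℕ} (a b : Ext n) : ExtC n := (1 : ℂ) ⊗ₜ[ℝ] a + Complex.I ⊗ₜ[ℝ] b

/-- The real part of a complex form. -/
def reForm (n : ℕ) : ExtC n →ₗ[ℝ] Ext n :=
  (TensorProduct.lid ℝ (Ext n)).toLinearMap ∘ₗ LinearMap.rTensor (Ext n) Complex.reLm

/-- The imaginary part of a complex form. -/
def imForm (n : ℕ) : ExtC n →ₗ[ℝ] Ext n :=
  (TensorProduct.lid ℝ (Ext n)).toLinearMap ∘ₗ LinearMap.rTensor (Ext n) Complex.imLm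

/-- The basic one-form `θ^i`. -/
def θ (n : ℕ) (i : (Fin n × Fin 2) ⊕ Unit) : Ext n := ExteriorAlgebra.ι ℝ (e n i)

/-- `α = θ^{2n+1}`. -/
def alphaForm (n : ℕ) : Ext n := θ n (Sum.inr ())

/-- `F = θ^{12} + θ^{34} + ⋯ + θ^{2n-1,2n}`. -/
def FForm (n : ℕ) : Ext n := ∑ k : Fin n, θ n (Sum.inl (k, 0)) * θ n (Sum.inl (k, 1))

/-- `Ω = (θ^1 + i θ^2) ∧ ⋯ ∧ (θ^{2n-1} + i θ^{2n})`. -/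
def OmegaForm (n : ℕ) : ExtC n :=
  (List.ofFn fun k : Fin n => cplx (θ n (Sum.inl (k, 0))) (θ n (Sum.inl (k, 1)))).prod

/-! ### Invariance of the four forms -/

theorem cplx_re_im {n : ℕ} (w : ExtC n) : cplx (reForm n w) (imForm n w) = w := by
  induction w using TensorProduct.induction_on with
  | zero => simp [cplx]
  | add x y hx hy =>
    rw [map_add, map_add]
    nth_rewrite 3 [← hx]
    nth_rewrite 3 [← hy]
    simp only [cplx, TensorProduct.tmul_add]
    abel
  | tmul c x =>
    have h : c = c.re • (1 : ℂ) + c.im • Complex.I := by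
      apply Complex.ext <;> simp
    conv_rhs => rw [h, TensorProduct.add_tmul, TensorProduct.smul_tmul, TensorProduct.smul_tmul]
    simp [cplx, reForm, imForm]

/-- The complex-linear extension of the action of `O(T)`. -/
def actC {n : ℕ} (g : T n ≃ₗᵢ[ℝ] T n) : ExtC n →ₐ[ℂ] ExtC n :=
  Algebra.TensorProduct.map (AlgHom.id ℂ ℂ) (act g)

theorem reForm_actC {n : ℕ} (g : T n ≃ₗᵢ[ℝ] T n) (w : ExtC n) :
    reForm n (actC g w) = act g (reForm n w) := by
  induction w using TensorProduct.induction_on with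
  | zero => simp
  | add x y hx hy => simp only [map_add, hx, hy]
  | tmul c x => simp [reForm, actC]

theorem imForm_actC {n : ℕ} (g : T n ≃ₗᵢ[ℝ] T n) (w : ExtC n) :
    imForm n (actC g w) = act g (imForm n w) := by
  induction w using TensorProduct.induction_on with
  | zero => simp
  | add x y hx hy => simp only [map_add, hx, hy]
  | tmul c x => simp [imForm, actC]

theorem actC_cplx {n : ℕ} (g : T n ≃ₗᵢ[ℝ] T n) (a b : Ext n) :
    actC g (cplx a b) = cplx (act g a) (act g b) := by
  simp [actC, cplx]

theorem act_ι {n : ℕ} (g : T n ≃ₗᵢ[ℝ] T n) (v : T n) :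
    act g (ExteriorAlgebra.ι ℝ v) = ExteriorAlgebra.ι ℝ (g v) :=
  ExteriorAlgebra.map_apply_ι _ _

/-- `θ^{2k-1} + i θ^{2k}`. -/
def ζ (n : ℕ) (k : Fin n) : ExtC n := cplx (θ n (Sum.inl (k, 0))) (θ n (Sum.inl (k, 1)))

/-- `θ^{2k-1} - i θ^{2k}`. -/
def ζbar (n : ℕ) (k : Fin n) : ExtC n := cplx (θ n (Sum.inl (k, 0))) (-θ n (Sum.inl (k, 1)))

theorem vec_expand {n : ℕ} (v : T n) : v =
    ∑ k : Fin n, (v (Sum.inl (k, 0)) • e n (Sum.inl (k, 0))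
      + v (Sum.inl (k, 1)) • e n (Sum.inl (k, 1))) + v (Sum.inr ()) • e n (Sum.inr ()) := by
  have h := (EuclideanSpace.basisFun ((Fin n × Fin 2) ⊕ Unit) ℝ).sum_repr v
  rw [Fintype.sum_sum_type, Fintype.sum_prod_type] at h
  simp only [Fin.sum_univ_two, Finset.univ_unique, Finset.sum_singleton] at h
  conv_lhs => rw [← h]
  simp [e]

theorem ι_expand {n : ℕ} (v : T n) : (1 : ℂ) ⊗ₜ[ℝ] ExteriorAlgebra.ι ℝ v =
    (2⁻¹ : ℂ) • ∑ k : Fin n, (star (z v k) • ζ n k + z v k • ζbar n k)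
      + (v (Sum.inr ()) : ℂ) • ((1 : ℂ) ⊗ₜ[ℝ] alphaForm n) := by
  have key : ∀ (r : ℝ) (x : Ext n), (1 : ℂ) ⊗ₜ[ℝ] (r • x) = (r : ℂ) • ((1 : ℂ) ⊗ₜ[ℝ] x) := by
    intro r x
    rw [← TensorProduct.smul_tmul, TensorProduct.smul_tmul']
    congr 1
  conv_lhs => rw [vec_expand v]
  simp only [map_add, map_sum, map_smul, TensorProduct.tmul_add, TensorProduct.tmul_sum, key,
    alphaForm, θ]
  congr 1
  rw [Finset.smul_sum]
  refine Finset.sum_congr rfl fun k _ => ?_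
  have hI : ∀ x : Ext n, Complex.I ⊗ₜ[ℝ] x = Complex.I • ((1 : ℂ) ⊗ₜ[ℝ] x) := by
    intro x; rw [TensorProduct.smul_tmul']; simp
  simp only [ζ, ζbar, cplx, θ, z, TensorProduct.tmul_neg, hI]
  simp only [star_add, star_mul', Complex.star_def, Complex.conj_I, Complex.conj_ofReal]
  match_scalars
  · ring
  · ring_nf
    simp

theorem ζ_eq {n : ℕ} (k : Fin n) : ζ n k = (1 : ℂ) ⊗ₜ[ℝ] θ n (Sum.inl (k, 0))
    + Complex.I • ((1 : ℂ) ⊗ₜ[ℝ] θ n (Sum.inl (k, 1))) := by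
  simp [ζ, cplx, TensorProduct.smul_tmul']

theorem ζbar_eq {n : ℕ} (k : Fin n) : ζbar n k = (1 : ℂ) ⊗ₜ[ℝ] θ n (Sum.inl (k, 0))
    - Complex.I • ((1 : ℂ) ⊗ₜ[ℝ] θ n (Sum.inl (k, 1))) := by
  simp [ζbar, cplx, TensorProduct.smul_tmul', TensorProduct.tmul_neg, sub_eq_add_neg]

theorem z_e0 {n : ℕ} (k : Fin n) : z (e n (Sum.inl (k, 0))) = Pi.single k 1 := by
  ext l
  by_cases h : l = k <;> simp [z, e, h]

theorem z_e1 {n : ℕ} (k : Fin n) : z (e n (Sum.inl (k, 1))) = Complex.I • Pi.single k 1 := by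
  ext l
  by_cases h : l = k <;> simp [z, e, h]

theorem actC_one_tmul {n : ℕ} (g : T n ≃ₗᵢ[ℝ] T n) (x : Ext n) :
    actC g ((1 : ℂ) ⊗ₜ[ℝ] x) = (1 : ℂ) ⊗ₜ[ℝ] act g x := by simp [actC]

theorem actC_ζ {n : ℕ} {g : T n ≃ₗᵢ[ℝ] T n} {U : Matrix (Fin n) (Fin n) ℂ}
    (hg : ∀ v : T n, z (g v) = U.mulVec (z v) ∧ g v (Sum.inr ()) = v (Sum.inr ())) (k : Fin n) :
    actC g (ζ n k) = ∑ l, star (U l k) • ζ n l ∧ actC g (ζbar n k) = ∑ l, U l k • ζbar n l := by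
  have h0 : (1 : ℂ) ⊗ₜ[ℝ] act g (θ n (Sum.inl (k, 0))) =
      (2⁻¹ : ℂ) • ∑ l : Fin n, (star (U l k) • ζ n l + U l k • ζbar n l) := by
    rw [θ, act_ι, ι_expand, (hg _).1, (hg _).2, z_e0]
    simp [e]
  have h1 : (1 : ℂ) ⊗ₜ[ℝ] act g (θ n (Sum.inl (k, 1))) =
      (2⁻¹ : ℂ) • ∑ l : Fin n, ((-Complex.I * star (U l k)) • ζ n l
        + (Complex.I * U l k) • ζbar n l) := by
    rw [θ, act_ι, ι_expand, (hg _).1, (hg _).2, z_e1, Matrix.mulVec_smul]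
    simp [e]
  constructor
  · rw [ζ_eq, map_add, map_smul, actC_one_tmul, actC_one_tmul, h0, h1, Finset.smul_sum,
      Finset.smul_sum, Finset.smul_sum, ← Finset.sum_add_distrib]
    refine Finset.sum_congr rfl fun l _ => ?_
    match_scalars <;> (ring_nf; simp <;> ring)
  · rw [ζbar_eq, map_sub, map_smul, actC_one_tmul, actC_one_tmul, h0, h1, Finset.smul_sum,
      Finset.smul_sum, Finset.smul_sum, ← Finset.sum_sub_distrib]
    refine Finset.sum_congr rfl fun l _ => ?_
    match_scalars <;> (ring_nf; simp <;> ring)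

theorem alphaForm_mem (n : ℕ) : alphaForm n ∈ Inv n := by
  rintro g ⟨U, hU, hg⟩
  have h : g (e n (Sum.inr ())) = e n (Sum.inr ()) := by
    have hz : z (e n (Sum.inr ())) = 0 := by
      ext l; simp [z, e]
    have h1 := (hg (e n (Sum.inr ()))).1
    rw [hz, Matrix.mulVec_zero] at h1
    ext i
    rcases i with ⟨k, j⟩ | u
    · have h2 := congrFun h1 k
      have hre := congrArg Complex.re h2
      have him := congrArg Complex.im h2
      simp only [z, Pi.zero_apply, Complex.add_re, Complex.add_im, Complex.mul_re, Complex.mul_im,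
        Complex.I_re, Complex.I_im, Complex.ofReal_re, Complex.ofReal_im, Complex.zero_re,
        Complex.zero_im] at hre him
      fin_cases j
      · simpa [e] using hre
      · simpa [e] using him
    · exact (hg _).2
  rw [alphaForm, θ, act_ι, h]

theorem one_tmul_FForm (n : ℕ) :
    (1 : ℂ) ⊗ₜ[ℝ] FForm n = (Complex.I / 2) • ∑ k : Fin n, ζ n k * ζbar n k := by
  rw [FForm, TensorProduct.tmul_sum, Finset.smul_sum]
  refine Finset.sum_congr rfl fun k _ => ?_
  set x := θ n (Sum.inl (k, 0)) with hx
  set y := θ n (Sum.inl (k, 1)) with hy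
  have hxx : x * x = 0 := ExteriorAlgebra.ι_sq_zero _
  have hyy : y * y = 0 := ExteriorAlgebra.ι_sq_zero _
  have hyx : y * x = -(x * y) := eq_neg_of_add_eq_zero_left (ExteriorAlgebra.ι_add_mul_swap _ _)
  have h : ζ n k * ζbar n k = (-2 * Complex.I) ⊗ₜ[ℝ] (x * y) := by
    simp only [ζ, ζbar, cplx, ← hx, ← hy, add_mul, mul_add, Algebra.TensorProduct.tmul_mul_tmul,
      hxx, hyy, hyx, mul_neg, one_mul, mul_one, TensorProduct.tmul_neg, TensorProduct.tmul_zero,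
      add_zero, zero_add, ← TensorProduct.neg_tmul, ← TensorProduct.add_tmul]
    congr 1
    ring
  rw [h, TensorProduct.smul_tmul']
  congr 1
  rw [smul_eq_mul, show Complex.I / 2 * (-2 * Complex.I) = -(Complex.I * Complex.I) by ring,
    Complex.I_mul_I, neg_neg]

theorem FForm_mem (n : ℕ) : FForm n ∈ Inv n := by
  rintro g ⟨U, hU, hg⟩
  have hinv : actC g ((1 : ℂ) ⊗ₜ[ℝ] FForm n) = (1 : ℂ) ⊗ₜ[ℝ] FForm n := by
    rw [one_tmul_FForm, map_smul, map_sum]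
    congr 1
    have hUU : ∀ l m, ∑ k, star (U l k) * U m k = if l = m then 1 else 0 := by
      intro l m
      have h := congrFun (congrFun (Matrix.mem_unitaryGroup_iff.1 hU.1) m) l
      rw [Matrix.mul_apply, Matrix.one_apply] at h
      rw [show (if l = m then (1 : ℂ) else 0) = if m = l then 1 else 0 by simp [eq_comm], ← h]
      exact Finset.sum_congr rfl fun k _ => mul_comm _ _
    simp only [map_mul, (actC_ζ hg _).1, (actC_ζ hg _).2, Finset.sum_mul_sum, smul_mul_smul_comm]
    rw [Finset.sum_comm]
    refine Finset.sum_congr rfl fun l _ => ?_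
    rw [Finset.sum_comm]
    simp only [← Finset.sum_smul, hUU, ite_smul, one_smul, zero_smul, Finset.sum_ite_eq,
      Finset.mem_univ, if_true]
  have h := congrArg (reForm n) hinv
  rw [reForm_actC] at h
  simpa [reForm] using h

/-- The complex-linear map `ℂ^n → ℂ ⊗ Λ^1 T` sending the standard basis to the `ζ_k`. -/
def ζlin (n : ℕ) : (Fin n → ℂ) →ₗ[ℂ] ExtC n := Fintype.linearCombination ℂ (ζ n)

theorem ζ_anticomm {n : ℕ} (k l : Fin n) : ζ n k * ζ n l = -(ζ n l * ζ n k) := by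
  have h : ∀ i j, θ n i * θ n j = -(θ n j * θ n i) := fun i j =>
    eq_neg_of_add_eq_zero_left (ExteriorAlgebra.ι_add_mul_swap _ _)
  simp only [ζ, cplx, add_mul, mul_add, Algebra.TensorProduct.tmul_mul_tmul, one_mul, mul_one]
  rw [h (Sum.inl (k, 0)) (Sum.inl (l, 0)), h (Sum.inl (k, 0)) (Sum.inl (l, 1)),
    h (Sum.inl (k, 1)) (Sum.inl (l, 0)), h (Sum.inl (k, 1)) (Sum.inl (l, 1))]
  simp only [TensorProduct.tmul_neg]
  abel

theorem ζlin_sq {n : ℕ} (c : Fin n → ℂ) : ζlin n c * ζlin n c = 0 := by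
  have h : ζlin n c * ζlin n c = -(ζlin n c * ζlin n c) := by
    conv_lhs => rw [ζlin, Fintype.linearCombination_apply, Finset.sum_mul_sum, Finset.sum_comm]
    conv_rhs => rw [ζlin, Fintype.linearCombination_apply, Finset.sum_mul_sum]
    simp only [← Finset.sum_neg_distrib]
    refine Finset.sum_congr rfl fun k _ => Finset.sum_congr rfl fun l _ => ?_
    rw [smul_mul_smul_comm, smul_mul_smul_comm, ζ_anticomm, smul_neg, mul_comm (c l)]
  have h2 : (2 : ℂ) • (ζlin n c * ζlin n c) = 0 := by
    rw [two_smul]; nth_rewrite 1 [h]; exact neg_add_cancel _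
  exact (smul_eq_zero.1 h2).resolve_left two_ne_zero

/-- The alternating map `(c_1, …, c_n) ↦ ζ(c_1) ∧ ⋯ ∧ ζ(c_n)`. -/
def ζalt (n : ℕ) : (Fin n → ℂ) [⋀^Fin n]→ₗ[ℂ] ExtC n :=
  (ExteriorAlgebra.lift ℂ ⟨ζlin n, ζlin_sq⟩).toLinearMap.compAlternatingMap
    (ExteriorAlgebra.ιMulti ℂ n)

theorem ζalt_apply {n : ℕ} (c : Fin n → Fin n → ℂ) :
    ζalt n c = (List.ofFn fun k => ζlin n (c k)).prod := by
  simp [ζalt, ExteriorAlgebra.ιMulti_apply, map_list_prod, List.map_ofFn, Function.comp_def]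

theorem ζalt_det {n : ℕ} (c : Fin n → Fin n → ℂ) :
    ζalt n c = (Matrix.of c).det • ζalt n (Pi.basisFun ℂ (Fin n)) := by
  have h : ζalt n = (LinearMap.toSpanSingleton ℂ (ExtC n)
      (ζalt n (Pi.basisFun ℂ (Fin n)))).compAlternatingMap (Pi.basisFun ℂ (Fin n)).det := by
    refine Module.Basis.ext_alternating (Pi.basisFun ℂ (Fin n)) fun v hv => ?_
    obtain ⟨σ, rfl⟩ : ∃ σ : Equiv.Perm (Fin n), v = σ :=
      ⟨Equiv.ofBijective v (Finite.injective_iff_bijective.1 hv), rfl⟩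
    change ζalt n (Pi.basisFun ℂ (Fin n) ∘ σ) = (LinearMap.toSpanSingleton ℂ (ExtC n)
      (ζalt n (Pi.basisFun ℂ (Fin n)))).compAlternatingMap (Pi.basisFun ℂ (Fin n)).det
        (Pi.basisFun ℂ (Fin n) ∘ σ)
    rw [AlternatingMap.map_perm, AlternatingMap.map_perm, LinearMap.compAlternatingMap_apply,
      Module.Basis.det_self, LinearMap.toSpanSingleton_apply, one_smul]
  conv_lhs => rw [h]
  rw [LinearMap.compAlternatingMap_apply, LinearMap.toSpanSingleton_apply, Pi.basisFun_det_apply]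

theorem actC_OmegaForm {n : ℕ} {g : T n ≃ₗᵢ[ℝ] T n} (hg : g ∈ SU n) :
    actC g (OmegaForm n) = OmegaForm n := by
  obtain ⟨U, hU, hg⟩ := hg
  have h1 : OmegaForm n = ζalt n (Pi.basisFun ℂ (Fin n)) := by
    rw [ζalt_apply, OmegaForm]
    congr 2
    funext k
    rw [ζlin, Fintype.linearCombination_apply]
    simp [Pi.single_apply, ζ]
  have h2 : actC g (OmegaForm n) = ζalt n fun k l => star (U l k) := by
    rw [ζalt_apply, OmegaForm, map_list_prod, List.map_ofFn]
    congr 2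
    funext k
    exact (actC_ζ hg k).1
  have h3 : (Matrix.of fun k l => star (U l k)).det = 1 := by
    have h4 : U.conjTranspose.det = 1 := by
      rw [Matrix.det_conjTranspose, (Matrix.mem_specialUnitaryGroup_iff.1 hU).2, star_one]
    exact h4
  rw [h2, ζalt_det, h3, one_smul, h1]

/-! ### The four invariant forms as elements of `(Λ*T)^{SU(n)}` -/

/-- The invariant form `α`. -/
def α (n : ℕ) : Inv n := ⟨alphaForm n, alphaForm_mem n⟩

/-- The invariant form `F`. -/
def F (n : ℕ) : Inv n := ⟨FForm n, FForm_mem n⟩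

/-- The invariant form `Ω⁺`, the real part of `Ω`. -/
def Ωp (n : ℕ) : Inv n := ⟨reForm n (OmegaForm n), fun g hg => by
  rw [← reForm_actC, actC_OmegaForm hg]⟩

/-- The invariant form `Ω⁻`, the imaginary part of `Ω`. -/
def Ωm (n : ℕ) : Inv n := ⟨imForm n (OmegaForm n), fun g hg => by
  rw [← imForm_actC, actC_OmegaForm hg]⟩

/-- The complex form `Ω = Ω⁺ + i Ω⁻`, as an element of `ℂ ⊗ (Λ*T)^{SU(n)}`. -/
def Ω (n : ℕ) : ℂ ⊗[ℝ] Inv n := (1 : ℂ) ⊗ₜ[ℝ] Ωp n + Complex.I ⊗ₜ[ℝ] Ωm n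

theorem map_Ω (n : ℕ) :
    Algebra.TensorProduct.map (AlgHom.id ℂ ℂ) (Inv n).val (Ω n) = OmegaForm n := by
  rw [Ω, map_add]
  exact cplx_re_im _

/-- The complex-linear extension of `f` to complex-valued invariant forms. -/
def extC {n : ℕ} (f : Inv n →ₗ[ℝ] Inv n) : ℂ ⊗[ℝ] Inv n →ₗ[ℂ] ℂ ⊗[ℝ] Inv n := f.baseChange ℂ

/-! ### The families of operators -/

/-- `f(α) = 0`, `f(F) = 2λ α ∧ F`, `f(Ω) = n(λ - μ i) α ∧ Ω`. -/
def TypeA {n : ℕ} (f : Inv n →ₗ[ℝ] Inv n) (lam mu : ℝ) : Prop :=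
  f (α n) = 0 ∧ f (F n) = (2 * lam) • (α n * F n) ∧
    extC f (Ω n) = ((n : ℂ) * ((lam : ℂ) - (mu : ℂ) * Complex.I)) • (((1 : ℂ) ⊗ₜ[ℝ] α n) * Ω n)

/-- `f(α) = λ F`, `f(F) = 0`, `f(Ω) = -μ i α ∧ Ω`. -/
def TypeB {n : ℕ} (f : Inv n →ₗ[ℝ] Inv n) (lam mu : ℝ) : Prop :=
  f (α n) = lam • F n ∧ f (F n) = 0 ∧
    extC f (Ω n) = (-(mu : ℂ) * Complex.I) • (((1 : ℂ) ⊗ₜ[ℝ] α n) * Ω n)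

/-- `f(α) = 0`, `f(F) = 3λ Ω⁻ - 3μ Ω⁺`, `f(Ω) = 2(λ + i μ) F ∧ F`. -/
def TypeD {n : ℕ} (f : Inv n →ₗ[ℝ] Inv n) (lam mu : ℝ) : Prop :=
  f (α n) = 0 ∧ f (F n) = (3 * lam) • Ωm n - (3 * mu) • Ωp n ∧
    extC f (Ω n) = (2 * ((lam : ℂ) + Complex.I * (mu : ℂ))) • ((1 : ℂ) ⊗ₜ[ℝ] (F n * F n))

end OddSU

end

noncomputable section

namespace OddSU

/-! ### Complex one-forms and sign rules -/

variable {n : ℕ}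

/-! Diagonal and permutation matrices in SU(n) already force every complexified invariant into the
span of F^k, Ω, Ω̄ and their products with α. The relations that matter are F∧Ω = F∧Ω̄ = 0, Ω∧Ω = 0
and Ω̄∧Ω = κ F^n with κ ≠ 0, together with α∧F^n ≠ 0. By degree, f(Ω) is a combination of α∧Ω, α∧Ω̄
and one further form X, which is F^((n+1)/2) or α∧F^(n/2) according to the parity of n.

Suppose that f extends to D on Λ*T, and that f(F) = 2λ α∧F + R with R∧F = 0. Three identities
restrict f. Since Ω is decomposable and n ≥ 2, D(Ω)∧Ω = 0, which removes α∧Ω̄ from f(Ω)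
(`cMap_OmegaForm_mul_OmegaForm`, `coefficient_relations`); this is the identity whose proof
evaluates D on forms that are not invariant. Applying D to Ω̄∧Ω = κ F^n makes the real part of the
coefficient of α∧Ω equal to nλ (`trace_relation`). Applying D to F∧Ω = 0 ties the coefficient of X
to R∧Ω (`exists_coefficients`). If f(α) = cF and R = 0, then X drops out and f²(α) = 0 gives cλ = 0,
so f is of type A or B (`typeA_or_typeB`).

For n ≥ 3, f(α) is a multiple of F, and R can be nonzero only if n = 3, being then a combination of
Ω⁺ and Ω⁻. In that case f² = 0 gives c = 0 and equates 2λ with the coefficient 3λ of α∧Ω, so λ = 0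
and type D remains (`typeD_of_three`).

For n = 2 the invariant two-forms are the 3-space of F, Ω⁺, Ω⁻, and the invariant three-forms are α
times it. Some line in this space contains f(α) and is preserved by f up to the factor α: the line
of f(α) if that is nonzero, otherwise a real eigenline of a 3×3 matrix. Unit quaternions commuting
with SU(2) rotate the line to that of F, which reduces to the previous analysis
(`exists_conj_typeA_or_typeB`).

Conversely, a derivation of Λ*T may be prescribed freely on one-forms (`exists_derivation`).
Suitable values on α and on the complex coframe reproduce each family on the generators, and f² = 0
needs checking only there (`isDifferentialOperator_of_derivation`). -/

/-- The complex-valued one-forms. -/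
def oneForms (n : ℕ) : Submodule ℂ (ExtC n) :=
  Submodule.span ℂ (Set.range fun v : T n => (1 : ℂ) ⊗ₜ[ℝ] ExteriorAlgebra.ι ℝ v)

theorem oneForms_anticomm {x y : ExtC n} (hx : x ∈ oneForms n) (hy : y ∈ oneForms n) :
    x * y = (-1 : ℂ) • (y * x) := by
  induction hx, hy using Submodule.span_induction₂ with
  | mem_mem x y hx hy =>
    obtain ⟨v, rfl⟩ := hx
    obtain ⟨w, rfl⟩ := hy
    simp only [Algebra.TensorProduct.tmul_mul_tmul, mul_one, neg_smul, one_smul,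
      ← TensorProduct.tmul_neg]
    congr 1
    exact eq_neg_of_add_eq_zero_left (ExteriorAlgebra.ι_add_mul_swap _ _)
  | zero_left y hy => simp
  | zero_right x hx => simp
  | add_left x y z _ _ _ h1 h2 => rw [add_mul, mul_add, h1, h2, smul_add]
  | add_right x y z _ _ _ h1 h2 => rw [add_mul, mul_add, h1, h2, smul_add]
  | smul_left r x y _ _ h => rw [smul_mul_assoc, mul_smul_comm, h, smul_comm]
  | smul_right r x y _ _ h => rw [smul_mul_assoc, mul_smul_comm, h, smul_comm]

theorem oneForms_sq {x : ExtC n} (hx : x ∈ oneForms n) : x * x = 0 := by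
  have h := oneForms_anticomm hx hx
  have h2 : (2 : ℂ) • (x * x) = 0 := by
    rw [neg_smul, one_smul] at h
    rw [two_smul]
    nth_rewrite 1 [h]
    exact neg_add_cancel _
  exact (smul_eq_zero.1 h2).resolve_left two_ne_zero

theorem tmul_ι_mem_oneForms (c : ℂ) (v : T n) : c ⊗ₜ[ℝ] ExteriorAlgebra.ι ℝ v ∈ oneForms n := by
  have h : c ⊗ₜ[ℝ] ExteriorAlgebra.ι ℝ v = c • ((1 : ℂ) ⊗ₜ[ℝ] ExteriorAlgebra.ι ℝ v) := by
    rw [TensorProduct.smul_tmul', smul_eq_mul, mul_one]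
  rw [h]
  exact Submodule.smul_mem _ _ (Submodule.subset_span ⟨v, rfl⟩)

theorem ζ_mem_oneForms (k : Fin n) : ζ n k ∈ oneForms n :=
  add_mem (tmul_ι_mem_oneForms _ _) (tmul_ι_mem_oneForms _ _)

theorem ζbar_mem_oneForms (k : Fin n) : ζbar n k ∈ oneForms n := by
  rw [ζbar_eq]
  exact sub_mem (tmul_ι_mem_oneForms _ _) (Submodule.smul_mem _ _ (tmul_ι_mem_oneForms _ _))

/-- The form `α` as a complex-valued form. -/
def αC (n : ℕ) : ExtC n := (1 : ℂ) ⊗ₜ[ℝ] alphaForm n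

theorem αC_mem_oneForms : αC n ∈ oneForms n := tmul_ι_mem_oneForms _ _

/-- The form `F` as a complex-valued form. -/
def FC (n : ℕ) : ExtC n := (1 : ℂ) ⊗ₜ[ℝ] FForm n

/-- The decomposable form `ζ_k ∧ ζbar_k`. -/
def ζζ (n : ℕ) (k : Fin n) : ExtC n := ζ n k * ζbar n k

/-- The conjugate of `Ω`. -/
def OmegaBar (n : ℕ) : ExtC n := (List.ofFn fun k : Fin n => ζbar n k).prod

theorem OmegaForm_eq (n : ℕ) : OmegaForm n = (List.ofFn fun k : Fin n => ζ n k).prod := rfl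

theorem FC_eq (n : ℕ) : FC n = (Complex.I / 2) • ∑ k, ζζ n k := one_tmul_FForm n

/-- Complex conjugation of complex-valued forms. -/
def conjC (n : ℕ) : ExtC n →ₐ[ℝ] ExtC n :=
  Algebra.TensorProduct.map (Complex.conjAe : ℂ →ₐ[ℝ] ℂ) (AlgHom.id ℝ (Ext n))

theorem conjC_cplx (a b : Ext n) : conjC n (cplx a b) = cplx a (-b) := by
  simp [conjC, cplx, TensorProduct.neg_tmul, TensorProduct.tmul_neg]

theorem conjC_ζ (k : Fin n) : conjC n (ζ n k) = ζbar n k := conjC_cplx _ _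

theorem conjC_OmegaForm : conjC n (OmegaForm n) = OmegaBar n := by
  rw [OmegaForm_eq, map_list_prod, List.map_ofFn]
  congr 2
  funext k
  exact conjC_ζ k

theorem OmegaBar_eq_cplx :
    OmegaBar n = cplx (reForm n (OmegaForm n)) (-imForm n (OmegaForm n)) := by
  rw [← conjC_OmegaForm, ← conjC_cplx, cplx_re_im]

/-! ### Commutation up to a scalar in products -/

/-- The two elements commute up to sign. -/
def SignCommute (x y : ExtC n) : Prop := ∃ ε : ℂ, x * y = ε • (y * x)

theorem SignCommute.one_right (x : ExtC n) : SignCommute x 1 := ⟨1, by simp⟩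

theorem SignCommute.mul_right {x y z : ExtC n} (hy : SignCommute x y) (hz : SignCommute x z) :
    SignCommute x (y * z) := by
  obtain ⟨a, ha⟩ := hy
  obtain ⟨b, hb⟩ := hz
  exact ⟨a * b, by rw [← mul_assoc, ha, smul_mul_assoc, mul_assoc, hb, mul_smul_comm, smul_smul,
    mul_assoc]⟩

theorem signCommute_of_mem {x y : ExtC n} (hx : x ∈ oneForms n) (hy : y ∈ oneForms n) :
    SignCommute x y := ⟨-1, oneForms_anticomm hx hy⟩

theorem SignCommute.list_prod {x : ExtC n} {l : List (ExtC n)} (h : ∀ y ∈ l, SignCommute x y) :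
    SignCommute x l.prod := by
  induction l with
  | nil => exact SignCommute.one_right x
  | cons y l ih =>
    rw [List.prod_cons]
    exact (h y (by simp)).mul_right (ih fun z hz => h z (by simp [hz]))

/-- Moving x to the right as far as the k-th factor costs only scalars, and x is absorbed there. The
resulting scalar is irrelevant for spanning arguments, so it is left unspecified. -/
theorem mul_list_prod_update {ι : Type*} [DecidableEq ι] {x y : ExtC n} {c : ℂ} (m : ι → ExtC n)
    (k : ι) (hk : x * m k = c • y) (l : List ι) (hl : l.Nodup) (hkl : k ∈ l)
    (h : ∀ j ∈ l, j ≠ k → SignCommute x (m j)) :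
    ∃ d : ℂ, x * (l.map m).prod = d • (l.map (Function.update m k y)).prod := by
  induction l with
  | nil => simp at hkl
  | cons j l ih =>
    rw [List.map_cons, List.map_cons, List.prod_cons, List.prod_cons]
    rw [List.nodup_cons] at hl
    by_cases hj : j = k
    · subst hj
      refine ⟨c, ?_⟩
      have hm : l.map (Function.update m j y) = l.map m :=
        List.map_congr_left fun i hi => Function.update_of_ne (fun h : i = j => hl.1 (h ▸ hi)) _ _
      rw [hm, Function.update_self, ← mul_assoc, hk, smul_mul_assoc]
    · obtain ⟨d, hd⟩ := ih hl.2 ((List.mem_cons.1 hkl).resolve_left (Ne.symm hj))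
        fun i hi => h i (by simp [hi])
      rw [Function.update_of_ne hj, ← mul_assoc]
      obtain ⟨ε, h1⟩ := h j (by simp) hj
      exact ⟨ε * d, by rw [h1, smul_mul_assoc, mul_assoc, hd, mul_smul_comm, smul_smul]⟩

/-! ### The spanning monomials -/

/-- The forms `1`, `ζ_k`, `ζbar_k`, `ζ_k ∧ ζbar_k`. -/
def blk (k : Fin n) (b : Bool × Bool) : ExtC n :=
  (if b.1 then ζ n k else 1) * (if b.2 then ζbar n k else 1)

/-- The monomials in the `ζ_k`, `ζbar_k`, and `α`. -/
def mono (s : Fin n → Bool × Bool) (ε : Bool) : ExtC n :=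
  (List.ofFn fun k => blk k (s k)).prod * (if ε then αC n else 1)

theorem signCommute_blk {x : ExtC n} (hx : x ∈ oneForms n) (k : Fin n) (b : Bool × Bool) :
    SignCommute x (blk k b) := by
  refine SignCommute.mul_right ?_ ?_
  · split_ifs
    exacts [signCommute_of_mem hx (ζ_mem_oneForms k), .one_right x]
  · split_ifs
    exacts [signCommute_of_mem hx (ζbar_mem_oneForms k), .one_right x]

theorem ζbar_mul_ζ (k : Fin n) : ζbar n k * ζ n k = (-1 : ℂ) • (ζ n k * ζbar n k) :=
  oneForms_anticomm (ζbar_mem_oneForms k) (ζ_mem_oneForms k)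

theorem ζ_mul_self (k : Fin n) : ζ n k * ζ n k = 0 := oneForms_sq (ζ_mem_oneForms k)

theorem ζbar_mul_self (k : Fin n) : ζbar n k * ζbar n k = 0 := oneForms_sq (ζbar_mem_oneForms k)

theorem ζ_mul_blk (k : Fin n) (b : Bool × Bool) :
    ∃ (c : ℂ) (b' : Bool × Bool), ζ n k * blk k b = c • blk k b' := by
  rcases b with ⟨_ | _, i⟩
  · exact ⟨1, (true, i), by simp [blk]⟩
  · exact ⟨0, (true, i), by simp [blk, ← mul_assoc, ζ_mul_self]⟩

theorem ζbar_mul_blk (k : Fin n) (b : Bool × Bool) :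
    ∃ (c : ℂ) (b' : Bool × Bool), ζbar n k * blk k b = c • blk k b' := by
  rcases b with ⟨_ | _, _ | _⟩
  · exact ⟨1, (false, true), by simp [blk]⟩
  · exact ⟨0, (false, true), by simp [blk, ζbar_mul_self]⟩
  · exact ⟨-1, (true, true), by simpa [blk] using ζbar_mul_ζ k⟩
  · refine ⟨0, (true, true), ?_⟩
    simp only [blk, if_true, ← mul_assoc, ζbar_mul_ζ, smul_mul_assoc]
    rw [mul_assoc, ζbar_mul_self, mul_zero, smul_zero, zero_smul]

theorem mul_mono_of_blk {x : ExtC n} (hx : x ∈ oneForms n) {k : Fin n}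
    (h : ∀ b, ∃ (c : ℂ) (b' : Bool × Bool), x * blk k b = c • blk k b')
    (s : Fin n → Bool × Bool) (ε : Bool) : ∃ (c : ℂ) (s' : Fin n → Bool × Bool),
      x * mono s ε = c • mono s' ε := by
  obtain ⟨c, b', hb⟩ := h (s k)
  obtain ⟨d, hd⟩ := mul_list_prod_update (fun j => blk j (s j)) k hb (List.finRange n)
    (List.nodup_finRange n) (List.mem_finRange k) fun j _ _ => signCommute_blk hx j _
  refine ⟨d, Function.update s k b', ?_⟩
  rw [mono, mono, ← mul_assoc, List.ofFn_eq_map, hd, smul_mul_assoc, List.ofFn_eq_map]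
  congr 4
  funext j
  by_cases hj : j = k
  · subst hj; simp
  · simp [Function.update_of_ne hj]

theorem αC_mul_mono (s : Fin n → Bool × Bool) (ε : Bool) : ∃ (c : ℂ) (ε' : Bool),
    αC n * mono s ε = c • mono s ε' := by
  have h : SignCommute (αC n) (List.ofFn fun k => blk k (s k)).prod := by
    refine SignCommute.list_prod fun y hy => ?_
    obtain ⟨k, rfl⟩ := (List.mem_ofFn' _ _).1 hy
    exact signCommute_blk αC_mem_oneForms _ _
  have hsq : αC n * αC n = 0 := oneForms_sq αC_mem_oneForms
  obtain ⟨c, hc⟩ := h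
  simp only [mono, ← mul_assoc, hc, smul_mul_assoc]
  cases ε
  · exact ⟨c, true, by simp⟩
  · exact ⟨0, true, by simp [mul_assoc, hsq]⟩

/-- The span contains 1 and is stable under left multiplication by each ζ_k, ζbar_k and α. These
span the one-forms, and one-forms generate the algebra. -/
theorem span_mono : Submodule.span ℂ (Set.range fun p : (Fin n → Bool × Bool) × Bool =>
    mono p.1 p.2) = ⊤ := by
  set M := Submodule.span ℂ (Set.range fun p : (Fin n → Bool × Bool) × Bool => mono p.1 p.2)
  have hM : ∀ (c : ℂ) (s : Fin n → Bool × Bool) (ε : Bool), c • mono s ε ∈ M := fun c s ε =>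
    Submodule.smul_mem _ _ (Submodule.subset_span ⟨(s, ε), rfl⟩)
  have key : ∀ x : ExtC n, (∀ s ε, x * mono s ε ∈ M) → ∀ w ∈ M, x * w ∈ M := by
    intro x hx w hw
    induction hw using Submodule.span_induction with
    | mem w hw => obtain ⟨p, rfl⟩ := hw; exact hx _ _
    | zero => simp
    | add a b _ _ ha hb => rw [mul_add]; exact add_mem ha hb
    | smul c a _ ha => rw [mul_smul_comm]; exact Submodule.smul_mem _ _ ha
  have hζ : ∀ k, ∀ w ∈ M, ζ n k * w ∈ M := fun k => key _ fun s ε => by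
    obtain ⟨c, s', h⟩ := mul_mono_of_blk (ζ_mem_oneForms k) (ζ_mul_blk k) s ε
    rw [h]; exact hM _ _ _
  have hζbar : ∀ k, ∀ w ∈ M, ζbar n k * w ∈ M := fun k => key _ fun s ε => by
    obtain ⟨c, s', h⟩ := mul_mono_of_blk (ζbar_mem_oneForms k) (ζbar_mul_blk k) s ε
    rw [h]; exact hM _ _ _
  have hα : ∀ w ∈ M, αC n * w ∈ M := key _ fun s ε => by
    obtain ⟨c, ε', h⟩ := αC_mul_mono s ε
    rw [h]; exact hM _ _ _
  have hall : ∀ y : Ext n, ∀ w ∈ M, ((1 : ℂ) ⊗ₜ[ℝ] y) * w ∈ M := by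
    intro y
    induction y using ExteriorAlgebra.induction with
    | algebraMap r =>
      intro w hw
      rw [Algebra.algebraMap_eq_smul_one, TensorProduct.tmul_smul, TensorProduct.smul_tmul']
      have h : ((r • (1 : ℂ)) ⊗ₜ[ℝ] (1 : Ext n)) = (r : ℂ) • (1 : ExtC n) := by
        rw [Algebra.TensorProduct.one_def, TensorProduct.smul_tmul']; simp
      rw [h, smul_mul_assoc, one_mul]
      exact Submodule.smul_mem _ _ hw
    | ι v =>
      intro w hw
      rw [ι_expand, add_mul, smul_mul_assoc, smul_mul_assoc, Finset.sum_mul]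
      refine add_mem (Submodule.smul_mem _ _ (sum_mem fun k _ => ?_))
        (Submodule.smul_mem _ _ (hα w hw))
      rw [add_mul, smul_mul_assoc, smul_mul_assoc]
      exact add_mem (Submodule.smul_mem _ _ (hζ k w hw)) (Submodule.smul_mem _ _ (hζbar k w hw))
    | mul a b ha hb =>
      intro w hw
      have h : (1 : ℂ) ⊗ₜ[ℝ] (a * b) = ((1 : ℂ) ⊗ₜ[ℝ] a) * ((1 : ℂ) ⊗ₜ[ℝ] b) := by simp
      rw [h, mul_assoc]
      exact ha _ (hb _ hw)
    | add a b ha hb =>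
      intro w hw
      rw [TensorProduct.tmul_add, add_mul]
      exact add_mem (ha w hw) (hb w hw)
  have h1 : (1 : ExtC n) ∈ M := by
    refine Submodule.subset_span ⟨(fun _ => (false, false), false), ?_⟩
    simp [mono, blk, List.ofFn_const]
  rw [eq_top_iff]
  rintro w -
  induction w using TensorProduct.induction_on with
  | zero => exact zero_mem _
  | add x y hx hy => exact add_mem hx hy
  | tmul c y =>
    have h := Submodule.smul_mem M c (hall y 1 h1)
    rwa [mul_one, TensorProduct.smul_tmul', smul_eq_mul, mul_one] at h

/-! ### Isometries realizing matrices of SU(n) -/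

theorem norm_sq_eq_sum_z (v : T n) :
    ‖v‖ ^ 2 = ∑ k, Complex.normSq (z v k) + v (Sum.inr ()) ^ 2 := by
  rw [EuclideanSpace.norm_sq_eq, Fintype.sum_sum_type, Fintype.sum_prod_type]
  simp [z, Complex.normSq_apply, Fin.sum_univ_two, sq]

/-- The vector of `T` with given complex coordinates and last coordinate. -/
def ofComplex (w : Fin n → ℂ) (r : ℝ) : T n :=
  WithLp.toLp 2 (Sum.elim (fun p => if p.2 = 0 then (w p.1).re else (w p.1).im) fun _ => r)

@[simp] theorem z_ofComplex (w : Fin n → ℂ) (r : ℝ) : z (ofComplex w r) = w := by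
  ext k
  apply Complex.ext <;> simp [z, ofComplex]

@[simp] theorem ofComplex_last (w : Fin n → ℂ) (r : ℝ) : ofComplex w r (Sum.inr ()) = r := rfl

theorem ext_z {v w : T n} (h : z v = z w) (h' : v (Sum.inr ()) = w (Sum.inr ())) : v = w := by
  ext i
  rcases i with ⟨k, j⟩ | u
  · have hk := congrFun h k
    fin_cases j
    · simpa [z] using congrArg Complex.re hk
    · simpa [z] using congrArg Complex.im hk
  · exact h'

theorem z_add (v w : T n) : z (v + w) = z v + z w := by
  ext k; simp [z]; ring

theorem z_smul (r : ℝ) (v : T n) : z (r • v) = (r : ℂ) • z v := by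
  ext k; simp [z]; ring

/-- A norm preserving real linear map of `ℂ^n` extends to an isometry of `T`. -/
theorem exists_isometry (L : (Fin n → ℂ) →ₗ[ℝ] (Fin n → ℂ))
    (hL : ∀ w, ∑ k, Complex.normSq (L w k) = ∑ k, Complex.normSq (w k)) :
    ∃ g : T n ≃ₗᵢ[ℝ] T n, ∀ v, z (g v) = L (z v) ∧ g v (Sum.inr ()) = v (Sum.inr ()) := by
  let A : T n →ₗᵢ[ℝ] T n :=
    { toFun := fun v => ofComplex (L (z v)) (v (Sum.inr ()))
      map_add' := fun v w => ext_z (by simp [z_add]) (by simp)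
      map_smul' := fun r v => ext_z (by
        simp only [z_ofComplex, z_smul, RingHom.id_apply, Complex.coe_smul, map_smul]) (by simp)
      norm_map' := fun v => by
        have h : ‖ofComplex (L (z v)) (v (Sum.inr ()))‖ ^ 2 = ‖v‖ ^ 2 := by
          rw [norm_sq_eq_sum_z, norm_sq_eq_sum_z v, z_ofComplex, hL, ofComplex_last]
        exact (sq_eq_sq₀ (norm_nonneg _) (norm_nonneg _)).1 h }
  refine ⟨A.toLinearIsometryEquiv rfl, fun v => ⟨?_, ?_⟩⟩
  · exact z_ofComplex _ _
  · exact ofComplex_last _ _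

theorem exists_mem_SU {U : Matrix (Fin n) (Fin n) ℂ}
    (hU : U ∈ Matrix.specialUnitaryGroup (Fin n) ℂ) : ∃ g ∈ SU n,
      ∀ v : T n, z (g v) = U.mulVec (z v) ∧ g v (Sum.inr ()) = v (Sum.inr ()) := by
  obtain ⟨g, hg⟩ := exists_isometry (U.mulVecLin.restrictScalars ℝ) fun w => by
    have h : star (U.mulVec w) ⬝ᵥ U.mulVec w = star w ⬝ᵥ w := by
      rw [Matrix.star_mulVec, Matrix.dotProduct_mulVec, Matrix.vecMul_vecMul,
        ← Matrix.star_eq_conjTranspose, Matrix.mem_unitaryGroup_iff'.1 hU.1, Matrix.vecMul_one]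
    have key : ∀ w : Fin n → ℂ, ((∑ k, Complex.normSq (w k) : ℝ) : ℂ) = star w ⬝ᵥ w := by
      intro w
      rw [dotProduct, Complex.ofReal_sum]
      exact Finset.sum_congr rfl fun k _ => Complex.normSq_eq_conj_mul_self
    exact Complex.ofReal_injective ((key _).trans (h.trans (key w).symm))
  exact ⟨g, ⟨U, hU, hg⟩, hg⟩

theorem actC_αC {g : T n ≃ₗᵢ[ℝ] T n} (hg : g ∈ SU n) : actC g (αC n) = αC n := by
  rw [αC, actC_one_tmul, alphaForm_mem n g hg]

theorem conjC_actC (g : T n ≃ₗᵢ[ℝ] T n) (w : ExtC n) : conjC n (actC g w) = actC g (conjC n w) := by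
  induction w using TensorProduct.induction_on with
  | zero => simp
  | add x y hx hy => simp only [map_add, hx, hy]
  | tmul c x => simp [conjC, actC]

theorem actC_OmegaBar {g : T n ≃ₗᵢ[ℝ] T n} (hg : g ∈ SU n) :
    actC g (OmegaBar n) = OmegaBar n := by
  rw [← conjC_OmegaForm, ← conjC_actC, actC_OmegaForm hg]

/-! ### Diagonal matrices and weights -/

/-- The weight of `blk k b` under the multiplication of the `k`-th coordinate by `t`. -/
def blkWeight (t : ℂ) (b : Bool × Bool) : ℂ :=
  (if b.1 then star t else 1) * (if b.2 then t else 1)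

theorem exists_diagonal {t : Fin n → ℂ} (ht : ∀ k, star (t k) * t k = 1) (hdet : ∏ k, t k = 1) :
    ∃ g ∈ SU n, ∀ s ε, actC g (mono s ε) = (∏ k, blkWeight (t k) (s k)) • mono s ε := by
  have hU : Matrix.diagonal t ∈ Matrix.specialUnitaryGroup (Fin n) ℂ := by
    rw [Matrix.mem_specialUnitaryGroup_iff, Matrix.mem_unitaryGroup_iff']
    refine ⟨?_, by rw [Matrix.det_diagonal, hdet]⟩
    rw [Matrix.star_eq_conjTranspose, Matrix.diagonal_conjTranspose, Matrix.diagonal_mul_diagonal,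
      ← Matrix.diagonal_one]
    congr 1
    exact funext ht
  obtain ⟨g, hg, hgz⟩ := exists_mem_SU hU
  refine ⟨g, hg, fun s ε => ?_⟩
  have hblk : ∀ k b, actC g (blk k b) = blkWeight (t k) b • blk k b := by
    intro k b
    have h1 : actC g (ζ n k) = star (t k) • ζ n k := by
      rw [(actC_ζ hgz k).1, Finset.sum_eq_single k (fun l _ hl => by simp [hl]) (by simp)]
      simp
    have h2 : actC g (ζbar n k) = t k • ζbar n k := by
      rw [(actC_ζ hgz k).2, Finset.sum_eq_single k (fun l _ hl => by simp [hl]) (by simp)]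
      simp
    rw [blk, blkWeight, ← smul_mul_smul_comm, map_mul]
    congr 1 <;> split_ifs <;> simp [h1, h2]
  have hα : actC g (if ε then αC n else 1) = if ε then αC n else 1 := by
    split_ifs
    exacts [actC_αC hg, map_one _]
  have hl : ∀ l : List (Fin n), (l.map fun k => blkWeight (t k) (s k) • blk k (s k)).prod =
      (l.map fun k => blkWeight (t k) (s k)).prod • (l.map fun k => blk k (s k)).prod := by
    intro l
    induction l with
    | nil => simp
    | cons k l ih =>
      simp only [List.map_cons, List.prod_cons, ih]
      exact smul_mul_smul_comm _ _ _ _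
  rw [mono, map_mul, hα, map_list_prod, List.map_ofFn, ← smul_mul_assoc]
  congr 1
  rw [List.ofFn_eq_map, List.ofFn_eq_map, ← List.prod_ofFn, List.ofFn_eq_map, ← hl]
  congr 2
  funext k
  exact hblk _ _

/-- The average P = (1 + g + g² + g³)/4 fixes w. It fixes the eigenvectors of eigenvalue 1 and kills
those whose eigenvalue is another fourth root of unity. -/
theorem mem_span_of_order_four {M : Type*} [AddCommGroup M] [Module ℂ M] (g : M →ₗ[ℂ] M)
    {ι : Type*} (m : ι → M) (χ : ι → ℂ) (hm : ∀ i, g (m i) = χ i • m i) (hχ : ∀ i, χ i ^ 4 = 1)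
    (S : Set ι) {w : M} (hw : w ∈ Submodule.span ℂ (m '' S)) (hgw : g w = w) :
    w ∈ Submodule.span ℂ (m '' {i ∈ S | χ i = 1}) := by
  let P : M →ₗ[ℂ] M := (4⁻¹ : ℂ) • (1 + g + g ^ 2 + g ^ 3)
  have hPw : P w = w := by
    simp only [P, LinearMap.smul_apply, LinearMap.add_apply, Module.End.one_apply, pow_succ,
      pow_zero, one_mul, Module.End.mul_apply, hgw]
    module
  have hP : ∀ i ∈ S, P (m i) ∈ Submodule.span ℂ (m '' {i ∈ S | χ i = 1}) := by
    intro i hi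
    have h : P (m i) = (4⁻¹ * (1 + χ i + χ i ^ 2 + χ i ^ 3)) • m i := by
      simp only [P, LinearMap.smul_apply, LinearMap.add_apply, Module.End.one_apply, pow_succ,
        pow_zero, one_mul, Module.End.mul_apply, hm, map_smul]
      module
    by_cases h1 : χ i = 1
    · rw [h]
      exact Submodule.smul_mem _ _ (Submodule.subset_span ⟨i, ⟨hi, h1⟩, rfl⟩)
    · have h2 : (1 + χ i + χ i ^ 2 + χ i ^ 3) = 0 := by
        refine (mul_eq_zero.1 (?_ : (χ i - 1) * (1 + χ i + χ i ^ 2 + χ i ^ 3) = 0)).resolve_left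
          (sub_ne_zero.2 h1)
        linear_combination hχ i
      rw [h, h2, mul_zero, zero_smul]
      exact zero_mem _
  have hle : Submodule.span ℂ (m '' S) ≤
      (Submodule.span ℂ (m '' {i ∈ S | χ i = 1})).comap P := by
    rw [Submodule.span_le]
    rintro _ ⟨i, hi, rfl⟩
    exact hP i hi
  have := hle hw
  rwa [Submodule.mem_comap, hPw] at this

/-- The number of factors `ζ_k` minus the number of factors `ζbar_k`. -/
def blkDegree (b : Bool × Bool) : ℤ := (if b.1 then 1 else 0) - (if b.2 then 1 else 0)

theorem blkWeight_I (b : Bool × Bool) : blkWeight Complex.I b = Complex.I ^ (-blkDegree b) := by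
  rcases b with ⟨_ | _, _ | _⟩ <;> simp [blkWeight, blkDegree]

theorem blkWeight_neg_I (b : Bool × Bool) :
    blkWeight (-Complex.I) b = Complex.I ^ (blkDegree b) := by
  rcases b with ⟨_ | _, _ | _⟩ <;> simp [blkWeight, blkDegree]

theorem blkWeight_one (b : Bool × Bool) : blkWeight 1 b = 1 := by
  rcases b with ⟨_ | _, _ | _⟩ <;> simp [blkWeight]

theorem blkDegree_cases (b : Bool × Bool) :
    blkDegree b = 0 ∨ blkDegree b = 1 ∨ blkDegree b = -1 := by
  rcases b with ⟨_ | _, _ | _⟩ <;> simp [blkDegree]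

/-- Multiplying coordinate j by i and coordinate k by -i leaves the determinant equal to 1, so two
block degrees can be compared by a diagonal element with fourth-root weights. -/
theorem exists_pair_rotation {j k : Fin n} (hjk : j ≠ k) : ∃ g ∈ SU n, ∀ s ε,
    actC g (mono s ε) = Complex.I ^ (blkDegree (s k) - blkDegree (s j)) • mono s ε := by
  obtain ⟨g, hg, h⟩ := exists_diagonal
    (t := fun l => if l = j then Complex.I else if l = k then -Complex.I else 1)
    (fun l => by split_ifs <;> simp) (by
      rw [← Finset.prod_subset (Finset.subset_univ {j, k}) (fun l _ hl => by
        simp only [Finset.mem_insert, Finset.mem_singleton, not_or] at hl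
        simp [hl]), Finset.prod_pair hjk]
      simp [hjk.symm])
  refine ⟨g, hg, fun s ε => ?_⟩
  rw [h]
  congr 1
  rw [← Finset.prod_subset (Finset.subset_univ {j, k}) (fun l _ hl => by
    simp only [Finset.mem_insert, Finset.mem_singleton, not_or] at hl
    simp [hl, blkWeight_one]), Finset.prod_pair hjk]
  simp only [if_true, hjk.symm, if_false, blkWeight_I, blkWeight_neg_I]
  rw [← zpow_add₀ Complex.I_ne_zero]
  congr 1
  ring

/-- Pairs (j, k) are treated one at a time: each rotation discards the monomials whose degrees at j
and k differ, while the conditions already obtained are kept. -/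
theorem mem_span_mono_constant_degree {w : ExtC n} (hw : ∀ g ∈ SU n, actC g w = w) :
    w ∈ Submodule.span ℂ ((fun p : (Fin n → Bool × Bool) × Bool => mono p.1 p.2) ''
      {p | ∀ j k, blkDegree (p.1 j) = blkDegree (p.1 k)}) := by
  have key : ∀ A : Finset (Fin n × Fin n), w ∈ Submodule.span ℂ
      ((fun p : (Fin n → Bool × Bool) × Bool => mono p.1 p.2) ''
        {p | ∀ q ∈ A, blkDegree (p.1 q.1) = blkDegree (p.1 q.2)}) := by
    intro A
    induction A using Finset.induction_on with
    | empty => simp [Set.image_univ, span_mono]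
    | insert q A hq ih =>
      by_cases hjk : q.1 = q.2
      · refine Submodule.span_mono (Set.image_mono fun p hp => ?_) ih
        intro r hr
        rcases Finset.mem_insert.1 hr with rfl | hr
        · rw [hjk]
        · exact hp r hr
      · obtain ⟨g, hg, h⟩ := exists_pair_rotation hjk
        have h4 : ∀ d : ℤ, (Complex.I ^ d) ^ 4 = 1 := by
          intro d
          rw [← zpow_natCast, ← zpow_mul, mul_comm, zpow_mul]
          simp
        refine Submodule.span_mono (Set.image_mono fun p hp => ?_) (mem_span_of_order_four
          (actC g).toLinearMap (fun p : (Fin n → Bool × Bool) × Bool => mono p.1 p.2)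
          (fun p => Complex.I ^ (blkDegree (p.1 q.2) - blkDegree (p.1 q.1))) (fun p => h _ _)
          (fun p => h4 _) _ ih (hw g hg))
        intro r hr
        rcases Finset.mem_insert.1 hr with rfl | hr
        · have hp2 := hp.2
          have hI3 : Complex.I ^ (-1 : ℤ) ≠ 1 := by
            rw [zpow_neg_one, Complex.inv_I]
            intro h; simpa using congrArg Complex.re h
          have hI1 : Complex.I ≠ 1 := by
            intro h; simpa using congrArg Complex.re h
          -- Both degrees lie in {-1, 0, 1}, so their difference has absolute value at most 2. An
          -- exponent of i in this range gives 1 only if it is 0.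
          rcases blkDegree_cases (p.1 r.1) with h1 | h1 | h1 <;>
            rcases blkDegree_cases (p.1 r.2) with h2 | h2 | h2 <;>
            rw [h1, h2] at hp2 <;> rw [h1, h2] <;> exfalso <;> norm_num at hp2
          all_goals first
            | exact hI1 hp2
            | exact hI3 (by simpa using hp2)
        · exact hp.1 r hr
  refine Submodule.span_mono (Set.image_mono fun p hp => ?_) (key Finset.univ)
  exact fun j k => hp (j, k) (Finset.mem_univ _)

/-! ### Averaging over permutation matrices -/

theorem ζζ_mul_ζζ_comm (j k : Fin n) : ζζ n j * ζζ n k = ζζ n k * ζζ n j := by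
  have hζ : ∀ l, ζζ n j * ζ n l = ζ n l * ζζ n j := by
    intro l
    rw [ζζ, mul_assoc, oneForms_anticomm (ζbar_mem_oneForms j) (ζ_mem_oneForms l), mul_smul_comm,
      ← mul_assoc, oneForms_anticomm (ζ_mem_oneForms j) (ζ_mem_oneForms l), smul_mul_assoc,
      smul_smul, mul_assoc]
    norm_num
  have hζbar : ∀ l, ζζ n j * ζbar n l = ζbar n l * ζζ n j := by
    intro l
    rw [ζζ, mul_assoc, oneForms_anticomm (ζbar_mem_oneForms j) (ζbar_mem_oneForms l),
      mul_smul_comm, ← mul_assoc, oneForms_anticomm (ζ_mem_oneForms j) (ζbar_mem_oneForms l),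
      smul_mul_assoc, smul_smul, mul_assoc]
    norm_num
  rw [ζζ.eq_1 n k, ← mul_assoc, hζ, mul_assoc, hζbar, mul_assoc]

theorem ζζ_mul_self (k : Fin n) : ζζ n k * ζζ n k = 0 := by
  rw [ζζ, mul_assoc, ← mul_assoc (ζbar n k), ζbar_mul_ζ, smul_mul_assoc, mul_assoc (ζ n k),
    ζbar_mul_self, mul_zero, smul_zero, mul_zero]

theorem ζζ_mul_list_prod_eq_zero {k : Fin n} {l : List (Fin n)} (h : k ∈ l) :
    ζζ n k * (l.map (ζζ n)).prod = 0 := by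
  induction l with
  | nil => simp at h
  | cons j l ih =>
    rw [List.map_cons, List.prod_cons, ← mul_assoc]
    by_cases hj : k = j
    · rw [hj, ζζ_mul_self, zero_mul]
    · rw [ζζ_mul_ζζ_comm, mul_assoc, ih ((List.mem_cons.1 h).resolve_left hj), mul_zero]

/-- A permutation matrix may have determinant -1. Unit phases on its entries correct this without
changing the action on ζ_k∧ζbar_k, where each phase meets its conjugate. -/
theorem exists_permutation (σ : Equiv.Perm (Fin n)) :
    ∃ g ∈ SU n, ∀ k, actC g (ζζ n k) = ζζ n (σ k) := by
  obtain ⟨c, hc, hdet⟩ : ∃ c : Fin n → ℂ, (∀ k, star (c k) * c k = 1) ∧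
      (∏ k, c k) * ((Equiv.Perm.sign σ : ℤ) : ℂ) = 1 := by
    rcases n with _ | n
    · exact ⟨fun _ => 1, by simp, by simp [Subsingleton.elim σ 1]⟩
    · rcases Int.units_eq_one_or (Equiv.Perm.sign σ) with h | h
      · exact ⟨fun _ => 1, by simp, by simp [h]⟩
      -- An odd permutation is compensated by one sign, placed at coordinate 0; this is why n = 0 is
      -- treated separately.
      · refine ⟨fun k => if k = 0 then -1 else 1, fun k => by by_cases hk : k = 0 <;> simp [hk], ?_⟩
        simp [h, Finset.prod_ite_eq']
  let U : Matrix (Fin n) (Fin n) ℂ := Matrix.of fun l k => if l = σ k then c l else 0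
  have hUeq : U = Matrix.diagonal c * (σ⁻¹).permMatrix ℂ := by
    ext l k
    rw [Matrix.diagonal_mul]
    simp only [U, Matrix.of_apply, Equiv.Perm.permMatrix, PEquiv.toMatrix_apply,
      Equiv.toPEquiv_apply, Option.mem_def, Option.some.injEq, mul_ite, mul_one, mul_zero]
    congr 1
    exact propext ⟨fun h => by simp [h], fun h => by simp [← h]⟩
  have hU : U ∈ Matrix.specialUnitaryGroup (Fin n) ℂ := by
    rw [Matrix.mem_specialUnitaryGroup_iff, Matrix.mem_unitaryGroup_iff']
    constructor
    · ext j k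
      rw [Matrix.mul_apply, Finset.sum_eq_single (σ j) (fun l _ hl => by
        simp [U, Matrix.star_apply, hl]) (by simp)]
      by_cases hjk : j = k
      · subst hjk
        simpa [U, Matrix.star_apply] using hc (σ j)
      · simp [U, Matrix.star_apply, hjk]
    · rw [hUeq, Matrix.det_mul, Matrix.det_diagonal, Matrix.det_permutation, Equiv.Perm.sign_inv]
      exact hdet
  obtain ⟨g, hg, hgz⟩ := exists_mem_SU hU
  refine ⟨g, hg, fun k => ?_⟩
  rw [ζζ, map_mul, (actC_ζ hgz k).1, (actC_ζ hgz k).2,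
    Finset.sum_eq_single (σ k) (fun l _ hl => by simp [U, hl]) (by simp),
    Finset.sum_eq_single (σ k) (fun l _ hl => by simp [U, hl]) (by simp), smul_mul_smul_comm]
  simp only [U, Matrix.of_apply, if_true]
  rw [hc, one_smul, ζζ]

/-- Write S(l) for the left-hand side. Multiplying S(l) by Σ ζζ_k gives the sum of S(k :: l) over
all k. The terms with k in l vanish because ζζ_k squares to zero, and the other n - |l| terms are
equal, so induction on l produces the factorial. -/
theorem sum_perm_list_prod (l : List (Fin n)) (hl : l.Nodup) :
    ∑ σ : Equiv.Perm (Fin n), (l.map fun k => ζζ n (σ k)).prod =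
      (((n - l.length).factorial : ℕ) : ℂ) • (∑ k, ζζ n k) ^ l.length := by
  induction l with
  | nil => simp [Fintype.card_perm, Nat.cast_smul_eq_nsmul]
  | cons j l ih =>
    rw [List.nodup_cons] at hl
    let G : Fin n → ExtC n := fun k =>
      ∑ σ : Equiv.Perm (Fin n), ((k :: l).map fun k => ζζ n (σ k)).prod
    have hGmem : ∀ k ∈ l, G k = 0 := by
      intro k hk
      refine Finset.sum_eq_zero fun σ _ => ?_
      have := ζζ_mul_list_prod_eq_zero (List.mem_map_of_mem (f := σ) hk)
      rwa [List.map_map] at this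
    have hGnot : ∀ k ∉ l, G k = G j := by
      intro k hk
      -- Precomposing σ with the transposition of j and k exchanges the two heads. It does not
      -- affect the tail, since neither j nor k occurs in l.
      refine Fintype.sum_equiv (Equiv.mulRight (Equiv.swap j k)) _ _ fun σ => ?_
      simp only [List.map_cons, List.prod_cons, Equiv.coe_mulRight, Equiv.Perm.mul_apply,
        Equiv.swap_apply_left]
      congr 2
      refine List.map_congr_left fun i hi => ?_
      rw [Equiv.swap_apply_of_ne_of_ne (fun h : i = j => hl.1 (h ▸ hi))
        (fun h : i = k => hk (h ▸ hi))]
    have h1 : (∑ k, ζζ n k) * ∑ σ : Equiv.Perm (Fin n), (l.map fun k => ζζ n (σ k)).prod =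
        ∑ k, G k := by
      rw [Finset.mul_sum, Finset.sum_comm]
      refine Finset.sum_congr rfl fun σ _ => ?_
      rw [← Equiv.sum_comp σ, Finset.sum_mul]
      simp only [List.map_cons, List.prod_cons]
    have hlt : l.length < n := by
      have := (List.nodup_cons.2 hl).length_le_card
      simpa using this
    have hcard : (Finset.univ.filter fun k => k ∉ l).card = n - l.length := by
      have h : (Finset.univ.filter fun k => k ∉ l) = (l.toFinset)ᶜ := by ext; simp
      rw [h, Finset.card_compl, List.toFinset_card_of_nodup hl.2, Fintype.card_fin]
    have h2 : ∑ k, G k = ((n - l.length : ℕ) : ℂ) • G j := by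
      rw [← Finset.sum_filter_add_sum_filter_not Finset.univ (fun k => k ∈ l),
        Finset.sum_eq_zero (fun k hk => hGmem k (Finset.mem_filter.1 hk).2), zero_add,
        Finset.sum_congr rfl (fun k hk => hGnot k (Finset.mem_filter.1 hk).2), Finset.sum_const,
        hcard, Nat.cast_smul_eq_nsmul]
    have hne : ((n - l.length : ℕ) : ℂ) ≠ 0 := Nat.cast_ne_zero.2 (by omega)
    have hfac : (n - l.length).factorial =
        (n - l.length) * (n - (j :: l).length).factorial := by
      rw [List.length_cons, show n - l.length = (n - (l.length + 1)) + 1 by omega,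
        Nat.factorial_succ]
    refine smul_right_injective _ hne ?_
    change ((n - l.length : ℕ) : ℂ) • G j = _
    beta_reduce
    rw [← h2, ← h1, ih hl.2, mul_smul_comm, ← pow_succ', smul_smul, ← Nat.cast_mul, ← hfac,
      List.length_cons]

theorem sum_perm_list_prod_mem (l : List (Fin n)) (hl : l.Nodup) :
    ∑ σ : Equiv.Perm (Fin n), (l.map fun k => ζζ n (σ k)).prod ∈
      Submodule.span ℂ (Set.range fun k : ℕ => FC n ^ k) := by
  have hsum : ∑ k, ζζ n k = (-2 * Complex.I) • FC n := by
    rw [FC_eq, smul_smul]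
    have : -2 * Complex.I * (Complex.I / 2) = 1 := by
      linear_combination (-1 : ℂ) * Complex.I_mul_I
    rw [this, one_smul]
  rw [sum_perm_list_prod l hl, hsum, smul_pow, smul_smul]
  exact Submodule.smul_mem _ _ (Submodule.subset_span ⟨_, rfl⟩)

/-- For the full list of indices the n! summands of `sum_perm_list_prod` coincide, because the ζζ_k
commute. -/
theorem sum_ζζ_pow : (∑ k, ζζ n k) ^ n =
    (n.factorial : ℂ) • (List.ofFn fun k => ζζ n k).prod := by
  have h := sum_perm_list_prod (List.finRange n) (List.nodup_finRange n)
  rw [List.length_finRange, Nat.sub_self, Nat.factorial_zero, Nat.cast_one, one_smul] at h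
  rw [← h, Finset.sum_congr rfl (g := fun _ => (List.ofFn fun k => ζζ n k).prod), Finset.sum_const,
    Finset.card_univ, Fintype.card_perm, Fintype.card_fin, Nat.cast_smul_eq_nsmul]
  intro σ _
  rw [List.ofFn_eq_map]
  have hp : ((List.finRange n).map fun k => ζζ n (σ k)).Perm ((List.finRange n).map (ζζ n)) := by
    have := (Equiv.Perm.map_finRange_perm σ).map (ζζ n)
    rwa [List.map_map] at this
  refine hp.prod_eq' ?_
  rw [List.pairwise_map]
  exact List.pairwise_of_forall fun j k => ζζ_mul_ζζ_comm _ _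

/-! ### The span of the complex invariants -/

/-- The standard complex invariants without factor `α`. -/
def horizontalInvariants (n : ℕ) : Set (ExtC n) :=
  Set.range (fun k : ℕ => FC n ^ k) ∪ {OmegaForm n, OmegaBar n}

theorem list_prod_ite {M ι : Type*} [Monoid M] (l : List ι) (p : ι → Prop) [DecidablePred p]
    (m : ι → M) : (l.map fun k => if p k then m k else 1).prod = ((l.filter p).map m).prod := by
  induction l with
  | nil => simp
  | cons j l ih => by_cases h : p j <;> simp [h, ih]

/-- Common degree 1 forces every block to be ζ_k, common degree -1 forces ζbar_k, and common degree
0 leaves the choice between 1 and ζ_k∧ζbar_k in each block. -/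
theorem mono_of_constant_degree (hn : 0 < n) {s : Fin n → Bool × Bool}
    (hs : ∀ j k, blkDegree (s j) = blkDegree (s k)) (ε : Bool) :
    (∃ l : List (Fin n), l.Nodup ∧
      mono s ε = (l.map (ζζ n)).prod * (if ε then αC n else 1)) ∨
    mono s ε = OmegaForm n * (if ε then αC n else 1) ∨
    mono s ε = OmegaBar n * (if ε then αC n else 1) := by
  have hs' := fun k => hs k ⟨0, hn⟩
  rcases blkDegree_cases (s ⟨0, hn⟩) with h0 | h0 | h0 <;> rw [h0] at hs'
  · refine Or.inl ⟨(List.finRange n).filter fun k => (s k).1, (List.nodup_finRange n).filter _, ?_⟩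
    rw [mono, List.ofFn_eq_map]
    congr 1
    have := list_prod_ite (List.finRange n) (fun k => (s k).1 = true) (ζζ n)
    simp only [Bool.decide_eq_true] at this
    rw [← this]
    congr 2
    funext k
    have hk := hs' k
    rcases hb : s k with ⟨_ | _, _ | _⟩ <;> rw [hb] at hk <;> simp [blkDegree] at hk <;>
      simp [blk, ζζ]
  · refine Or.inr (Or.inl ?_)
    rw [mono, OmegaForm_eq]
    congr 3
    funext k
    have hk := hs' k
    rcases hb : s k with ⟨_ | _, _ | _⟩ <;> rw [hb] at hk <;> simp [blkDegree] at hk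
    simp [blk]
  · refine Or.inr (Or.inr ?_)
    rw [mono, OmegaBar]
    congr 3
    funext k
    have hk := hs' k
    rcases hb : s k with ⟨_ | _, _ | _⟩ <;> rw [hb] at hk <;> simp [blkDegree] at hk
    simp [blk]

/-- The operator Q, a sum over lifts of all permutations, multiplies an invariant by n!. It maps
each monomial of constant degree into M: degree 0 yields a multiple of a power of F, and degrees ±1
yield multiples of Ω and Ω̄, in each case possibly times α. -/
theorem mem_span_of_invariant (hn : 0 < n) {w : ExtC n} (hw : ∀ g ∈ SU n, actC g w = w) :
    w ∈ Submodule.span ℂ (horizontalInvariants n ∪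
      (fun x => x * αC n) '' horizontalInvariants n) := by
  set M := Submodule.span ℂ (horizontalInvariants n ∪
      (fun x => x * αC n) '' horizontalInvariants n)
  choose g hg hgζ using exists_permutation (n := n)
  let Q : ExtC n →ₗ[ℂ] ExtC n := ∑ σ : Equiv.Perm (Fin n), (actC (g σ)).toLinearMap
  have hQ : ∀ x, Q x = ∑ σ : Equiv.Perm (Fin n), actC (g σ) x := fun x => by
    simp [Q, LinearMap.sum_apply]
  have hQinv : ∀ x : ExtC n, (∀ g ∈ SU n, actC g x = x) →
      Q x = ((Fintype.card (Equiv.Perm (Fin n)) : ℕ) : ℂ) • x := by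
    intro x hx
    rw [hQ, Finset.sum_congr rfl fun σ _ => hx _ (hg σ), Finset.sum_const, Finset.card_univ,
      Nat.cast_smul_eq_nsmul]
  have hMα : ∀ x ∈ Submodule.span ℂ (horizontalInvariants n), ∀ ε : Bool,
      x * (if ε then αC n else 1) ∈ M := by
    intro x hx ε
    cases ε
    · simp only [Bool.false_eq_true, if_false, mul_one]
      exact Submodule.span_mono Set.subset_union_left hx
    · simp only [if_true]
      have h1 : (LinearMap.mulRight ℂ (αC n)) x ∈
          (Submodule.span ℂ (horizontalInvariants n)).map (LinearMap.mulRight ℂ (αC n)) :=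
        Submodule.mem_map_of_mem hx
      rw [Submodule.map_span] at h1
      exact Submodule.span_mono Set.subset_union_right h1
  have hQα : ∀ (x : ExtC n) (ε : Bool),
      Q (x * (if ε then αC n else 1)) = Q x * (if ε then αC n else 1) := by
    intro x ε
    rw [hQ, hQ, Finset.sum_mul]
    refine Finset.sum_congr rfl fun σ _ => ?_
    rw [map_mul]
    split_ifs
    · rw [actC_αC (hg σ)]
    · rw [map_one]
  have hle : Submodule.span ℂ ((fun p : (Fin n → Bool × Bool) × Bool => mono p.1 p.2) ''
      {p | ∀ j k, blkDegree (p.1 j) = blkDegree (p.1 k)}) ≤ M.comap Q := by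
    rw [Submodule.span_le]
    rintro _ ⟨⟨s, ε⟩, hs, rfl⟩
    change Q (mono s ε) ∈ M
    rcases mono_of_constant_degree hn hs ε with ⟨l, hl, h⟩ | h | h
    · rw [h, hQα]
      refine hMα _ ?_ ε
      rw [hQ]
      simp only [map_list_prod, List.map_map, Function.comp_def, hgζ]
      exact Submodule.span_mono Set.subset_union_left (sum_perm_list_prod_mem l hl)
    · rw [h, hQα, hQinv _ fun g hg => actC_OmegaForm hg]
      exact hMα _ (Submodule.smul_mem _ _ (Submodule.subset_span (by simp [horizontalInvariants])))
        ε
    · rw [h, hQα, hQinv _ fun g hg => actC_OmegaBar hg]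
      exact hMα _ (Submodule.smul_mem _ _ (Submodule.subset_span (by simp [horizontalInvariants])))
        ε
  have h := hle (mem_span_mono_constant_degree hw)
  rw [Submodule.mem_comap, hQinv w hw, Submodule.smul_mem_iff _ (by simp)]
    at h
  exact h

/-! ### Algebraic relations -/

theorem list_prod_mul_eq_zero {M : Type*} [MonoidWithZero M] {l : List M} (hl : l ≠ []) {y : M}
    (h : ∀ x ∈ l, x * y = 0) : l.prod * y = 0 := by
  induction l with
  | nil => exact absurd rfl hl
  | cons x l ih =>
    rw [List.prod_cons, mul_assoc]
    by_cases hl' : l = []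
    · simpa [hl'] using h x (by simp)
    · rw [ih hl' fun z hz => h z (by simp [hz]), mul_zero]

theorem mul_list_prod_eq_zero {m : Fin n → ExtC n} (k : Fin n) (h : m k * m k = 0)
    (hm : ∀ j, SignCommute (m k) (m j)) : m k * (List.ofFn m).prod = 0 := by
  have key : ∀ l : List (Fin n), k ∈ l → m k * (l.map m).prod = 0 := by
    intro l hl
    induction l with
    | nil => simp at hl
    | cons j l ih =>
      rw [List.map_cons, List.prod_cons, ← mul_assoc]
      by_cases hj : k = j
      · rw [← hj, h, zero_mul]
      · obtain ⟨ε, hε⟩ := hm j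
        rw [hε, smul_mul_assoc, mul_assoc, ih ((List.mem_cons.1 hl).resolve_left hj), mul_zero,
          smul_zero]
  rw [List.ofFn_eq_map]
  exact key _ (List.mem_finRange k)

theorem ζ_mul_OmegaForm (k : Fin n) : ζ n k * OmegaForm n = 0 :=
  mul_list_prod_eq_zero k (ζ_mul_self k) fun j =>
    signCommute_of_mem (ζ_mem_oneForms k) (ζ_mem_oneForms j)

theorem ζbar_mul_OmegaBar (k : Fin n) : ζbar n k * OmegaBar n = 0 :=
  mul_list_prod_eq_zero k (ζbar_mul_self k) fun j =>
    signCommute_of_mem (ζbar_mem_oneForms k) (ζbar_mem_oneForms j)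

theorem OmegaForm_mul_self (hn : 0 < n) : OmegaForm n * OmegaForm n = 0 := by
  nth_rewrite 1 [OmegaForm_eq]
  refine list_prod_mul_eq_zero (by simpa using hn.ne') fun x hx => ?_
  obtain ⟨k, rfl⟩ := (List.mem_ofFn' _ _).1 hx
  exact ζ_mul_OmegaForm k

theorem FC_mul_OmegaForm : FC n * OmegaForm n = 0 := by
  rw [FC_eq, smul_mul_assoc, Finset.sum_mul, Finset.sum_eq_zero, smul_zero]
  intro k _
  have h : ζζ n k = (-1 : ℂ) • (ζbar n k * ζ n k) := by
    rw [ζbar_mul_ζ, smul_smul, ζζ]; norm_num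
  rw [h, smul_mul_assoc, mul_assoc, ζ_mul_OmegaForm, mul_zero, smul_zero]

theorem FC_mul_OmegaBar : FC n * OmegaBar n = 0 := by
  rw [FC_eq, smul_mul_assoc, Finset.sum_mul, Finset.sum_eq_zero, smul_zero]
  intro k _
  rw [ζζ, mul_assoc, ζbar_mul_OmegaBar, mul_zero]

theorem list_prod_mul_oneForm {l : List (ExtC n)} (hl : ∀ y ∈ l, y ∈ oneForms n) {x : ExtC n}
    (hx : x ∈ oneForms n) : l.prod * x = (-1 : ℂ) ^ l.length • (x * l.prod) := by
  induction l with
  | nil => simp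
  | cons y l ih =>
    rw [List.prod_cons, mul_assoc, ih fun z hz => hl z (by simp [hz]), mul_smul_comm, ← mul_assoc,
      oneForms_anticomm (hl y (by simp)) hx, smul_mul_assoc, smul_smul, mul_assoc, List.length_cons,
      pow_succ]

theorem list_prod_ζbar_mul_list_prod_ζ (l : List (Fin n)) : ∃ ε : ℤˣ,
    (l.map (ζbar n)).prod * (l.map (ζ n)).prod = ((ε : ℤ) : ℂ) • (l.map (ζζ n)).prod := by
  induction l with
  | nil => exact ⟨1, by simp⟩
  | cons k l ih =>
    obtain ⟨ε, hε⟩ := ih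
    refine ⟨(-1) ^ l.length * (-1) * ε, ?_⟩
    have h := list_prod_mul_oneForm (l := l.map (ζbar n)) (x := ζ n k) (fun y hy => by
      obtain ⟨j, _, rfl⟩ := List.mem_map.1 hy
      exact ζbar_mem_oneForms j) (ζ_mem_oneForms k)
    rw [List.map_cons, List.map_cons, List.map_cons, List.prod_cons, List.prod_cons,
      List.prod_cons, mul_assoc, ← mul_assoc (l.map (ζbar n)).prod, h, smul_mul_assoc,
      mul_smul_comm, mul_assoc (ζ n k), hε, mul_smul_comm, mul_smul_comm, ← mul_assoc (ζbar n k),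
      ζbar_mul_ζ, smul_mul_assoc, ζζ.eq_1 n k, smul_smul, smul_smul, List.length_map]
    congr 1
    push_cast
    ring

/-- Both Ω̄∧Ω and F^n are nonzero scalar multiples of the product of all ζζ_k. Usually only κ ≠ 0
matters. -/
theorem exists_OmegaBar_mul_OmegaForm : ∃ κ : ℂ, κ ≠ 0 ∧
    OmegaBar n * OmegaForm n = κ • FC n ^ n := by
  obtain ⟨ε, hε⟩ := list_prod_ζbar_mul_list_prod_ζ (List.finRange n)
  have hF : FC n ^ n = ((Complex.I / 2) ^ n * (n.factorial : ℂ)) •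
      ((List.finRange n).map (ζζ n)).prod := by
    rw [FC_eq, smul_pow, sum_ζζ_pow, smul_smul, List.ofFn_eq_map]
  have hc : (Complex.I / 2) ^ n * (n.factorial : ℂ) ≠ 0 :=
    mul_ne_zero (pow_ne_zero _ (div_ne_zero Complex.I_ne_zero two_ne_zero))
      (Nat.cast_ne_zero.2 n.factorial_ne_zero)
  refine ⟨((ε : ℤ) : ℂ) * ((Complex.I / 2) ^ n * (n.factorial : ℂ))⁻¹,
    mul_ne_zero ?_ (inv_ne_zero hc), ?_⟩
  · rcases Int.units_eq_one_or ε with h | h <;> simp [h]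
  · rw [hF, smul_smul, mul_assoc, inv_mul_cancel₀ hc, mul_one, ← hε, OmegaBar, OmegaForm_eq,
      List.ofFn_eq_map, List.ofFn_eq_map]

/-- The exact constant is needed here: it fixes the ratio of the coefficients 3 and 2 in type D. -/
theorem OmegaBar_mul_OmegaForm_three :
    OmegaBar 3 * OmegaForm 3 = (4 / 3 * Complex.I) • FC 3 ^ 3 := by
  have hF : FC 3 ^ 3 = ((Complex.I / 2) ^ 3 * 6) • ((List.finRange 3).map (ζζ 3)).prod := by
    rw [FC_eq, smul_pow, sum_ζζ_pow, smul_smul, List.ofFn_eq_map]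
    norm_num [Nat.factorial]
  have h : ∀ a b : Fin 3, ζbar 3 a * ζ 3 b = (-1 : ℂ) • (ζ 3 b * ζbar 3 a) := fun a b =>
    oneForms_anticomm (ζbar_mem_oneForms a) (ζ_mem_oneForms b)
  have h' : ∀ (a b : Fin 3) (x : ExtC 3),
      ζbar 3 a * (ζ 3 b * x) = (-1 : ℂ) • (ζ 3 b * (ζbar 3 a * x)) := fun a b x => by
    rw [← mul_assoc, h, smul_mul_assoc, mul_assoc]
  rw [hF, smul_smul, OmegaBar, OmegaForm_eq]
  have hl : List.finRange 3 = [0, 1, 2] := rfl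
  rw [hl]
  simp only [List.ofFn_succ, List.ofFn_zero, List.prod_cons, List.prod_nil, List.map_cons,
    List.map_nil, mul_one, ζζ, mul_assoc]
  change ζbar 3 0 * (ζbar 3 1 * (ζbar 3 2 * (ζ 3 0 * (ζ 3 1 * ζ 3 2)))) = _
  have hs : ∀ (c : ℂ) (x y : ExtC 3), x * c • y = c • (x * y) := fun c x y => mul_smul_comm _ _ _
  simp only [h, h', hs, smul_smul]
  congr 1
  ring_nf
  rw [show Complex.I ^ 4 = 1 from Complex.I_pow_four]

/-! ### Nonvanishing -/

/-- Contraction with the dual basis vector of the first factor strips that factor off and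
annihilates the remaining product, where it does not recur. Induction then reaches the product 1. -/
theorem list_prod_θ_ne_zero (l : List ((Fin n × Fin 2) ⊕ Unit)) (hl : l.Nodup) :
    (l.map (θ n)).prod ≠ 0 := by
  let d : (Fin n × Fin 2) ⊕ Unit → Module.Dual ℝ (T n) := fun i =>
    (EuclideanSpace.proj (𝕜 := ℝ) i : T n →L[ℝ] ℝ).toLinearMap
  have hd : ∀ i j, d i (e n j) = if i = j then 1 else 0 := by
    intro i j
    simp [d, e]
  have hc : ∀ (i j) (x : Ext n), CliffordAlgebra.contractLeft (d i) (θ n j * x) =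
      (if i = j then (1 : ℝ) else 0) • x - θ n j * CliffordAlgebra.contractLeft (d i) x := by
    intro i j x
    rw [← hd]
    exact CliffordAlgebra.contractLeft_ι_mul (Q := (0 : QuadraticForm ℝ (T n))) _ _ _
  have h0 : ∀ (i) (l : List ((Fin n × Fin 2) ⊕ Unit)), i ∉ l →
      CliffordAlgebra.contractLeft (d i) ((l.map (θ n)).prod : Ext n) = 0 := by
    intro i l hi
    induction l with
    | nil => exact CliffordAlgebra.contractLeft_one (Q := (0 : QuadraticForm ℝ (T n))) _
    | cons j l ih =>
      simp only [List.mem_cons, not_or] at hi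
      rw [List.map_cons, List.prod_cons, hc, ih hi.2, if_neg hi.1, zero_smul, mul_zero, sub_zero]
  induction l with
  | nil => simp
  | cons i l ih =>
    rw [List.nodup_cons] at hl
    intro h
    have h1 := hc i i (l.map (θ n)).prod
    rw [List.map_cons, List.prod_cons] at h
    rw [h, h0 i l hl.1, if_pos rfl, one_smul, mul_zero, sub_zero, map_zero] at h1
    exact ih hl.2 h1.symm

theorem one_tmul_eq_zero {x : Ext n} (h : (1 : ℂ) ⊗ₜ[ℝ] x = 0) : x = 0 := by
  have := congrArg (reForm n) h
  simpa [reForm] using this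

/-- Up to a nonzero scalar this is the product of all the basis one-forms. -/
theorem αC_mul_FC_pow_ne_zero : αC n * FC n ^ n ≠ 0 := by
  have hF : FC n ^ n = ((Complex.I / 2) ^ n * (n.factorial : ℂ)) •
      ((List.finRange n).map (ζζ n)).prod := by
    rw [FC_eq, smul_pow, sum_ζζ_pow, smul_smul, List.ofFn_eq_map]
  have hζ : ∀ k, ζζ n k =
      (-2 * Complex.I) ⊗ₜ[ℝ] (θ n (Sum.inl (k, 0)) * θ n (Sum.inl (k, 1))) := by
    intro k
    set x := θ n (Sum.inl (k, 0)) with hx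
    set y := θ n (Sum.inl (k, 1)) with hy
    have hxx : x * x = 0 := ExteriorAlgebra.ι_sq_zero _
    have hyy : y * y = 0 := ExteriorAlgebra.ι_sq_zero _
    have hyx : y * x = -(x * y) := eq_neg_of_add_eq_zero_left (ExteriorAlgebra.ι_add_mul_swap _ _)
    simp only [ζζ, ζ, ζbar, cplx, ← hx, ← hy, add_mul, mul_add,
      Algebra.TensorProduct.tmul_mul_tmul, hxx, hyy, hyx, mul_neg, one_mul, mul_one,
      TensorProduct.tmul_neg, TensorProduct.tmul_zero, add_zero, zero_add,
      ← TensorProduct.neg_tmul, ← TensorProduct.add_tmul]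
    congr 1
    ring
  have hl : ∀ l : List (Fin n), (l.map (ζζ n)).prod = ((-2 * Complex.I) ^ l.length) ⊗ₜ[ℝ]
      ((l.flatMap fun k => [Sum.inl (k, 0), Sum.inl (k, 1)]).map (θ n)).prod := by
    intro l
    induction l with
    | nil => simp [Algebra.TensorProduct.one_def]
    | cons k l ih =>
      rw [List.map_cons, List.prod_cons, ih, hζ, Algebra.TensorProduct.tmul_mul_tmul]
      simp only [List.flatMap_cons, List.map_append, List.prod_append, List.map_cons,
        List.prod_cons, List.map_nil, List.prod_nil, mul_one, List.length_cons, pow_succ']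
  rw [hF, hl, mul_smul_comm, αC, Algebra.TensorProduct.tmul_mul_tmul, one_mul]
  have ht : ∀ (c : ℂ) (x : Ext n), c ⊗ₜ[ℝ] x = c • ((1 : ℂ) ⊗ₜ[ℝ] x) := fun c x => by
    rw [TensorProduct.smul_tmul', smul_eq_mul, mul_one]
  rw [ht, smul_smul]
  intro h
  rw [smul_eq_zero] at h
  rcases h with h | h
  · simp [Nat.factorial_ne_zero] at h
  · have h1 := one_tmul_eq_zero h
    refine list_prod_θ_ne_zero (Sum.inr () :: (List.finRange n).flatMap
      fun k => [Sum.inl (k, 0), Sum.inl (k, 1)]) ?_ (by simpa [alphaForm] using h1)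
    rw [List.nodup_cons]
    constructor
    · simp
    · rw [List.nodup_flatMap]
      refine ⟨fun k _ => by simp, ?_⟩
      refine (List.nodup_finRange n).imp fun {j k} hjk => ?_
      simp [Function.onFun, hjk.symm]

theorem αC_mul_FC_pow_ne_zero_of_le {k : ℕ} (hk : k ≤ n) : αC n * FC n ^ k ≠ 0 := fun h =>
  αC_mul_FC_pow_ne_zero (n := n) (by
    rw [show FC n ^ n = FC n ^ (k + (n - k)) by rw [Nat.add_sub_cancel' hk], pow_add, ← mul_assoc, h, zero_mul])

theorem FC_pow_ne_zero_of_le {k : ℕ} (hk : k ≤ n) : FC n ^ k ≠ 0 := fun h =>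
  αC_mul_FC_pow_ne_zero_of_le hk (by rw [h, mul_zero])

/-! ### Grading -/

instance (n : ℕ) : GradedRing (extGrading n) :=
  inferInstanceAs (GradedRing fun p => ⋀[ℝ]^p (T n))

theorem extGrading_mul {p q : ℕ} {a b : Ext n} (ha : a ∈ extGrading n p)
    (hb : b ∈ extGrading n q) : a * b ∈ extGrading n (p + q) :=
  SetLike.GradedMul.mul_mem ha hb

theorem extGrading_pow {p : ℕ} {a : Ext n} (ha : a ∈ extGrading n p) (k : ℕ) :
    a ^ k ∈ extGrading n (k * p) := by
  induction k with
  | zero => simpa using SetLike.GradedOne.one_mem (A := extGrading n)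
  | succ k ih => rw [pow_succ, Nat.succ_mul]; exact extGrading_mul ih ha

theorem ι_mem_extGrading (v : T n) : ExteriorAlgebra.ι ℝ v ∈ extGrading n 1 := by
  change _ ∈ LinearMap.range (ExteriorAlgebra.ι ℝ (M := T n)) ^ 1
  rw [pow_one]
  exact ⟨v, rfl⟩

theorem alphaForm_mem_extGrading : alphaForm n ∈ extGrading n 1 := ι_mem_extGrading _

theorem FForm_mem_extGrading : FForm n ∈ extGrading n 2 :=
  sum_mem fun _ _ => extGrading_mul (p := 1) (q := 1) (ι_mem_extGrading _) (ι_mem_extGrading _)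

theorem mul_ι_of_mem_extGrading {p : ℕ} {a : Ext n} (ha : a ∈ extGrading n p) (v : T n) :
    a * ExteriorAlgebra.ι ℝ v = (-1 : ℝ) ^ p • (ExteriorAlgebra.ι ℝ v * a) := by
  change a ∈ LinearMap.range (ExteriorAlgebra.ι ℝ (M := T n)) ^ p at ha
  induction ha using Submodule.pow_induction_on_left' with
  | algebraMap r => rw [pow_zero, one_smul]; exact Algebra.commutes _ _
  | add x y i hx hy ihx ihy => rw [add_mul, mul_add, ihx, ihy, smul_add]
  | mem_mul m hm i x hx ih =>
    obtain ⟨w, rfl⟩ := hm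
    have h : ExteriorAlgebra.ι ℝ w * ExteriorAlgebra.ι ℝ v =
        -(ExteriorAlgebra.ι ℝ v * ExteriorAlgebra.ι ℝ w) :=
      eq_neg_of_add_eq_zero_left (ExteriorAlgebra.ι_add_mul_swap _ _)
    rw [mul_assoc, ih, mul_smul_comm, ← mul_assoc, h, neg_mul, mul_assoc, pow_succ, mul_neg_one,
      neg_smul, smul_neg]

theorem mul_comm_of_mem_extGrading_two {a b : Ext n} (hb : b ∈ extGrading n 2) :
    a * b = b * a := by
  have key : ∀ v : T n, b * ExteriorAlgebra.ι ℝ v = ExteriorAlgebra.ι ℝ v * b := fun v => by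
    rw [mul_ι_of_mem_extGrading hb v]; norm_num
  induction a using ExteriorAlgebra.induction with
  | algebraMap r => exact Algebra.commutes _ _
  | ι v => exact (key v).symm
  | mul x y hx hy => rw [mul_assoc, hy, ← mul_assoc, hx, mul_assoc]
  | add x y hx hy => rw [add_mul, mul_add, hx, hy]

@[simp] theorem reForm_cplx (a b : Ext n) : reForm n (cplx a b) = a := by
  simp [reForm, cplx]

@[simp] theorem imForm_cplx (a b : Ext n) : imForm n (cplx a b) = b := by
  simp [imForm, cplx]

theorem cplx_mul_cplx (a b c d : Ext n) :
    cplx a b * cplx c d = cplx (a * c - b * d) (a * d + b * c) := by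
  simp only [cplx, add_mul, mul_add, Algebra.TensorProduct.tmul_mul_tmul, one_mul, mul_one,
    Complex.I_mul_I, TensorProduct.tmul_add, TensorProduct.tmul_sub, TensorProduct.neg_tmul]
  abel

/-- The complex-valued forms of degree `p`. -/
def IsHomogeneous (p : ℕ) (w : ExtC n) : Prop :=
  reForm n w ∈ extGrading n p ∧ imForm n w ∈ extGrading n p

theorem IsHomogeneous.mul {p q : ℕ} {v w : ExtC n} (hv : IsHomogeneous p v)
    (hw : IsHomogeneous q w) : IsHomogeneous (p + q) (v * w) := by
  rw [← cplx_re_im v, ← cplx_re_im w, cplx_mul_cplx, IsHomogeneous, reForm_cplx, imForm_cplx]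
  exact ⟨sub_mem (extGrading_mul hv.1 hw.1) (extGrading_mul hv.2 hw.2),
    add_mem (extGrading_mul hv.1 hw.2) (extGrading_mul hv.2 hw.1)⟩

theorem isHomogeneous_one : IsHomogeneous 0 (1 : ExtC n) := by
  have h : (1 : ExtC n) = cplx 1 0 := by simp [cplx, Algebra.TensorProduct.one_def]
  rw [h, IsHomogeneous, reForm_cplx, imForm_cplx]
  exact ⟨SetLike.GradedOne.one_mem, zero_mem _⟩

theorem isHomogeneous_ζ (k : Fin n) : IsHomogeneous 1 (ζ n k) := by
  rw [IsHomogeneous, ζ, reForm_cplx, imForm_cplx]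
  exact ⟨ι_mem_extGrading _, ι_mem_extGrading _⟩

theorem isHomogeneous_ζbar (k : Fin n) : IsHomogeneous 1 (ζbar n k) := by
  rw [IsHomogeneous, ζbar, reForm_cplx, imForm_cplx]
  exact ⟨ι_mem_extGrading _, neg_mem (ι_mem_extGrading _)⟩

theorem isHomogeneous_OmegaForm : IsHomogeneous n (OmegaForm n) := by
  have h : ∀ l : List (Fin n), IsHomogeneous l.length (l.map (ζ n)).prod := by
    intro l
    induction l with
    | nil => exact isHomogeneous_one
    | cons k l ih =>
      rw [List.map_cons, List.prod_cons, List.length_cons, add_comm]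
      exact (isHomogeneous_ζ k).mul ih
  have := h (List.finRange n)
  rwa [List.length_finRange, ← List.ofFn_eq_map] at this

/-- The standard invariant forms `α^ε F^k`, `α^ε Ω^±`. -/
def stdInv (n : ℕ) (i : Bool × (ℕ ⊕ Bool)) : Inv n :=
  (if i.1 then α n else 1) * Sum.elim (fun k => F n ^ k) (fun b => if b then Ωp n else Ωm n) i.2

/-- The degree of `stdInv n i`. -/
def stdDeg (n : ℕ) (i : Bool × (ℕ ⊕ Bool)) : ℕ :=
  (if i.1 then 1 else 0) + Sum.elim (fun k => k * 2) (fun _ => n) i.2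

theorem coe_Ωp : (Ωp n : Ext n) = reForm n (OmegaForm n) := rfl

theorem coe_Ωm : (Ωm n : Ext n) = imForm n (OmegaForm n) := rfl

@[simp] theorem coe_F : (F n : Ext n) = FForm n := rfl

@[simp] theorem coe_α : (α n : Ext n) = alphaForm n := rfl

theorem stdInv_mem (i : Bool × (ℕ ⊕ Bool)) :
    (stdInv n i : Ext n) ∈ extGrading n (stdDeg n i) := by
  rcases i with ⟨ε, i⟩
  rw [stdInv, stdDeg, Subalgebra.coe_mul]
  refine extGrading_mul ?_ ?_
  · cases ε
    · exact SetLike.GradedOne.one_mem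
    · exact alphaForm_mem_extGrading
  · rcases i with k | b
    · exact extGrading_pow FForm_mem_extGrading k
    · cases b
      · exact isHomogeneous_OmegaForm.2
      · exact isHomogeneous_OmegaForm.1

theorem FC_pow_eq (k : ℕ) : FC n ^ k = (1 : ℂ) ⊗ₜ[ℝ] (FForm n ^ k) := by
  rw [FC, Algebra.TensorProduct.tmul_pow, one_pow]

theorem FC_pow_eq_cplx (k : ℕ) : FC n ^ k = cplx (FForm n ^ k) 0 := by
  rw [FC_pow_eq]; simp [cplx]

theorem αC_eq_cplx : αC n = cplx (alphaForm n) 0 := by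
  simp [cplx, αC]

/-- The complex statement descends by taking real parts. The real and imaginary parts of the complex
spanning forms lie in V; a factor α on the right is moved to the left at the cost of a sign. -/
theorem coe_Inv_mem_span (hn : 0 < n) (a : Inv n) :
    (a : Ext n) ∈ Submodule.span ℝ (Set.range fun i => (stdInv n i : Ext n)) := by
  set V := Submodule.span ℝ (Set.range fun i => (stdInv n i : Ext n))
  have hV : ∀ i, (stdInv n i : Ext n) ∈ V := fun i => Submodule.subset_span ⟨i, rfl⟩
  have hα : ∀ p : ℕ, ∀ x ∈ extGrading n p, alphaForm n * x ∈ V → x * alphaForm n ∈ V := by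
    intro p x hx h
    rw [alphaForm, θ, mul_ι_of_mem_extGrading hx]
    exact Submodule.smul_mem _ _ h
  have hF : ∀ k, FForm n ^ k ∈ V := fun k => by simpa [stdInv] using hV (false, Sum.inl k)
  have hp : reForm n (OmegaForm n) ∈ V := by
    simpa [stdInv, coe_Ωp] using hV (false, Sum.inr true)
  have hm : imForm n (OmegaForm n) ∈ V := by
    simpa [stdInv, coe_Ωm] using hV (false, Sum.inr false)
  have hαF : ∀ k, FForm n ^ k * alphaForm n ∈ V := fun k =>
    hα _ _ (extGrading_pow FForm_mem_extGrading k)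
      (by simpa [stdInv] using hV (true, Sum.inl k))
  have hαp : reForm n (OmegaForm n) * alphaForm n ∈ V := hα _ _ isHomogeneous_OmegaForm.1
    (by simpa [stdInv, coe_Ωp] using hV (true, Sum.inr true))
  have hαm : imForm n (OmegaForm n) * alphaForm n ∈ V := hα _ _ isHomogeneous_OmegaForm.2
    (by simpa [stdInv, coe_Ωm] using hV (true, Sum.inr false))
  have hspan : ∀ w ∈ Submodule.span ℂ (horizontalInvariants n ∪
      (fun x => x * αC n) '' horizontalInvariants n), reForm n w ∈ V ∧ imForm n w ∈ V := by
    intro w hw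
    induction hw using Submodule.span_induction with
    | mem w hw =>
      rcases hw with (⟨k, rfl⟩ | rfl | rfl) | ⟨_, (⟨k, rfl⟩ | rfl | rfl), rfl⟩
      · beta_reduce
        rw [FC_pow_eq_cplx, reForm_cplx, imForm_cplx]
        exact ⟨hF k, zero_mem _⟩
      · exact ⟨hp, hm⟩
      · rw [OmegaBar_eq_cplx, reForm_cplx, imForm_cplx]
        exact ⟨hp, neg_mem hm⟩
      · beta_reduce
        rw [FC_pow_eq_cplx, αC_eq_cplx, cplx_mul_cplx, reForm_cplx, imForm_cplx]
        simpa using hαF k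
      · beta_reduce
        rw [← cplx_re_im (OmegaForm n), αC_eq_cplx, cplx_mul_cplx, reForm_cplx, imForm_cplx]
        simpa using ⟨hαp, hαm⟩
      · beta_reduce
        rw [OmegaBar_eq_cplx, αC_eq_cplx, cplx_mul_cplx, reForm_cplx, imForm_cplx]
        simpa using ⟨hαp, hαm⟩
    | zero => simp
    | add x y _ _ hx hy =>
      rw [map_add, map_add]
      exact ⟨add_mem hx.1 hy.1, add_mem hx.2 hy.2⟩
    | smul c x _ hx =>
      have h : c • x = cplx (c.re • reForm n x - c.im • imForm n x)
          (c.re • imForm n x + c.im • reForm n x) := by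
        conv_lhs => rw [← cplx_re_im x]
        have hc : ∀ y : Ext n, c • ((1 : ℂ) ⊗ₜ[ℝ] y) =
            (1 : ℂ) ⊗ₜ[ℝ] (c.re • y) + Complex.I ⊗ₜ[ℝ] (c.im • y) := by
          intro y
          rw [← TensorProduct.smul_tmul, ← TensorProduct.smul_tmul, ← TensorProduct.add_tmul,
            TensorProduct.smul_tmul', smul_eq_mul, mul_one]
          congr 1
          apply Complex.ext <;> simp
        have hI : ∀ y : Ext n, Complex.I ⊗ₜ[ℝ] y = Complex.I • ((1 : ℂ) ⊗ₜ[ℝ] y) := by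
          intro y; rw [TensorProduct.smul_tmul']; simp
        simp only [cplx, smul_add, TensorProduct.tmul_add, TensorProduct.tmul_sub, hI]
        rw [smul_comm c Complex.I, hc, hc]
        simp only [hI, smul_add, smul_smul, Complex.I_mul_I]
        module
      rw [h, reForm_cplx, imForm_cplx]
      exact ⟨sub_mem (Submodule.smul_mem _ _ hx.1) (Submodule.smul_mem _ _ hx.2),
        add_mem (Submodule.smul_mem _ _ hx.2) (Submodule.smul_mem _ _ hx.1)⟩
  have h := (hspan _ (mem_span_of_invariant hn (w := (1 : ℂ) ⊗ₜ[ℝ] (a : Ext n)) fun g hg => by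
    rw [actC_one_tmul, a.2 g hg])).1
  simpa [reForm] using h

theorem span_stdInv (hn : 0 < n) : Submodule.span ℝ (Set.range (stdInv n)) = ⊤ := by
  rw [eq_top_iff]
  rintro a -
  have h := coe_Inv_mem_span hn a
  have h2 : (Set.range fun i => (stdInv n i : Ext n)) =
      (Inv n).val.toLinearMap '' Set.range (stdInv n) := by
    rw [← Set.range_comp]; rfl
  rw [h2, ← Submodule.map_span] at h
  obtain ⟨b, hb, hba⟩ := h
  have : b = a := Subtype.ext hba
  rwa [← this]

/-- Projection to degree p fixes or kills each standard form, since these are homogeneous, and it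
fixes a. -/
theorem mem_span_of_mem_invGrading (hn : 0 < n) {p : ℕ} {a : Inv n} (ha : a ∈ invGrading n p) :
    a ∈ Submodule.span ℝ (stdInv n '' {i | stdDeg n i = p}) := by
  have key : ∀ b : Inv n, ∃ c ∈ Submodule.span ℝ (stdInv n '' {i | stdDeg n i = p}),
      GradedRing.proj (extGrading n) p (b : Ext n) = (c : Ext n) := by
    intro b
    have hb : b ∈ Submodule.span ℝ (Set.range (stdInv n)) := by
      rw [span_stdInv hn]; trivial
    induction hb using Submodule.span_induction with
    | mem b hb =>
      obtain ⟨i, rfl⟩ := hb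
      by_cases hi : stdDeg n i = p
      · refine ⟨stdInv n i, Submodule.subset_span ⟨i, hi, rfl⟩, ?_⟩
        rw [GradedRing.proj_apply]
        exact DirectSum.decompose_of_mem_same _ (hi ▸ stdInv_mem i)
      · refine ⟨0, zero_mem _, ?_⟩
        rw [GradedRing.proj_apply]
        exact DirectSum.decompose_of_mem_ne _ (stdInv_mem i) hi
    | zero => exact ⟨0, zero_mem _, by simp⟩
    | add x y _ _ hx hy =>
      obtain ⟨c, hc, hc'⟩ := hx
      obtain ⟨d, hd, hd'⟩ := hy
      exact ⟨c + d, add_mem hc hd, by rw [Subalgebra.coe_add, map_add, hc', hd', Subalgebra.coe_add]⟩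
    | smul r x _ hx =>
      obtain ⟨c, hc, hc'⟩ := hx
      refine ⟨r • c, Submodule.smul_mem _ _ hc, ?_⟩
      rw [GradedRing.proj_apply] at hc' ⊢
      rw [Subalgebra.coe_smul, DirectSum.decompose_smul, DirectSum.smul_apply, Submodule.coe_smul,
        hc', Subalgebra.coe_smul]
  obtain ⟨c, hc, h⟩ := key a
  have h2 : GradedRing.proj (extGrading n) p (a : Ext n) = (a : Ext n) := by
    rw [GradedRing.proj_apply]
    exact DirectSum.decompose_of_mem_same _ ha
  have : a = c := Subtype.ext (h2.symm.trans h)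
  rwa [this]

/-! ### Derivations of the exterior algebra -/

/-- The complex-linear extension of a linear endomorphism of `Λ*T`. -/
def cMap (D : Ext n →ₗ[ℝ] Ext n) : ExtC n →ₗ[ℂ] ExtC n := D.baseChange ℂ

theorem cMap_tmul (D : Ext n →ₗ[ℝ] Ext n) (c : ℂ) (a : Ext n) :
    cMap D (c ⊗ₜ[ℝ] a) = c ⊗ₜ[ℝ] D a := rfl

theorem cMap_cplx (D : Ext n →ₗ[ℝ] Ext n) (a b : Ext n) :
    cMap D (cplx a b) = cplx (D a) (D b) := by
  simp [cplx, cMap_tmul]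

theorem cMap_conjC (D : Ext n →ₗ[ℝ] Ext n) (w : ExtC n) :
    cMap D (conjC n w) = conjC n (cMap D w) := by
  rw [← cplx_re_im w, conjC_cplx, cMap_cplx, cMap_cplx, conjC_cplx, map_neg]

theorem cplx_eq (a b : Ext n) :
    cplx a b = (1 : ℂ) ⊗ₜ[ℝ] a + Complex.I • ((1 : ℂ) ⊗ₜ[ℝ] b) := by
  simp [cplx, TensorProduct.smul_tmul']

theorem one_tmul_smul (r : ℝ) (a : Ext n) :
    (1 : ℂ) ⊗ₜ[ℝ] (r • a) = (r : ℂ) • ((1 : ℂ) ⊗ₜ[ℝ] a) := by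
  rw [← TensorProduct.smul_tmul, TensorProduct.smul_tmul']
  congr 1

theorem conjC_smul (c : ℂ) (w : ExtC n) : conjC n (c • w) = star c • conjC n w := by
  induction w using TensorProduct.induction_on with
  | zero => simp
  | add x y hx hy => simp only [smul_add, map_add, hx, hy]
  | tmul d x => simp [conjC, TensorProduct.smul_tmul']

theorem conjC_one_tmul (a : Ext n) : conjC n ((1 : ℂ) ⊗ₜ[ℝ] a) = (1 : ℂ) ⊗ₜ[ℝ] a := by
  simp [conjC]

theorem one_tmul_mul (a b : Ext n) :
    (1 : ℂ) ⊗ₜ[ℝ] (a * b) = ((1 : ℂ) ⊗ₜ[ℝ] a) * ((1 : ℂ) ⊗ₜ[ℝ] b) := by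
  simp

theorem one_tmul_re : (1 : ℂ) ⊗ₜ[ℝ] reForm n (OmegaForm n) =
    (2⁻¹ : ℂ) • (OmegaForm n + OmegaBar n) := by
  rw [OmegaBar_eq_cplx]
  nth_rewrite 2 [← cplx_re_im (OmegaForm n)]
  rw [cplx_eq, cplx_eq, TensorProduct.tmul_neg]
  module

theorem one_tmul_im : (1 : ℂ) ⊗ₜ[ℝ] imForm n (OmegaForm n) =
    (-2⁻¹ * Complex.I : ℂ) • OmegaForm n + (2⁻¹ * Complex.I : ℂ) • OmegaBar n := by
  rw [OmegaBar_eq_cplx]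
  nth_rewrite 2 [← cplx_re_im (OmegaForm n)]
  rw [cplx_eq, cplx_eq, TensorProduct.tmul_neg]
  have h : (1 : ℂ) = -(Complex.I * Complex.I) := by rw [Complex.I_mul_I, neg_neg]
  match_scalars
  · linear_combination h
  · ring

section Derivation

variable {D : Ext n →ₗ[ℝ] Ext n}

theorem cMap_mul (hD : GradedLeibniz (extGrading n) D) {p : ℕ} {x : ExtC n}
    (hx : IsHomogeneous p x) (y : ExtC n) :
    cMap D (x * y) = cMap D x * y + (-1 : ℂ) ^ p • (x * cMap D y) := by
  have key : ∀ (c : ℂ) (a : Ext n), a ∈ extGrading n p → ∀ y, cMap D ((c ⊗ₜ[ℝ] a) * y) =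
      cMap D (c ⊗ₜ[ℝ] a) * y + (-1 : ℂ) ^ p • ((c ⊗ₜ[ℝ] a) * cMap D y) := by
    intro c a ha y
    induction y using TensorProduct.induction_on with
    | zero => simp
    | add y z hy hz => rw [mul_add, map_add, hy, hz, mul_add, map_add, mul_add]; module
    | tmul d b =>
      rw [Algebra.TensorProduct.tmul_mul_tmul, cMap_tmul, cMap_tmul, cMap_tmul, hD p a ha b,
        Algebra.TensorProduct.tmul_mul_tmul, Algebra.TensorProduct.tmul_mul_tmul,
        TensorProduct.tmul_add]
      congr 1
      rcases Nat.even_or_odd p with h | h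
      · simp [h.neg_one_pow]
      · simp [h.neg_one_pow, TensorProduct.tmul_neg]
  rw [← cplx_re_im x]
  simp only [cplx, add_mul, map_add]
  rw [key _ _ hx.1, key _ _ hx.2]
  module

theorem isHomogeneous_cMap (hD : HasDegreeOne (extGrading n) D) {p : ℕ} {x : ExtC n}
    (hx : IsHomogeneous p x) : IsHomogeneous (p + 1) (cMap D x) := by
  rw [← cplx_re_im x, cMap_cplx, IsHomogeneous, reForm_cplx, imForm_cplx]
  exact ⟨hD _ _ hx.1, hD _ _ hx.2⟩

theorem mul_comm_of_isHomogeneous_two {x : ExtC n} (hx : IsHomogeneous 2 x) (y : ExtC n) :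
    x * y = y * x := by
  rw [← cplx_re_im x, ← cplx_re_im y, cplx_mul_cplx, cplx_mul_cplx]
  rw [mul_comm_of_mem_extGrading_two (a := reForm n y) hx.1,
    mul_comm_of_mem_extGrading_two (a := reForm n y) hx.2,
    mul_comm_of_mem_extGrading_two (a := imForm n y) hx.1,
    mul_comm_of_mem_extGrading_two (a := imForm n y) hx.2, add_comm (reForm n x * imForm n y)]

theorem OmegaForm_mul_oneForm {x : ExtC n} (hx : x ∈ oneForms n) :
    OmegaForm n * x = (-1 : ℂ) ^ n • (x * OmegaForm n) := by
  have := list_prod_mul_oneForm (l := List.ofFn fun k => ζ n k) (fun y hy => by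
    obtain ⟨k, rfl⟩ := (List.mem_ofFn' _ _).1 hy
    exact ζ_mem_oneForms k) hx
  rwa [List.length_ofFn] at this

theorem OmegaBar_mul_oneForm {x : ExtC n} (hx : x ∈ oneForms n) :
    OmegaBar n * x = (-1 : ℂ) ^ n • (x * OmegaBar n) := by
  have := list_prod_mul_oneForm (l := List.ofFn fun k => ζbar n k) (fun y hy => by
    obtain ⟨k, rfl⟩ := (List.mem_ofFn' _ _).1 hy
    exact ζbar_mem_oneForms k) hx
  rwa [List.length_ofFn] at this

theorem isHomogeneous_OmegaBar : IsHomogeneous n (OmegaBar n) := by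
  rw [OmegaBar_eq_cplx, IsHomogeneous, reForm_cplx, imForm_cplx]
  exact ⟨isHomogeneous_OmegaForm.1, neg_mem isHomogeneous_OmegaForm.2⟩

/-- Applying D to Ω∧ζ_0 = 0 expresses D(Ω)∧ζ_0 as ±D(ζ_0)∧Ω, because the two-form D(ζ_0) is central.
Multiplying by the remaining factors of Ω gives zero, since Ω∧ζ_1 = 0; the second factor exists
because n ≥ 2. -/
theorem cMap_OmegaForm_mul_OmegaForm (hn : 2 ≤ n) (hD1 : HasDegreeOne (extGrading n) D)
    (hD : GradedLeibniz (extGrading n) D) : cMap D (OmegaForm n) * OmegaForm n = 0 := by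
  obtain ⟨m, rfl⟩ := Nat.exists_eq_add_of_le' hn
  have hO : ∀ k, OmegaForm (m + 2) * ζ (m + 2) k = 0 := fun k => by
    rw [OmegaForm_mul_oneForm (ζ_mem_oneForms k), ζ_mul_OmegaForm, smul_zero]
  have h0 := cMap_mul hD isHomogeneous_OmegaForm (ζ (m + 2) 0)
  rw [hO, map_zero, ← mul_comm_of_isHomogeneous_two (isHomogeneous_cMap hD1 (isHomogeneous_ζ 0))]
    at h0
  have hexp : OmegaForm (m + 2) = ζ (m + 2) 0 * (ζ (m + 2) 1 *
      (List.ofFn fun k : Fin m => ζ (m + 2) k.succ.succ).prod) := by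
    rw [OmegaForm_eq, List.ofFn_succ, List.prod_cons, List.ofFn_succ, List.prod_cons]
    rfl
  have h1 : cMap D (OmegaForm (m + 2)) * ζ (m + 2) 0 =
      (-(-1 : ℂ) ^ (m + 2)) • (cMap D (ζ (m + 2) 0) * OmegaForm (m + 2)) := by
    rw [neg_smul]
    exact eq_neg_of_add_eq_zero_left h0.symm
  nth_rewrite 2 [hexp]
  rw [← mul_assoc, h1, smul_mul_assoc, mul_assoc, ← mul_assoc (OmegaForm _), hO, zero_mul, mul_zero,
    smul_zero]

theorem FC_comm (x : ExtC n) : FC n * x = x * FC n := by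
  refine mul_comm_of_isHomogeneous_two ?_ x
  rw [← pow_one (FC n), FC_pow_eq_cplx, pow_one, IsHomogeneous, reForm_cplx, imForm_cplx]
  exact ⟨FForm_mem_extGrading, zero_mem _⟩

theorem αC_mul_OmegaBar_mul_OmegaForm_ne_zero :
    αC n * OmegaBar n * OmegaForm n ≠ 0 := by
  obtain ⟨κ, hκ, h⟩ := exists_OmegaBar_mul_OmegaForm (n := n)
  rw [mul_assoc, h, mul_smul_comm]
  exact smul_ne_zero hκ αC_mul_FC_pow_ne_zero

section Coefficients

variable {s t w s' t' w' : ℝ} {X : Ext n}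

theorem cMap_OmegaForm_eq
    (hp : D (reForm n (OmegaForm n)) = s • (alphaForm n * reForm n (OmegaForm n)) +
      t • (alphaForm n * imForm n (OmegaForm n)) + w • X)
    (hm : D (imForm n (OmegaForm n)) = s' • (alphaForm n * reForm n (OmegaForm n)) +
      t' • (alphaForm n * imForm n (OmegaForm n)) + w' • X) :
    cMap D (OmegaForm n) =
      (2⁻¹ * ((s + s' * Complex.I) - (t + t' * Complex.I) * Complex.I) : ℂ) •
        (αC n * OmegaForm n) +
      (2⁻¹ * ((s + s' * Complex.I) + (t + t' * Complex.I) * Complex.I) : ℂ) •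
        (αC n * OmegaBar n) + (w + w' * Complex.I : ℂ) • ((1 : ℂ) ⊗ₜ[ℝ] X) := by
  conv_lhs => rw [← cplx_re_im (OmegaForm n), cMap_cplx, cplx_eq, hp, hm]
  have hs : ∀ (c : ℂ) (x y : ExtC n), x * c • y = c • (x * y) := fun c x y => mul_smul_comm _ _ _
  simp only [TensorProduct.tmul_add, one_tmul_smul, one_tmul_mul, one_tmul_re, one_tmul_im,
    mul_add, hs, ← αC.eq_1]
  generalize αC n * OmegaForm n = x
  generalize αC n * OmegaBar n = y
  generalize (1 : ℂ) ⊗ₜ[ℝ] X = u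
  module

/-- Multiplication by Ω kills α∧Ω and X but not α∧Ω̄, so D(Ω)∧Ω = 0 says exactly that the complex
coefficient of α∧Ω̄ vanishes. The two real equations are its real and imaginary parts. -/
theorem coefficient_relations (hn : 2 ≤ n) (hD1 : HasDegreeOne (extGrading n) D)
    (hD : GradedLeibniz (extGrading n) D) (hX : ((1 : ℂ) ⊗ₜ[ℝ] X) * OmegaForm n = 0)
    (hp : D (reForm n (OmegaForm n)) = s • (alphaForm n * reForm n (OmegaForm n)) +
      t • (alphaForm n * imForm n (OmegaForm n)) + w • X)
    (hm : D (imForm n (OmegaForm n)) = s' • (alphaForm n * reForm n (OmegaForm n)) +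
      t' • (alphaForm n * imForm n (OmegaForm n)) + w' • X) :
    s' = -t ∧ t' = s ∧ cMap D (OmegaForm n) = (s - t * Complex.I : ℂ) • (αC n * OmegaForm n) +
      (w + w' * Complex.I : ℂ) • ((1 : ℂ) ⊗ₜ[ℝ] X) := by
  have h := cMap_OmegaForm_eq hp hm
  have h0 := cMap_OmegaForm_mul_OmegaForm hn hD1 hD
  rw [h, add_mul, add_mul, smul_mul_assoc, smul_mul_assoc, smul_mul_assoc, hX, smul_zero, add_zero,
    mul_assoc, OmegaForm_mul_self (by omega), mul_zero, smul_zero, zero_add, smul_eq_zero] at h0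
  have h1 := h0.resolve_right αC_mul_OmegaBar_mul_OmegaForm_ne_zero
  have hre := congrArg Complex.re h1
  have him := congrArg Complex.im h1
  simp at hre him
  have e1 : s' = -t := by linarith
  have e2 : t' = s := by linarith
  refine ⟨e1, e2, ?_⟩
  rw [h, e1, e2]
  push_cast
  have hI := Complex.I_mul_I
  match_scalars <;> ring_nf <;> simp <;> ring

/-- The exponent starts at 2 because the remainder R disappears only when another factor F is
present. -/
theorem map_FForm_pow {lam : ℝ} {R : Ext n} (hD : GradedLeibniz (extGrading n) D)
    (hF : D (FForm n) = (2 * lam) • (alphaForm n * FForm n) + R) (hR : R * FForm n = 0) (k : ℕ) :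
    D (FForm n ^ (k + 2)) = (2 * (k + 2) * lam) • (alphaForm n * FForm n ^ (k + 2)) := by
  have hL : ∀ b, D (FForm n * b) = D (FForm n) * b + FForm n * D b := fun b => by
    rw [hD 2 _ FForm_mem_extGrading b]; norm_num
  have hc : ∀ b, FForm n * b = b * FForm n := fun b =>
    (mul_comm_of_mem_extGrading_two FForm_mem_extGrading).symm
  induction k with
  | zero =>
    rw [zero_add, sq, hL, hc, hF, add_mul, hR, smul_mul_assoc, mul_assoc]
    push_cast
    module
  | succ k ih =>
    have hR' : R * FForm n ^ (k + 2) = 0 := by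
      rw [pow_succ', ← mul_assoc, hR, zero_mul]
    have h1 : FForm n * (alphaForm n * FForm n ^ (k + 2)) = alphaForm n * FForm n ^ (k + 3) := by
      rw [hc, mul_assoc, ← pow_succ]
    have h2 : alphaForm n * FForm n * FForm n ^ (k + 2) = alphaForm n * FForm n ^ (k + 3) := by
      rw [mul_assoc, ← pow_succ']
    rw [show k + 1 + 2 = k + 2 + 1 by ring, pow_succ', hL, ih, mul_smul_comm, h1, hF, add_mul, hR',
      smul_mul_assoc, h2, ← pow_succ']
    push_cast
    module

/-- D is applied to Ω̄∧Ω = κ F^n. On the left the imaginary parts cancel between Ω and its conjugate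
and the X terms vanish, leaving the factor 2s. On the right the factor is 2nλ. Both multiply a
nonzero multiple of α∧F^n. -/
theorem trace_relation {lam : ℝ} {R : Ext n} (hn : 2 ≤ n) (hD1 : HasDegreeOne (extGrading n) D)
    (hD : GradedLeibniz (extGrading n) D) (hX : ((1 : ℂ) ⊗ₜ[ℝ] X) * OmegaForm n = 0)
    (hX' : OmegaBar n * ((1 : ℂ) ⊗ₜ[ℝ] X) = 0)
    (hF : D (FForm n) = (2 * lam) • (alphaForm n * FForm n) + R) (hR : R * FForm n = 0)
    (hp : D (reForm n (OmegaForm n)) = s • (alphaForm n * reForm n (OmegaForm n)) +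
      t • (alphaForm n * imForm n (OmegaForm n)) + w • X)
    (hm : D (imForm n (OmegaForm n)) = s' • (alphaForm n * reForm n (OmegaForm n)) +
      t' • (alphaForm n * imForm n (OmegaForm n)) + w' • X) : s = n * lam := by
  obtain ⟨-, -, hO⟩ := coefficient_relations hn hD1 hD hX hp hm
  have hB : cMap D (OmegaBar n) = (s + t * Complex.I : ℂ) • (αC n * OmegaBar n) +
      (w - w' * Complex.I : ℂ) • ((1 : ℂ) ⊗ₜ[ℝ] X) := by
    rw [← conjC_OmegaForm, cMap_conjC, hO, map_add, conjC_smul, conjC_smul, map_mul,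
      conjC_one_tmul, αC, conjC_one_tmul]
    simp [sub_eq_add_neg]
  obtain ⟨κ, hκ, hBO⟩ := exists_OmegaBar_mul_OmegaForm (n := n)
  have h1 : cMap D (OmegaBar n * OmegaForm n) = (2 * s : ℂ) • (αC n * (OmegaBar n * OmegaForm n)) := by
    have hs : ∀ (c : ℂ) (x y : ExtC n), x * c • y = c • (x * y) := fun c x y => mul_smul_comm _ _ _
    rw [cMap_mul hD isHomogeneous_OmegaBar, hO, hB, add_mul, mul_add, smul_mul_assoc,
      smul_mul_assoc, hX, hs, hs, hX', ← mul_assoc (OmegaBar n),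
      OmegaBar_mul_oneForm αC_mem_oneForms, smul_mul_assoc, smul_zero, smul_zero, add_zero,
      add_zero, smul_comm _ ((-1 : ℂ) ^ n), smul_smul ((-1 : ℂ) ^ n), ← mul_pow, neg_one_mul,
      neg_neg, one_pow, one_smul, mul_assoc]
    module
  obtain ⟨m, rfl⟩ := Nat.exists_eq_add_of_le' hn
  have h2 : cMap D (FC (m + 2) ^ (m + 2)) =
      (2 * (m + 2) * lam : ℂ) • (αC (m + 2) * FC (m + 2) ^ (m + 2)) := by
    rw [FC_pow_eq, cMap_tmul, map_FForm_pow hD hF hR, one_tmul_smul, one_tmul_mul, αC]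
    push_cast
    rfl
  have hs : ∀ (c : ℂ) (x y : ExtC (m + 2)), x * c • y = c • (x * y) := fun c x y =>
    mul_smul_comm _ _ _
  rw [hBO, map_smul, h2, hs, smul_smul, smul_smul] at h1
  have h3 := smul_left_injective ℂ (αC_mul_FC_pow_ne_zero (n := m + 2)) h1
  have h4 : (s : ℂ) = ((((m + 2 : ℕ) : ℝ) * lam : ℝ) : ℂ) := by
    refine mul_left_cancel₀ (mul_ne_zero hκ two_ne_zero) ?_
    push_cast
    linear_combination -h3
  exact Complex.ofReal_injective h4

end Coefficients

end Derivation

/-! ### Complex-valued invariant forms -/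

theorem tmul_add_I_tmul_injective {M : Type*} [AddCommGroup M] [Module ℝ M] {a b c d : M}
    (h : (1 : ℂ) ⊗ₜ[ℝ] a + Complex.I ⊗ₜ[ℝ] b = (1 : ℂ) ⊗ₜ[ℝ] c + Complex.I ⊗ₜ[ℝ] d) :
    a = c ∧ b = d := by
  constructor
  · have := congrArg ((TensorProduct.lid ℝ M).toLinearMap ∘ₗ LinearMap.rTensor M Complex.reLm) h
    simpa using this
  · have := congrArg ((TensorProduct.lid ℝ M).toLinearMap ∘ₗ LinearMap.rTensor M Complex.imLm) h
    simpa using this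

theorem smul_tmul_add_I_tmul {M : Type*} [AddCommGroup M] [Module ℝ M] (x y : ℝ) (a b : M) :
    ((x : ℂ) + (y : ℂ) * Complex.I) • ((1 : ℂ) ⊗ₜ[ℝ] a + Complex.I ⊗ₜ[ℝ] b) =
      (1 : ℂ) ⊗ₜ[ℝ] (x • a - y • b) + Complex.I ⊗ₜ[ℝ] (x • b + y • a) := by
  have h1 : ∀ (c : ℂ) (a : M), c ⊗ₜ[ℝ] a = c • ((1 : ℂ) ⊗ₜ[ℝ] a) := fun c a => by
    rw [TensorProduct.smul_tmul', smul_eq_mul, mul_one]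
  have h2 : ∀ (r : ℝ) (a : M), (1 : ℂ) ⊗ₜ[ℝ] (r • a) = (r : ℂ) • ((1 : ℂ) ⊗ₜ[ℝ] a) :=
    fun r a => by
      rw [← TensorProduct.smul_tmul, TensorProduct.smul_tmul']
      congr 1
  rw [h1 Complex.I, h1 Complex.I]
  simp only [TensorProduct.tmul_add, TensorProduct.tmul_sub, h2]
  match_scalars
  · ring
  · linear_combination (y : ℂ) * Complex.I_mul_I

theorem extC_Ω_eq_iff {f : Inv n →ₗ[ℝ] Inv n} {p m : Inv n} :
    extC f (Ω n) = (1 : ℂ) ⊗ₜ[ℝ] p + Complex.I ⊗ₜ[ℝ] m ↔ f (Ωp n) = p ∧ f (Ωm n) = m := by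
  have h : extC f (Ω n) = (1 : ℂ) ⊗ₜ[ℝ] f (Ωp n) + Complex.I ⊗ₜ[ℝ] f (Ωm n) := by
    simp [extC, Ω]
  rw [h]
  exact ⟨tmul_add_I_tmul_injective, fun h => by rw [h.1, h.2]⟩

theorem α_mul_Ω : ((1 : ℂ) ⊗ₜ[ℝ] α n) * Ω n =
    (1 : ℂ) ⊗ₜ[ℝ] (α n * Ωp n) + Complex.I ⊗ₜ[ℝ] (α n * Ωm n) := by
  rw [Ω, mul_add, Algebra.TensorProduct.tmul_mul_tmul, Algebra.TensorProduct.tmul_mul_tmul, one_mul,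
    one_mul]

theorem typeA_iff {f : Inv n →ₗ[ℝ] Inv n} {lam mu : ℝ} : TypeA f lam mu ↔ f (α n) = 0 ∧
    f (F n) = (2 * lam) • (α n * F n) ∧
    f (Ωp n) = (n * lam) • (α n * Ωp n) + (n * mu) • (α n * Ωm n) ∧
    f (Ωm n) = (n * lam) • (α n * Ωm n) - (n * mu) • (α n * Ωp n) := by
  have h : (n : ℂ) * ((lam : ℂ) - (mu : ℂ) * Complex.I) =
      ((n * lam : ℝ) : ℂ) + ((-(n * mu) : ℝ) : ℂ) * Complex.I := by
    push_cast; ring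
  rw [TypeA, h, α_mul_Ω, smul_tmul_add_I_tmul, extC_Ω_eq_iff, neg_smul, sub_neg_eq_add, neg_smul,
    ← sub_eq_add_neg]

theorem typeB_iff {f : Inv n →ₗ[ℝ] Inv n} {lam mu : ℝ} : TypeB f lam mu ↔ f (α n) = lam • F n ∧
    f (F n) = 0 ∧ f (Ωp n) = mu • (α n * Ωm n) ∧ f (Ωm n) = -mu • (α n * Ωp n) := by
  have h : -(mu : ℂ) * Complex.I = ((0 : ℝ) : ℂ) + ((-mu : ℝ) : ℂ) * Complex.I := by
    push_cast; ring
  rw [TypeB, h, α_mul_Ω, smul_tmul_add_I_tmul, extC_Ω_eq_iff, neg_smul, sub_neg_eq_add, neg_smul,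
    zero_smul, zero_smul, zero_add, zero_add]

theorem typeD_iff {f : Inv n →ₗ[ℝ] Inv n} {lam mu : ℝ} : TypeD f lam mu ↔ f (α n) = 0 ∧
    f (F n) = (3 * lam) • Ωm n - (3 * mu) • Ωp n ∧
    f (Ωp n) = (2 * lam) • (F n * F n) ∧ f (Ωm n) = (2 * mu) • (F n * F n) := by
  have h : 2 * ((lam : ℂ) + Complex.I * (mu : ℂ)) =
      ((2 * lam : ℝ) : ℂ) + ((2 * mu : ℝ) : ℂ) * Complex.I := by
    push_cast; ring
  have h2 : (1 : ℂ) ⊗ₜ[ℝ] (F n * F n) = (1 : ℂ) ⊗ₜ[ℝ] (F n * F n) + Complex.I ⊗ₜ[ℝ] 0 := by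
    rw [TensorProduct.tmul_zero, add_zero]
  rw [TypeD, h, h2, smul_tmul_add_I_tmul, extC_Ω_eq_iff, smul_zero, smul_zero, sub_zero, zero_add]

/-! ### Invariants of low degree -/

theorem α_mem : α n ∈ invGrading n 1 := alphaForm_mem_extGrading

theorem F_mem : F n ∈ invGrading n 2 := FForm_mem_extGrading

theorem Ωp_mem : Ωp n ∈ invGrading n n := isHomogeneous_OmegaForm.1

theorem Ωm_mem : Ωm n ∈ invGrading n n := isHomogeneous_OmegaForm.2

theorem F_mul_comm (x : Inv n) : F n * x = x * F n :=
  Subtype.ext (mul_comm_of_mem_extGrading_two FForm_mem_extGrading).symm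

theorem one_tmul_coe_F_pow (k : ℕ) : (1 : ℂ) ⊗ₜ[ℝ] ((F n ^ k : Inv n) : Ext n) = FC n ^ k := by
  rw [FC_pow_eq]; rfl

theorem one_tmul_coe_α_mul_F_pow (k : ℕ) :
    (1 : ℂ) ⊗ₜ[ℝ] ((α n * F n ^ k : Inv n) : Ext n) = αC n * FC n ^ k := by
  rw [FC_pow_eq, αC, ← one_tmul_mul]; rfl

theorem α_mul_F_pow_ne_zero {k : ℕ} (hk : k ≤ n) : α n * F n ^ k ≠ 0 := fun h =>
  αC_mul_FC_pow_ne_zero_of_le hk (by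
    rw [← one_tmul_coe_α_mul_F_pow, h]; simp)

theorem F_pow_ne_zero {k : ℕ} (hk : k ≤ n) : F n ^ k ≠ 0 := fun h =>
  α_mul_F_pow_ne_zero hk (by rw [h, mul_zero])

theorem F_mul_Ωp : F n * Ωp n = 0 := by
  refine Subtype.ext (one_tmul_eq_zero ?_)
  change (1 : ℂ) ⊗ₜ[ℝ] (FForm n * reForm n (OmegaForm n)) = 0
  rw [one_tmul_mul, one_tmul_re, mul_smul_comm, mul_add, ← FC.eq_1, FC_mul_OmegaForm,
    FC_mul_OmegaBar, add_zero, smul_zero]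

theorem F_mul_Ωm : F n * Ωm n = 0 := by
  refine Subtype.ext (one_tmul_eq_zero ?_)
  change (1 : ℂ) ⊗ₜ[ℝ] (FForm n * imForm n (OmegaForm n)) = 0
  rw [one_tmul_mul, one_tmul_im, mul_add]
  have hs : ∀ (c : ℂ) (x y : ExtC n), x * c • y = c • (x * y) := fun c x y => mul_smul_comm _ _ _
  rw [hs, hs, ← FC.eq_1, FC_mul_OmegaForm, FC_mul_OmegaBar, smul_zero, smul_zero, add_zero]

/-- Besides α∧Ω⁺ and α∧Ω⁻, degree n+1 contains one standard form: α∧F^(n/2) for n even, F^((n+1)/2)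
for n odd. The factorization through F is recorded because F∧Ω = F∧Ω̄ = 0 then gives X∧Ω = Ω̄∧X = 0.
-/
theorem exists_top_invariant (hn : 2 ≤ n) : ∃ X X' : Inv n, X = F n * X' ∧ F n * X ≠ 0 ∧
    (n = 3 → X = F n * F n) ∧
    ∀ y ∈ invGrading n (n + 1), ∃ s t w : ℝ,
      y = s • (α n * Ωp n) + t • (α n * Ωm n) + w • X := by
  have key : ∀ X : Inv n, (∀ k, k * 2 = n + 1 → F n ^ k = X) →
      (∀ k, 1 + k * 2 = n + 1 → α n * F n ^ k = X) →
      ∀ y ∈ invGrading n (n + 1), ∃ s t w : ℝ,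
      y = s • (α n * Ωp n) + t • (α n * Ωm n) + w • X := by
    intro X h1 h2 y hy
    have hle : Submodule.span ℝ (stdInv n '' {i | stdDeg n i = n + 1}) ≤
        Submodule.span ℝ {α n * Ωp n, α n * Ωm n, X} := by
      rw [Submodule.span_le]
      rintro _ ⟨⟨ε, i⟩, hi, rfl⟩
      refine Submodule.subset_span ?_
      simp only [stdDeg, Set.mem_ofPred_eq] at hi
      rcases ε with _ | _ <;> rcases i with k | b <;> simp at hi
      · right; right
        simpa [stdInv] using h1 k hi
      · right; right
        simpa [stdInv] using h2 k (by omega)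
      · cases b
        · right; left; simp [stdInv]
        · left; simp [stdInv]
    have := hle (mem_span_of_mem_invGrading (by omega) hy)
    rw [Submodule.mem_span_triple] at this
    obtain ⟨s, t, w, h⟩ := this
    exact ⟨s, t, w, h.symm⟩
  rcases Nat.even_or_odd' n with ⟨m, hm | hm⟩
  · refine ⟨α n * F n ^ m, α n * F n ^ (m - 1), ?_, ?_, by omega, key _ (by omega) ?_⟩
    · rw [F_mul_comm, mul_assoc, ← pow_succ, Nat.sub_add_cancel (by omega)]
    · rw [F_mul_comm, mul_assoc, ← pow_succ]
      exact α_mul_F_pow_ne_zero (by omega)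
    · intro k hk
      rw [show k = m by omega]
  · refine ⟨F n ^ (m + 1), F n ^ m, pow_succ' _ _, ?_, ?_, key _ ?_ (by omega)⟩
    · rw [← pow_succ']
      exact F_pow_ne_zero (by omega)
    · intro h
      rw [show m = 1 by omega, sq]
    · intro k hk
      rw [show k = m + 1 by omega]

theorem mem_span_of_degree_two {y : Inv n} (hn : 2 ≤ n) (hy : y ∈ invGrading n 2) : ∃ c a b : ℝ,
    y = c • F n + a • Ωp n + b • Ωm n ∧ (n ≠ 2 → a = 0 ∧ b = 0) := by
  by_cases h2 : n = 2
  · have hle : Submodule.span ℝ (stdInv n '' {i | stdDeg n i = 2}) ≤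
        Submodule.span ℝ {F n, Ωp n, Ωm n} := by
      rw [Submodule.span_le]
      rintro _ ⟨⟨ε, i⟩, hi, rfl⟩
      refine Submodule.subset_span ?_
      simp only [stdDeg, Set.mem_ofPred_eq] at hi
      rcases ε with _ | _ <;> rcases i with k | b <;> simp at hi
      · left; simp [stdInv, show k = 1 by omega]
      · cases b <;> simp [stdInv]
      · omega
      · omega
    have := hle (mem_span_of_mem_invGrading (by omega) hy)
    rw [Submodule.mem_span_triple] at this
    obtain ⟨c, a, b, h⟩ := this
    exact ⟨c, a, b, h.symm, fun h => absurd h2 h⟩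
  · have hle : Submodule.span ℝ (stdInv n '' {i | stdDeg n i = 2}) ≤
        Submodule.span ℝ {F n} := by
      rw [Submodule.span_le]
      rintro _ ⟨⟨ε, i⟩, hi, rfl⟩
      refine Submodule.subset_span ?_
      simp only [stdDeg, Set.mem_ofPred_eq] at hi
      rcases ε with _ | _ <;> rcases i with k | b <;> simp at hi
      · simp [stdInv, show k = 1 by omega]
      · omega
      · omega
      · omega
    have := hle (mem_span_of_mem_invGrading (by omega) hy)
    rw [Submodule.mem_span_singleton] at this
    obtain ⟨c, h⟩ := this
    exact ⟨c, 0, 0, by simp [h], fun _ => ⟨rfl, rfl⟩⟩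

theorem mem_span_of_degree_three {y : Inv n} (hn : 3 ≤ n) (hy : y ∈ invGrading n 3) :
    ∃ c a b : ℝ, y = c • (α n * F n) + a • Ωp n + b • Ωm n ∧ (n ≠ 3 → a = 0 ∧ b = 0) := by
  by_cases h2 : n = 3
  · have hle : Submodule.span ℝ (stdInv n '' {i | stdDeg n i = 3}) ≤
        Submodule.span ℝ {α n * F n, Ωp n, Ωm n} := by
      rw [Submodule.span_le]
      rintro _ ⟨⟨ε, i⟩, hi, rfl⟩
      refine Submodule.subset_span ?_
      simp only [stdDeg, Set.mem_ofPred_eq] at hi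
      rcases ε with _ | _ <;> rcases i with k | b <;> simp at hi
      · omega
      · cases b <;> simp [stdInv]
      · left; simp [stdInv, show k = 1 by omega]
      · omega
    have := hle (mem_span_of_mem_invGrading (by omega) hy)
    rw [Submodule.mem_span_triple] at this
    obtain ⟨c, a, b, h⟩ := this
    exact ⟨c, a, b, h.symm, fun h => absurd h2 h⟩
  · have hle : Submodule.span ℝ (stdInv n '' {i | stdDeg n i = 3}) ≤
        Submodule.span ℝ {α n * F n} := by
      rw [Submodule.span_le]
      rintro _ ⟨⟨ε, i⟩, hi, rfl⟩
      refine Submodule.subset_span ?_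
      simp only [stdDeg, Set.mem_ofPred_eq] at hi
      rcases ε with _ | _ <;> rcases i with k | b <;> simp at hi
      · omega
      · omega
      · simp [stdInv, show k = 1 by omega]
      · omega
    have := hle (mem_span_of_mem_invGrading (by omega) hy)
    rw [Submodule.mem_span_singleton] at this
    obtain ⟨c, h⟩ := this
    exact ⟨c, 0, 0, by simp [h], fun _ => ⟨rfl, rfl⟩⟩

/-! ### Operators in normal form -/

/-- This collects the three identities imposed by the extension. The last conclusion is what remains
of D(F∧Ω) = 0 once the terms containing F∧Ω are removed. -/
theorem exists_coefficients (hn : 2 ≤ n) {f : Inv n →ₗ[ℝ] Inv n}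
    (hf : IsDifferentialOperator (invGrading n) f) (hext : ExtendsToDerivation f) {lam : ℝ}
    {R : Inv n} (hF : f (F n) = (2 * lam) • (α n * F n) + R) (hR : R * F n = 0) :
    ∃ (X : Inv n) (t w w' : ℝ), F n * X ≠ 0 ∧ (n = 3 → X = F n * F n) ∧
      ((1 : ℂ) ⊗ₜ[ℝ] (X : Ext n)) * OmegaForm n = 0 ∧
      f (Ωp n) = (n * lam) • (α n * Ωp n) + t • (α n * Ωm n) + w • X ∧
      f (Ωm n) = (-t) • (α n * Ωp n) + (n * lam) • (α n * Ωm n) + w' • X ∧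
      ((1 : ℂ) ⊗ₜ[ℝ] (R : Ext n)) * OmegaForm n +
        ((w : ℂ) + w' * Complex.I) • ((1 : ℂ) ⊗ₜ[ℝ] ((F n * X : Inv n) : Ext n)) = 0 := by
  obtain ⟨D, hD1, hD, hDf⟩ := hext
  obtain ⟨X, X', hXX', hX0, hX3, hX⟩ := exists_top_invariant hn
  obtain ⟨s, t, w, hp⟩ := hX _ (hf.degree_one _ _ Ωp_mem)
  obtain ⟨s', t', w', hm⟩ := hX _ (hf.degree_one _ _ Ωm_mem)
  have hXO : ((1 : ℂ) ⊗ₜ[ℝ] (X : Ext n)) * OmegaForm n = 0 := by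
    rw [hXX', F_mul_comm, Subalgebra.coe_mul, one_tmul_mul, mul_assoc]
    change _ * (FC n * _) = 0
    rw [FC_mul_OmegaForm, mul_zero]
  have hBX : OmegaBar n * ((1 : ℂ) ⊗ₜ[ℝ] (X : Ext n)) = 0 := by
    rw [hXX', Subalgebra.coe_mul, one_tmul_mul, ← mul_assoc]
    change _ * FC n * _ = 0
    rw [← FC_comm, FC_mul_OmegaBar, zero_mul]
  have hp' : D (reForm n (OmegaForm n)) = s • (alphaForm n * reForm n (OmegaForm n)) +
      t • (alphaForm n * imForm n (OmegaForm n)) + w • (X : Ext n) := by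
    rw [← coe_Ωp, hDf, hp]; rfl
  have hm' : D (imForm n (OmegaForm n)) = s' • (alphaForm n * reForm n (OmegaForm n)) +
      t' • (alphaForm n * imForm n (OmegaForm n)) + w' • (X : Ext n) := by
    rw [← coe_Ωm, hDf, hm]; rfl
  have hF' : D (FForm n) = (2 * lam) • (alphaForm n * FForm n) + (R : Ext n) := by
    rw [← coe_F, hDf, hF]; rfl
  obtain ⟨h1, h2, h3⟩ := coefficient_relations hn hD1 hD hXO hp' hm'
  have h4 := trace_relation hn hD1 hD hXO hBX hF' (congrArg Subtype.val hR) hp' hm'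
  subst h1 h2 h4
  refine ⟨X, t, w, w', hX0, hX3, hXO, hp, hm, ?_⟩
  have hFh : IsHomogeneous 2 (FC n) := by
    rw [← pow_one (FC n), FC_pow_eq_cplx, pow_one, IsHomogeneous, reForm_cplx, imForm_cplx]
    exact ⟨FForm_mem_extGrading, zero_mem _⟩
  -- Leibniz on F∧Ω = 0: in D(F)∧Ω only R∧Ω survives, and in F∧D(Ω) only the multiple of F∧X.
  have h5 := cMap_mul hD hFh (OmegaForm n)
  have hs : ∀ (c : ℂ) (x y : ExtC n), x * c • y = c • (x * y) := fun c x y => mul_smul_comm _ _ _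
  rw [FC_mul_OmegaForm, map_zero, h3, FC, cMap_tmul, hF', TensorProduct.tmul_add, one_tmul_smul,
    one_tmul_mul, add_mul, smul_mul_assoc, mul_assoc, mul_add, hs, hs, ← FC.eq_1,
    FC_mul_OmegaForm, mul_zero, smul_zero, zero_add, ← mul_assoc (FC n), FC_comm, mul_assoc,
    FC_mul_OmegaForm, mul_zero, smul_zero, zero_add, neg_one_sq, one_smul, FC, ← one_tmul_mul] at h5
  exact h5.symm

/-- With R = 0 the relation from F∧Ω = 0 kills the coefficient of X, since F∧X ≠ 0. Then f²(α) = 2cλ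
α∧F = 0 separates the cases: c = 0 is type A, and c ≠ 0 forces λ = 0, type B. -/
theorem typeA_or_typeB (hn : 2 ≤ n) {f : Inv n →ₗ[ℝ] Inv n}
    (hf : IsDifferentialOperator (invGrading n) f) (hext : ExtendsToDerivation f) {c lam : ℝ}
    (hα : f (α n) = c • F n) (hF : f (F n) = (2 * lam) • (α n * F n)) :
    (∃ lam mu : ℝ, TypeA f lam mu) ∨ ∃ lam mu : ℝ, TypeB f lam mu := by
  obtain ⟨X, t, w, w', hX0, -, -, hp, hm, hrel⟩ :=
    exists_coefficients hn hf hext (lam := lam) (R := 0) (by rw [hF, add_zero]) (zero_mul _)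
  have hn0 : (n : ℝ) ≠ 0 := by positivity
  have hw : (w : ℂ) + w' * Complex.I = 0 := by
    rw [Subalgebra.coe_zero, TensorProduct.tmul_zero, zero_mul, zero_add, smul_eq_zero] at hrel
    refine hrel.resolve_right fun h => hX0 (Subtype.ext (one_tmul_eq_zero h))
  have hw0 : w = 0 := by simpa using congrArg Complex.re hw
  have hw0' : w' = 0 := by simpa using congrArg Complex.im hw
  rw [hw0, zero_smul, add_zero] at hp
  rw [hw0', zero_smul, add_zero] at hm
  have h2 := hf.sq_zero (α n)
  have hαF : α n * F n ≠ 0 := by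
    have := α_mul_F_pow_ne_zero (n := n) (k := 1) (by omega)
    rwa [pow_one] at this
  rw [hα, map_smul, hF, smul_smul, smul_eq_zero] at h2
  have h3 := h2.resolve_right hαF
  by_cases hc : c = 0
  · left
    refine ⟨lam, t / n, typeA_iff.2 ⟨by rw [hα, hc, zero_smul], hF, ?_, ?_⟩⟩
    · rw [hp, mul_div_cancel₀ _ hn0]
    · rw [hm, mul_div_cancel₀ _ hn0]
      module
  · have hl : lam = 0 := by simpa [hc] using h3
    subst hl
    right
    refine ⟨c, t, typeB_iff.2 ⟨hα, by rw [hF]; simp, by rw [hp]; simp, by rw [hm]; simp⟩⟩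

theorem smul_Ωp_add_smul_Ωm_mul_OmegaForm (hn : 0 < n) (p q : ℝ) :
    ((1 : ℂ) ⊗ₜ[ℝ] ((p • Ωp n + q • Ωm n : Inv n) : Ext n)) * OmegaForm n =
      (2⁻¹ * ((p : ℂ) + q * Complex.I)) • (OmegaBar n * OmegaForm n) := by
  have mulp : ((1 : ℂ) ⊗ₜ[ℝ] (Ωp n : Ext n)) * OmegaForm n =
      (2⁻¹ : ℂ) • (OmegaBar n * OmegaForm n) := by
    rw [coe_Ωp, one_tmul_re, smul_mul_assoc, add_mul, OmegaForm_mul_self hn, zero_add]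
  have mulm : ((1 : ℂ) ⊗ₜ[ℝ] (Ωm n : Ext n)) * OmegaForm n =
      (2⁻¹ * Complex.I : ℂ) • (OmegaBar n * OmegaForm n) := by
    rw [coe_Ωm, one_tmul_im, add_mul, smul_mul_assoc, smul_mul_assoc,
      OmegaForm_mul_self hn, smul_zero, zero_add]
  rw [Subalgebra.coe_add, Subalgebra.coe_smul, Subalgebra.coe_smul, TensorProduct.tmul_add,
    one_tmul_smul, one_tmul_smul, add_mul, smul_mul_assoc, smul_mul_assoc, mulp, mulm]
  module

theorem OmegaBar_mul_OmegaForm_ne_zero : OmegaBar n * OmegaForm n ≠ 0 := fun h =>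
  αC_mul_OmegaBar_mul_OmegaForm_ne_zero (n := n) (by rw [mul_assoc, h, mul_zero])

/-- Multiplication by Ω removes α∧F and turns the rest into (p + qi)/2 times the nonzero form Ω̄∧Ω.
-/
theorem smul_Ωp_add_smul_Ωm_eq_zero (hn : 0 < n) {l p q : ℝ}
    (h : l • (α n * F n) + (p • Ωp n + q • Ωm n) = 0) : p = 0 ∧ q = 0 := by
  have h3 := congrArg (fun x : Inv n => ((1 : ℂ) ⊗ₜ[ℝ] (x : Ext n)) * OmegaForm n) h
  beta_reduce at h3
  rw [Subalgebra.coe_add, TensorProduct.tmul_add, add_mul,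
    smul_Ωp_add_smul_Ωm_mul_OmegaForm hn, Subalgebra.coe_smul, one_tmul_smul, Subalgebra.coe_mul,
    one_tmul_mul, smul_mul_assoc, mul_assoc, coe_F, ← FC.eq_1, FC_mul_OmegaForm, mul_zero,
    smul_zero, zero_add, Subalgebra.coe_zero, TensorProduct.tmul_zero, zero_mul, smul_eq_zero] at h3
  have h4 := h3.resolve_right OmegaBar_mul_OmegaForm_ne_zero
  have h5 : (p : ℂ) + q * Complex.I = 0 := by linear_combination 2 * h4
  exact ⟨by simpa using congrArg Complex.re h5, by simpa using congrArg Complex.im h5⟩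

theorem α_mul_smul_Ωp_add_smul_Ωm_eq_zero (hn : 0 < n) {p q w : ℝ} {X : Inv n}
    (hX : ((1 : ℂ) ⊗ₜ[ℝ] (X : Ext n)) * OmegaForm n = 0)
    (h : α n * (p • Ωp n + q • Ωm n) + w • X = 0) : p = 0 ∧ q = 0 := by
  have h3 := congrArg (fun x : Inv n => ((1 : ℂ) ⊗ₜ[ℝ] (x : Ext n)) * OmegaForm n) h
  beta_reduce at h3
  have hs : ∀ (c : ℂ) (x y : ExtC n), x * c • y = c • (x * y) := fun c x y => mul_smul_comm _ _ _
  rw [Subalgebra.coe_add, TensorProduct.tmul_add, add_mul, Subalgebra.coe_smul _ w, one_tmul_smul,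
    smul_mul_assoc, hX, smul_zero, add_zero, Subalgebra.coe_mul, one_tmul_mul, mul_assoc,
    smul_Ωp_add_smul_Ωm_mul_OmegaForm hn, hs, Subalgebra.coe_zero, TensorProduct.tmul_zero,
    zero_mul, coe_α, ← αC.eq_1, ← mul_assoc, smul_eq_zero] at h3
  have h4 := h3.resolve_right αC_mul_OmegaBar_mul_OmegaForm_ne_zero
  have h5 : (p : ℂ) + q * Complex.I = 0 := by linear_combination 2 * h4
  exact ⟨by simpa using congrArg Complex.re h5, by simpa using congrArg Complex.im h5⟩

/-- The component of f²(F) = 0 along α∧Ω⁺ and α∧Ω⁻ is the complex equation ((s - 2λ) + ti)(p + qi) =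
0, and p + qi ≠ 0. -/
theorem trace_eq_zero_of_sq_zero (hn : 0 < n) {f : Inv n →ₗ[ℝ] Inv n}
    (hf : IsDifferentialOperator (invGrading n) f) {lam p q s t w w' : ℝ} {X : Inv n}
    (hX : ((1 : ℂ) ⊗ₜ[ℝ] (X : Ext n)) * OmegaForm n = 0) (hα : f (α n) = 0)
    (hF : f (F n) = (2 * lam) • (α n * F n) + (p • Ωp n + q • Ωm n))
    (hp : f (Ωp n) = s • (α n * Ωp n) + t • (α n * Ωm n) + w • X)
    (hm : f (Ωm n) = (-t) • (α n * Ωp n) + s • (α n * Ωm n) + w' • X)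
    (hpq : ¬(p = 0 ∧ q = 0)) : s = 2 * lam ∧ t = 0 := by
  have h2 := hf.sq_zero (F n)
  have hαL : ∀ b, f (α n * b) = -(α n * f b) := fun b => by
    rw [hf.leibniz 1 _ α_mem b, hα, zero_mul, zero_add, pow_one, neg_one_mul]
  have hαα : α n * α n = 0 := Subtype.ext (ExteriorAlgebra.ι_sq_zero _)
  rw [hF, map_add, map_smul, hαL, hF, map_add, map_smul, map_smul, hp, hm, mul_add,
    mul_smul_comm, ← mul_assoc, hαα, zero_mul, smul_zero, zero_add, mul_add, mul_smul_comm,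
    mul_smul_comm] at h2
  obtain ⟨h3, h4⟩ := α_mul_smul_Ωp_add_smul_Ωm_eq_zero hn hX
    (p := (s - 2 * lam) * p - t * q) (q := (s - 2 * lam) * q + t * p) (w := p * w + q * w') (by
      rw [← h2, mul_add, mul_smul_comm, mul_smul_comm]
      module)
  have hsum : p ^ 2 + q ^ 2 ≠ 0 := by
    intro h
    exact hpq ⟨by nlinarith [sq_nonneg p, sq_nonneg q], by nlinarith [sq_nonneg p, sq_nonneg q]⟩
  -- Real and imaginary parts after multiplying that equation by p - qi.
  have h5 : (s - 2 * lam) * (p ^ 2 + q ^ 2) = 0 := by linear_combination p * h3 + q * h4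
  have h6 : t * (p ^ 2 + q ^ 2) = 0 := by linear_combination p * h4 - q * h3
  exact ⟨sub_eq_zero.1 ((mul_eq_zero.1 h5).resolve_right hsum),
    (mul_eq_zero.1 h6).resolve_right hsum⟩

/-- First f²(α) = c f(F) = 0 with f(F) ≠ 0 gives c = 0. The trace relation gives s = 3λ whereas
f²(F) = 0 gives s = 2λ, so λ = 0. Finally F∧Ω = 0 determines f(Ω) from f(F). -/
theorem typeD_of_three (hn : n = 3) {f : Inv n →ₗ[ℝ] Inv n}
    (hf : IsDifferentialOperator (invGrading n) f) (hext : ExtendsToDerivation f) {c lam p q : ℝ}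
    (hα : f (α n) = c • F n) (hF : f (F n) = (2 * lam) • (α n * F n) + (p • Ωp n + q • Ωm n))
    (hpq : ¬(p = 0 ∧ q = 0)) : ∃ lam mu : ℝ, TypeD f lam mu := by
  have hn0 : 0 < n := by omega
  obtain ⟨X, t, w, w', hX0, hX3, hXO, hp, hm, hrel⟩ :=
    exists_coefficients (by omega) hf hext hF (by
      rw [add_mul, smul_mul_assoc, smul_mul_assoc, ← F_mul_comm, ← F_mul_comm, F_mul_Ωp, F_mul_Ωm,
        smul_zero, smul_zero, add_zero])
  have hX := hX3 hn
  have hc : c = 0 := by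
    have h2 := hf.sq_zero (α n)
    rw [hα, map_smul, hF, smul_eq_zero] at h2
    exact h2.resolve_right fun h => hpq (smul_Ωp_add_smul_Ωm_eq_zero hn0 h)
  rw [hc, zero_smul] at hα
  obtain ⟨h1, ht⟩ := trace_eq_zero_of_sq_zero hn0 hf hXO hα hF hp hm hpq
  have hlam : lam = 0 := by
    rw [hn] at h1
    push_cast at h1
    linarith
  -- With Ω̄∧Ω = (4i/3) F³ the relation becomes (2i/3)(p + qi) + (w + w'i) = 0. Hence the type D
  -- parameters below are q/3 and -p/3.
  have hW : w = 2 * (q / 3) ∧ w' = 2 * (-p / 3) := by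
    have h3 : F n * X = F n ^ 3 := by rw [hX, pow_three]
    have h4 : OmegaBar n * OmegaForm n = (4 / 3 * Complex.I) • FC n ^ 3 := by
      subst hn; exact OmegaBar_mul_OmegaForm_three
    rw [smul_Ωp_add_smul_Ωm_mul_OmegaForm hn0, h3, one_tmul_coe_F_pow, h4, smul_smul,
      ← add_smul] at hrel
    have h1 := (smul_eq_zero.1 hrel).resolve_right (FC_pow_ne_zero_of_le hn.ge)
    have hre := congrArg Complex.re h1
    have him := congrArg Complex.im h1
    simp at hre him
    constructor <;> linarith
  refine ⟨q / 3, -p / 3, typeD_iff.2 ⟨hα, ?_, ?_, ?_⟩⟩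
  · rw [hF, hlam]
    module
  · rw [hp, hW.1, hX, ht, hlam]; simp
  · rw [hm, hW.2, hX, ht, hlam]; simp

theorem forward_of_three_le (hn : 3 ≤ n) {f : Inv n →ₗ[ℝ] Inv n}
    (hf : IsDifferentialOperator (invGrading n) f) (hext : ExtendsToDerivation f) :
    (∃ lam mu : ℝ, TypeA f lam mu) ∨ (∃ lam mu : ℝ, TypeB f lam mu) ∨
      (n = 3 ∧ ∃ lam mu : ℝ, TypeD f lam mu) := by
  obtain ⟨c, a, b, hα, hab⟩ := mem_span_of_degree_two (by omega) (hf.degree_one _ _ α_mem)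
  obtain ⟨l, p, q, hF, hpq⟩ := mem_span_of_degree_three hn (hf.degree_one _ _ F_mem)
  obtain ⟨rfl, rfl⟩ := hab (by omega)
  rw [zero_smul, zero_smul, add_zero, add_zero] at hα
  rw [show l = 2 * (l / 2) by ring] at hF
  by_cases h0 : p = 0 ∧ q = 0
  · obtain ⟨rfl, rfl⟩ := h0
    rw [zero_smul, zero_smul, add_zero, add_zero] at hF
    rcases typeA_or_typeB (by omega) hf hext hα hF with h | h
    · exact Or.inl h
    · exact Or.inr (Or.inl h)
  · have h3 : n = 3 := by
      by_contra h
      exact h0 (hpq h)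
    rw [add_assoc] at hF
    exact Or.inr (Or.inr ⟨h3, typeD_of_three h3 hf hext hα hF h0⟩)

/-! ### Construction of derivations -/

/-- The matrix with rows (-v, d v) and (0, v) squares to zero, since the two-form d v commutes with
v, so v ↦ m v extends to an algebra map φ. Its lower diagonal entry is the identity, its upper one
the parity involution, and multiplicativity of φ is the graded Leibniz rule for the corner entry. -/
theorem exists_derivation (d : T n →ₗ[ℝ] Ext n) (hd : ∀ v, d v ∈ extGrading n 2) :
    ∃ D : Ext n →ₗ[ℝ] Ext n, HasDegreeOne (extGrading n) D ∧ GradedLeibniz (extGrading n) D ∧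
      ∀ v, D (ExteriorAlgebra.ι ℝ v) = d v := by
  let ι' : T n →ₗ[ℝ] Ext n := ExteriorAlgebra.ι ℝ
  let m : T n →ₗ[ℝ] Matrix (Fin 2) (Fin 2) (Ext n) :=
    { toFun := fun v => !![-ι' v, d v; 0, ι' v]
      map_add' := fun v w => by
        ext i j; fin_cases i <;> fin_cases j <;> simp [add_comm]
      map_smul' := fun r v => by
        ext i j; fin_cases i <;> fin_cases j <;> simp }
  have hm : ∀ v, m v * m v = 0 := by
    intro v
    have h1 : ι' v * ι' v = 0 := ExteriorAlgebra.ι_sq_zero v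
    have h2 : ι' v * d v = d v * ι' v := mul_comm_of_mem_extGrading_two (hd v)
    ext i j
    fin_cases i <;> fin_cases j <;> simp [m, Matrix.mul_apply, Fin.sum_univ_two, h1, h2]
  let φ : Ext n →ₐ[ℝ] Matrix (Fin 2) (Fin 2) (Ext n) := ExteriorAlgebra.lift ℝ ⟨m, hm⟩
  have hφι : ∀ v, φ (ExteriorAlgebra.ι ℝ v) = m v := fun v => ExteriorAlgebra.lift_ι_apply _ _ _ _
  have hlow : ∀ a, φ a 1 0 = 0 ∧ φ a 1 1 = a := by
    intro a
    induction a using ExteriorAlgebra.induction with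
    | algebraMap r => rw [AlgHom.commutes]; simp [Matrix.algebraMap_matrix_apply]
    | ι v => rw [hφι]; simp [m, ι']
    | mul a b ha hb => rw [map_mul]; simp [Matrix.mul_apply, Fin.sum_univ_two, ha, hb]
    | add a b ha hb => rw [map_add]; simp [ha, hb]
  have hsign : ∀ p, ∀ a ∈ extGrading n p, φ a 0 0 = (-1) ^ p * a := by
    intro p a ha
    change a ∈ LinearMap.range (ExteriorAlgebra.ι ℝ (M := T n)) ^ p at ha
    induction ha using Submodule.pow_induction_on_left' with
    | algebraMap r => rw [AlgHom.commutes]; simp [Matrix.algebraMap_matrix_apply]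
    | add x y i hx hy ihx ihy => rw [map_add, Matrix.add_apply, ihx, ihy, mul_add]
    | mem_mul w hw i x hx ih =>
      obtain ⟨v, rfl⟩ := hw
      rw [map_mul, Matrix.mul_apply, Fin.sum_univ_two, (hlow x).1, mul_zero, add_zero, ih, hφι]
      have : m v 0 0 = -ExteriorAlgebra.ι ℝ v := by simp [m, ι']
      rw [this]
      rcases Nat.even_or_odd i with h | h
      · rw [h.neg_one_pow, Nat.succ_eq_add_one, h.add_one.neg_one_pow, one_mul, neg_one_mul,
          neg_mul]
      · rw [h.neg_one_pow, Nat.succ_eq_add_one, h.add_one.neg_one_pow, one_mul, neg_one_mul,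
          neg_mul_neg]
  let D : Ext n →ₗ[ℝ] Ext n :=
    { toFun := fun a => φ a 0 1
      map_add' := fun a b => by rw [map_add, Matrix.add_apply]
      map_smul' := fun r a => by rw [map_smul, Matrix.smul_apply, RingHom.id_apply] }
  have hDι : ∀ v, D (ExteriorAlgebra.ι ℝ v) = d v := fun v => by
    change φ (ExteriorAlgebra.ι ℝ v) 0 1 = _
    rw [hφι]; simp [m]
  have hDφ : ∀ a, D a = φ a 0 1 := fun a => rfl
  have hDL : GradedLeibniz (extGrading n) D := by
    intro p a ha b
    change φ (a * b) 0 1 = φ a 0 1 * b + (-1) ^ p * (a * φ b 0 1)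
    rw [map_mul, Matrix.mul_apply, Fin.sum_univ_two, hsign p a ha, (hlow b).2, add_comm, mul_assoc]
  refine ⟨D, ?_, hDL, hDι⟩
  intro p a ha
  change a ∈ LinearMap.range (ExteriorAlgebra.ι ℝ (M := T n)) ^ p at ha
  induction ha using Submodule.pow_induction_on_left' with
  | algebraMap r =>
    rw [hDφ, AlgHom.commutes]
    simp [Matrix.algebraMap_matrix_apply]
  | add x y i hx hy ihx ihy => rw [map_add]; exact add_mem ihx ihy
  | mem_mul w hw i x hx ih =>
    obtain ⟨v, rfl⟩ := hw
    rw [hDL 1 _ (ι_mem_extGrading v), hDι, pow_one, neg_one_mul]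
    refine add_mem ?_ (neg_mem ?_)
    · rw [show i.succ + 1 = 2 + i by omega]
      exact extGrading_mul (hd v) hx
    · rw [show i.succ + 1 = 1 + (i + 1) by omega]
      exact extGrading_mul (ι_mem_extGrading v) ih

/-- The real and imaginary parts of the ζ_k, with α, form a basis of T, so complex two-forms may be
prescribed on the ζ_k; reality of D then determines its values on the ζbar_k. -/
theorem exists_derivation_ζ {Y : Ext n} (hY : Y ∈ extGrading n 2) {X : Fin n → ExtC n}
    (hX : ∀ k, IsHomogeneous 2 (X k)) :
    ∃ D : Ext n →ₗ[ℝ] Ext n, HasDegreeOne (extGrading n) D ∧ GradedLeibniz (extGrading n) D ∧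
      D (alphaForm n) = Y ∧ ∀ k, cMap D (ζ n k) = X k := by
  let c : (Fin n × Fin 2) ⊕ Unit → Ext n := Sum.elim
    (fun p => if p.2 = 0 then reForm n (X p.1) else imForm n (X p.1)) fun _ => Y
  have hc : ∀ i, c i ∈ extGrading n 2 := by
    rintro (⟨k, j⟩ | _)
    · simp only [c, Sum.elim_inl]
      split_ifs
      exacts [(hX k).1, (hX k).2]
    · exact hY
  let d : T n →ₗ[ℝ] Ext n := (EuclideanSpace.basisFun _ ℝ).toBasis.constr ℝ c
  have hde : ∀ i, d (e n i) = c i := by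
    intro i
    simp [e, d]
  obtain ⟨D, h1, h2, h3⟩ := exists_derivation d fun v => by
    have := (EuclideanSpace.basisFun ((Fin n × Fin 2) ⊕ Unit) ℝ).toBasis.constr_apply_fintype ℝ c v
    rw [show d v = _ from this]
    exact sum_mem fun i _ => Submodule.smul_mem _ _ (hc i)
  refine ⟨D, h1, h2, ?_, fun k => ?_⟩
  · rw [alphaForm, θ, h3, hde]; rfl
  · rw [ζ, cMap_cplx, θ, θ, h3, h3, hde, hde]
    exact cplx_re_im _

/-! ### Operators determined by their values on the generators -/

theorem map_one_eq_zero {f : Inv n →ₗ[ℝ] Inv n} (hf : GradedLeibniz (invGrading n) f) :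
    f 1 = 0 := by
  have h := hf 0 1 (SetLike.GradedOne.one_mem (A := extGrading n)) 1
  rw [mul_one, pow_zero, one_mul, mul_one, one_mul] at h
  exact left_eq_add.1 h

/-- Closure under products is required only for a homogeneous left factor, which is what the graded
Leibniz rule can supply. -/
theorem stdInv_induction {P : Inv n → Prop} (hn : 0 < n)
    (hmul : ∀ p, ∀ x ∈ invGrading n p, ∀ y, P x → P y → P (x * y)) (hadd : ∀ x y, P x → P y → P (x + y))
    (hsmul : ∀ (r : ℝ) x, P x → P (r • x)) (h1 : P 1) (hα : P (α n)) (hF : P (F n)) (hp : P (Ωp n))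
    (hm : P (Ωm n)) (a : Inv n) : P a := by
  have ha : a ∈ Submodule.span ℝ (Set.range (stdInv n)) := by
    rw [span_stdInv hn]; trivial
  have hpow : ∀ k, P (F n ^ k) := by
    intro k
    induction k with
    | zero => rw [pow_zero]; exact h1
    | succ k ih => rw [pow_succ']; exact hmul 2 _ F_mem _ hF ih
  induction ha using Submodule.span_induction with
  | mem x hx =>
    obtain ⟨⟨ε, i⟩, rfl⟩ := hx
    have hi : P (Sum.elim (fun k => F n ^ k) (fun b => if b then Ωp n else Ωm n) i) := by
      rcases i with k | b
      · exact hpow k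
      · cases b
        exacts [hm, hp]
    cases ε
    · simpa [stdInv] using hi
    · simpa [stdInv] using hmul 1 _ α_mem _ hα hi
  | zero => simpa using hsmul 0 1 h1
  | add x y _ _ hx hy => exact hadd x y hx hy
  | smul r x _ hx => exact hsmul r x hx

/-- Two derivations that agree on α, F, Ω⁺, Ω⁻ agree on all invariants, so D extends f and f
inherits degree one. -/
theorem isDifferentialOperator_of_derivation (hn : 0 < n) {f : Inv n →ₗ[ℝ] Inv n}
    (hf : GradedLeibniz (invGrading n) f) {D : Ext n →ₗ[ℝ] Ext n}
    (hD1 : HasDegreeOne (extGrading n) D) (hD : GradedLeibniz (extGrading n) D)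
    (hα : D (α n) = f (α n)) (hF : D (F n) = f (F n)) (hp : D (Ωp n) = f (Ωp n))
    (hm : D (Ωm n) = f (Ωm n)) (hα2 : f (f (α n)) = 0) (hF2 : f (f (F n)) = 0)
    (hp2 : f (f (Ωp n)) = 0) (hm2 : f (f (Ωm n)) = 0) :
    IsDifferentialOperator (invGrading n) f ∧ ExtendsToDerivation f := by
  have hDf : ∀ a : Inv n, D a = f a := by
    refine stdInv_induction hn ?_ ?_ ?_ ?_ hα hF hp hm
    · intro p x hx y hx' hy'
      have h := hD p (x : Ext n) hx (y : Ext n)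
      rw [Subalgebra.coe_mul, h, hf p x hx, hx', hy']
      simp
    · intro x y hx hy
      rw [Subalgebra.coe_add, map_add, map_add, hx, hy, Subalgebra.coe_add]
    · intro r x hx
      rw [Subalgebra.coe_smul, map_smul, map_smul, hx, Subalgebra.coe_smul]
    · rw [map_one_eq_zero hf, Subalgebra.coe_one, Subalgebra.coe_zero]
      have h := hD 0 1 (SetLike.GradedOne.one_mem (A := extGrading n)) 1
      rw [mul_one, pow_zero, one_mul, mul_one, one_mul] at h
      exact left_eq_add.1 h
  have hdeg : HasDegreeOne (invGrading n) f := by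
    intro p a ha
    have h : (f a : Ext n) ∈ extGrading n (p + 1) := by
      rw [← hDf]
      exact hD1 p _ ha
    exact h
  refine ⟨⟨?_, hf, hdeg⟩, D, hD1, hD, hDf⟩
  -- The cross terms f(x)∧f(y) in f²(x∧y) occur with opposite signs, because f(x) has degree p + 1.
  -- Hence f² satisfies an ungraded Leibniz rule and vanishes once it does so on the generators.
  refine stdInv_induction hn ?_ ?_ ?_ ?_ hα2 hF2 hp2 hm2
  · intro p x hx y hx' hy'
    rcases Nat.even_or_odd p with h | h
    · rw [hf p x hx, map_add, hf (p + 1) _ (hdeg p x hx), hx', h.neg_one_pow, one_mul,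
        hf p x hx, hy', h.add_one.neg_one_pow, h.neg_one_pow]
      simp
    · rw [hf p x hx, map_add, hf (p + 1) _ (hdeg p x hx), hx', h.neg_one_pow, neg_one_mul, map_neg,
        hf p x hx, hy', h.add_one.neg_one_pow, h.neg_one_pow]
      simp
  · intro x y hx hy
    rw [map_add, map_add, hx, hy, add_zero]
  · intro r x hx
    rw [map_smul, map_smul, hx, smul_zero]
  · rw [map_one_eq_zero hf, map_zero]

theorem one_tmul_injective {x y : Ext n} (h : (1 : ℂ) ⊗ₜ[ℝ] x = (1 : ℂ) ⊗ₜ[ℝ] y) : x = y := by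
  have := congrArg (reForm n) h
  simpa [reForm] using this

theorem re_im_of_cMap_OmegaForm {D : Ext n →ₗ[ℝ] Ext n} {P M : Ext n}
    (h : cMap D (OmegaForm n) = cplx P M) :
    D (reForm n (OmegaForm n)) = P ∧ D (imForm n (OmegaForm n)) = M := by
  rw [← cplx_re_im (OmegaForm n), cMap_cplx] at h
  exact ⟨by simpa using congrArg (reForm n) h, by simpa using congrArg (imForm n) h⟩

theorem IsHomogeneous.smul {p : ℕ} {v : ExtC n} (hv : IsHomogeneous p v) (x y : ℝ) :
    IsHomogeneous p (((x : ℂ) + y * Complex.I) • v) := by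
  have h : ((x : ℂ) + y * Complex.I) • v = cplx (x • 1) (y • 1) * v := by
    have h2 : ((x : ℂ) + y * Complex.I) • (1 : ExtC n) = cplx (x • 1) (y • 1) := by
      rw [cplx_eq, one_tmul_smul, one_tmul_smul, ← Algebra.TensorProduct.one_def]
      module
    rw [← h2, smul_mul_assoc, one_mul]
  rw [h, ← zero_add p]
  refine IsHomogeneous.mul ?_ hv
  rw [IsHomogeneous, reForm_cplx, imForm_cplx]
  exact ⟨Submodule.smul_mem _ _ SetLike.GradedOne.one_mem,
    Submodule.smul_mem _ _ SetLike.GradedOne.one_mem⟩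

/-- The derivation is α ↦ cF and ζ_k ↦ w α∧ζ_k with w = λ - μi. Then each ζ_k∧ζbar_k acquires w + w̄
= 2λ, and Ω acquires w from each of its n factors. Both types A and B are special cases. -/
theorem exists_derivation_AB (c lam mu : ℝ) :
    ∃ D : Ext n →ₗ[ℝ] Ext n, HasDegreeOne (extGrading n) D ∧ GradedLeibniz (extGrading n) D ∧
      D (α n) = ((c • F n : Inv n) : Ext n) ∧ D (F n) = (((2 * lam) • (α n * F n) : Inv n) : Ext n) ∧
      D (Ωp n) = (((n * lam) • (α n * Ωp n) + (n * mu) • (α n * Ωm n) : Inv n) : Ext n) ∧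
      D (Ωm n) = (((n * lam) • (α n * Ωm n) - (n * mu) • (α n * Ωp n) : Inv n) : Ext n) := by
  set w : ℂ := lam - mu * Complex.I with hw
  have hαh : IsHomogeneous 1 (αC n) := by
    rw [αC_eq_cplx, IsHomogeneous, reForm_cplx, imForm_cplx]
    exact ⟨alphaForm_mem_extGrading, zero_mem _⟩
  have hhom : ∀ k, IsHomogeneous 2 (w • (αC n * ζ n k)) := fun k => by
    simpa [hw, sub_eq_add_neg] using (hαh.mul (isHomogeneous_ζ k)).smul lam (-mu)
  obtain ⟨D, hD1, hD, hα, hζ⟩ := exists_derivation_ζ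
    (Submodule.smul_mem _ c (FForm_mem_extGrading (n := n))) hhom
  have hs : ∀ (c : ℂ) (x y : ExtC n), x * c • y = c • (x * y) := fun c x y => mul_smul_comm _ _ _
  have hζbar : ∀ k, cMap D (ζbar n k) = star w • (αC n * ζbar n k) := fun k => by
    rw [← conjC_ζ, cMap_conjC, hζ, conjC_smul, map_mul, αC, conjC_one_tmul]
  have hζζ : ∀ k, cMap D (ζζ n k) = (2 * lam : ℂ) • (αC n * ζζ n k) := fun k => by
    rw [ζζ, cMap_mul hD (isHomogeneous_ζ k), hζ, hζbar, smul_mul_assoc, mul_assoc, hs,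
      ← mul_assoc (ζ n k), oneForms_anticomm (ζ_mem_oneForms k) αC_mem_oneForms, smul_mul_assoc,
      mul_assoc, smul_smul, smul_smul, ← add_smul]
    congr 1
    simp only [hw, star_sub, star_mul', Complex.star_def, Complex.conj_ofReal, Complex.conj_I]
    ring
  have hF : cMap D (FC n) = (2 * lam : ℂ) • (αC n * FC n) := by
    rw [FC_eq, map_smul, map_sum, Finset.sum_congr rfl fun k _ => hζζ k, ← Finset.smul_sum,
      ← Finset.mul_sum, hs, smul_comm]
  have hl : ∀ l : List (Fin n), cMap D (l.map (ζ n)).prod =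
      ((l.length : ℂ) * w) • (αC n * (l.map (ζ n)).prod) := by
    intro l
    induction l with
    | nil =>
      have h1 := cMap_mul hD isHomogeneous_one (1 : ExtC n)
      rw [mul_one, pow_zero, one_smul, mul_one, one_mul] at h1
      simpa using left_eq_add.1 h1
    | cons k l ih =>
      rw [List.map_cons, List.prod_cons, cMap_mul hD (isHomogeneous_ζ k), hζ, ih, smul_mul_assoc,
        mul_assoc, hs, ← mul_assoc (ζ n k), oneForms_anticomm (ζ_mem_oneForms k) αC_mem_oneForms,
        smul_mul_assoc, mul_assoc, smul_smul, smul_smul, ← add_smul, List.length_cons]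
      congr 1
      push_cast
      ring
  have hO : cMap D (OmegaForm n) = cplx
      ((n * lam) • (alphaForm n * reForm n (OmegaForm n)) +
        (n * mu) • (alphaForm n * imForm n (OmegaForm n)))
      ((n * lam) • (alphaForm n * imForm n (OmegaForm n)) -
        (n * mu) • (alphaForm n * reForm n (OmegaForm n))) := by
    have h := hl (List.finRange n)
    rw [← List.ofFn_eq_map, ← OmegaForm_eq, List.length_finRange] at h
    rw [h]
    nth_rewrite 1 [← cplx_re_im (OmegaForm n)]
    rw [αC_eq_cplx, cplx_mul_cplx, zero_mul, zero_mul, sub_zero, add_zero, cplx_eq, cplx_eq,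
      TensorProduct.tmul_add, TensorProduct.tmul_sub, one_tmul_smul, one_tmul_smul, one_tmul_smul,
      one_tmul_smul, hw]
    generalize (1 : ℂ) ⊗ₜ[ℝ] (alphaForm n * reForm n (OmegaForm n)) = x
    generalize (1 : ℂ) ⊗ₜ[ℝ] (alphaForm n * imForm n (OmegaForm n)) = y
    have hI := Complex.I_mul_I
    push_cast
    match_scalars
    · ring
    · linear_combination (-n * mu : ℂ) * hI
  obtain ⟨hp, hm⟩ := re_im_of_cMap_OmegaForm hO
  refine ⟨D, hD1, hD, hα, one_tmul_injective ?_, hp, hm⟩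
  have h := hF
  rw [FC, cMap_tmul] at h
  rw [coe_F, h, Subalgebra.coe_smul, one_tmul_smul, Subalgebra.coe_mul, one_tmul_mul, αC]
  push_cast
  rfl

theorem α_mul_self : α n * α n = 0 := Subtype.ext (ExteriorAlgebra.ι_sq_zero _)

/-- All values on generators are multiples of α, f(α) = 0 and α∧α = 0, so f² vanishes on generators.
-/
theorem reverse_typeA (hn : 2 ≤ n) {f : Inv n →ₗ[ℝ] Inv n} (hf : GradedLeibniz (invGrading n) f)
    {lam mu : ℝ} (h : TypeA f lam mu) :
    IsDifferentialOperator (invGrading n) f ∧ ExtendsToDerivation f := by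
  obtain ⟨hα, hF, hp, hm⟩ := typeA_iff.1 h
  obtain ⟨D, hD1, hD, hDα, hDF, hDp, hDm⟩ := exists_derivation_AB (n := n) 0 lam mu
  have hαL : ∀ b, f (α n * b) = -(α n * f b) := fun b => by
    rw [hf 1 _ α_mem b, hα, zero_mul, zero_add, pow_one, neg_one_mul]
  have h0 : ∀ x, α n * (α n * x) = 0 := fun x => by rw [← mul_assoc, α_mul_self, zero_mul]
  refine isDifferentialOperator_of_derivation (by omega) hf hD1 hD (by rw [hDα, hα, zero_smul])
    (by rw [hDF, hF]) (by rw [hDp, hp]) (by rw [hDm, hm]) (by rw [hα, map_zero]) ?_ ?_ ?_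
  · rw [hF, map_smul, hαL, hF, mul_smul_comm, h0, smul_zero, neg_zero, smul_zero]
  · rw [hp, map_add, map_smul, map_smul, hαL, hαL, hp, hm]
    simp only [mul_add, mul_sub, mul_smul_comm, h0, smul_zero, add_zero, sub_zero, neg_zero]
  · rw [hm, map_sub, map_smul, map_smul, hαL, hαL, hp, hm]
    simp only [mul_add, mul_sub, mul_smul_comm, h0, smul_zero, add_zero, sub_zero, neg_zero]

theorem reverse_typeB (hn : 2 ≤ n) {f : Inv n →ₗ[ℝ] Inv n} (hf : GradedLeibniz (invGrading n) f)
    {lam mu : ℝ} (h : TypeB f lam mu) :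
    IsDifferentialOperator (invGrading n) f ∧ ExtendsToDerivation f := by
  obtain ⟨hα, hF, hp, hm⟩ := typeB_iff.1 h
  -- Type B has no factor n in f(Ω), hence the parameter μ/n. In f²(Ω) the new term from f(α) = λF
  -- vanishes because F∧Ω = 0.
  obtain ⟨D, hD1, hD, hDα, hDF, hDp, hDm⟩ := exists_derivation_AB (n := n) lam 0 (mu / n)
  have hn0 : (n : ℝ) ≠ 0 := by positivity
  have hαL : ∀ b, f (α n * b) = lam • (F n * b) - α n * f b := fun b => by
    rw [hf 1 _ α_mem b, hα, pow_one, neg_one_mul, smul_mul_assoc, sub_eq_add_neg]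
  have h0 : ∀ x, α n * (α n * x) = 0 := fun x => by rw [← mul_assoc, α_mul_self, zero_mul]
  refine isDifferentialOperator_of_derivation (by omega) hf hD1 hD (by rw [hDα, hα])
    (by rw [hDF, hF]; simp) (by rw [hDp, hp, mul_div_cancel₀ _ hn0]; simp)
    (by rw [hDm, hm, mul_div_cancel₀ _ hn0]; simp) (by rw [hα, map_smul, hF, smul_zero])
    (by rw [hF, map_zero]) ?_ ?_
  · rw [hp, map_smul, hαL, hm, F_mul_Ωm, mul_smul_comm, h0]
    simp
  · rw [hm, map_smul, hαL, hp, F_mul_Ωp, mul_smul_comm, h0]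
    simp

theorem conjC_ζbar (k : Fin n) : conjC n (ζbar n k) = ζ n k := by
  rw [ζbar, conjC_cplx, neg_neg, ζ]

/-- Replacing one factor ζ_k of Ω by the two complementary ζbar's gives, after reordering, -w times
the product of the two other ζζ's, while F² is -1/2 times the sum of these three products. -/
theorem cMap_OmegaForm_three {D : Ext 3 →ₗ[ℝ] Ext 3} (hD : GradedLeibniz (extGrading 3) D) {w : ℂ}
    (hζ : ∀ k, cMap D (ζ 3 k) = w • (ζbar 3 (k + 1) * ζbar 3 (k + 2))) :
    cMap D (OmegaForm 3) = (2 * w) • FC 3 ^ 2 := by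
  have hs : ∀ (c : ℂ) (x y : ExtC 3), x * c • y = c • (x * y) := fun c x y => mul_smul_comm _ _ _
  have h : ∀ a b : Fin 3, ζbar 3 a * ζ 3 b = (-1 : ℂ) • (ζ 3 b * ζbar 3 a) := fun a b =>
    oneForms_anticomm (ζbar_mem_oneForms a) (ζ_mem_oneForms b)
  have h' : ∀ (a b : Fin 3) (x : ExtC 3),
      ζbar 3 a * (ζ 3 b * x) = (-1 : ℂ) • (ζ 3 b * (ζbar 3 a * x)) := fun a b x => by
    rw [← mul_assoc, h, smul_mul_assoc, mul_assoc]
  have hb : ∀ a b : Fin 3, ζbar 3 a * ζbar 3 b = (-1 : ℂ) • (ζbar 3 b * ζbar 3 a) := fun a b =>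
    oneForms_anticomm (ζbar_mem_oneForms a) (ζbar_mem_oneForms b)
  have hsq : ∀ a, ζζ 3 a * ζζ 3 a = 0 := ζζ_mul_self
  have hF : FC 3 ^ 2 = (-2⁻¹ : ℂ) •
      (ζζ 3 0 * ζζ 3 1 + ζζ 3 0 * ζζ 3 2 + ζζ 3 1 * ζζ 3 2) := by
    rw [FC_eq, smul_pow, Fin.sum_univ_three, sq (_ + _)]
    simp only [add_mul, mul_add, hsq]
    rw [ζζ_mul_ζζ_comm 1 0, ζζ_mul_ζζ_comm 2 0, ζζ_mul_ζζ_comm 2 1]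
    have : (Complex.I / 2) ^ 2 = -4⁻¹ := by
      rw [div_pow, Complex.I_sq]; norm_num
    rw [this]
    module
  have hO : OmegaForm 3 = ζ 3 0 * (ζ 3 1 * ζ 3 2) := by
    rw [OmegaForm_eq]
    simp only [List.ofFn_succ, List.ofFn_zero, List.prod_cons, List.prod_nil, mul_one]
    rfl
  rw [hO, cMap_mul hD (isHomogeneous_ζ _), cMap_mul hD (isHomogeneous_ζ _), hζ, hζ, hζ, hF]
  change w • (ζbar 3 1 * ζbar 3 2) * (ζ 3 1 * ζ 3 2) + (-1 : ℂ) ^ 1 •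
    (ζ 3 0 * (w • (ζbar 3 2 * ζbar 3 0) * ζ 3 2 + (-1 : ℂ) ^ 1 •
      (ζ 3 1 * w • (ζbar 3 0 * ζbar 3 1)))) = _
  simp only [smul_mul_assoc, hs, mul_assoc, h, h', smul_smul, mul_add, ζζ, smul_add]
  rw [hb 2 0]
  simp only [hs, smul_smul]
  module

/-- Each of the three forms ζ_k∧ζbar_k contributes the same w Ω̄ - w̄ Ω, because the indices are
cyclically ordered. -/
theorem cMap_FC_three {D : Ext 3 →ₗ[ℝ] Ext 3} (hD : GradedLeibniz (extGrading 3) D) {w : ℂ}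
    (hζ : ∀ k, cMap D (ζ 3 k) = w • (ζbar 3 (k + 1) * ζbar 3 (k + 2))) :
    cMap D (FC 3) = (3 * Complex.I / 2) • (w • OmegaBar 3 - star w • OmegaForm 3) := by
  have hs : ∀ (c : ℂ) (x y : ExtC 3), x * c • y = c • (x * y) := fun c x y => mul_smul_comm _ _ _
  have hz : ∀ a b : Fin 3, ζ 3 a * ζ 3 b = (-1 : ℂ) • (ζ 3 b * ζ 3 a) := fun a b =>
    oneForms_anticomm (ζ_mem_oneForms a) (ζ_mem_oneForms b)
  have hb : ∀ a b : Fin 3, ζbar 3 a * ζbar 3 b = (-1 : ℂ) • (ζbar 3 b * ζbar 3 a) := fun a b =>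
    oneForms_anticomm (ζbar_mem_oneForms a) (ζbar_mem_oneForms b)
  have hz' : ∀ (a b : Fin 3) (x : ExtC 3),
      ζ 3 a * (ζ 3 b * x) = (-1 : ℂ) • (ζ 3 b * (ζ 3 a * x)) := fun a b x => by
    rw [← mul_assoc, hz, smul_mul_assoc, mul_assoc]
  have hb' : ∀ (a b : Fin 3) (x : ExtC 3),
      ζbar 3 a * (ζbar 3 b * x) = (-1 : ℂ) • (ζbar 3 b * (ζbar 3 a * x)) := fun a b x => by
    rw [← mul_assoc, hb, smul_mul_assoc, mul_assoc]
  have hζbar : ∀ k, cMap D (ζbar 3 k) = star w • (ζ 3 (k + 1) * ζ 3 (k + 2)) := fun k => by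
    rw [← conjC_ζ, cMap_conjC, hζ, conjC_smul, map_mul, conjC_ζbar, conjC_ζbar]
  have hO : OmegaForm 3 = ζ 3 0 * (ζ 3 1 * ζ 3 2) := by
    rw [OmegaForm_eq]
    simp only [List.ofFn_succ, List.ofFn_zero, List.prod_cons, List.prod_nil, mul_one]
    rfl
  have hB : OmegaBar 3 = ζbar 3 0 * (ζbar 3 1 * ζbar 3 2) := by
    rw [OmegaBar]
    simp only [List.ofFn_succ, List.ofFn_zero, List.prod_cons, List.prod_nil, mul_one]
    rfl
  have h0 : cMap D (ζζ 3 0) = w • OmegaBar 3 - star w • OmegaForm 3 := by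
    rw [ζζ, cMap_mul hD (isHomogeneous_ζ _), hζ, hζbar]
    change w • (ζbar 3 1 * ζbar 3 2) * ζbar 3 0 + (-1 : ℂ) ^ 1 •
      (ζ 3 0 * star w • (ζ 3 1 * ζ 3 2)) = _
    rw [hs, ← hO, smul_mul_assoc, mul_assoc, hb 2 0, hs, hb' 1 0, ← hB]
    module
  have h1 : cMap D (ζζ 3 1) = w • OmegaBar 3 - star w • OmegaForm 3 := by
    rw [ζζ, cMap_mul hD (isHomogeneous_ζ _), hζ, hζbar]
    change w • (ζbar 3 2 * ζbar 3 0) * ζbar 3 1 + (-1 : ℂ) ^ 1 •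
      (ζ 3 1 * star w • (ζ 3 2 * ζ 3 0)) = _
    rw [hs, hz 2 0, hs, hz' 1 0, ← hO, smul_mul_assoc, mul_assoc, hb' 2 0, hb 2 1, hs, ← hB]
    module
  have h2 : cMap D (ζζ 3 2) = w • OmegaBar 3 - star w • OmegaForm 3 := by
    rw [ζζ, cMap_mul hD (isHomogeneous_ζ _), hζ, hζbar]
    change w • (ζbar 3 0 * ζbar 3 1) * ζbar 3 2 + (-1 : ℂ) ^ 1 •
      (ζ 3 2 * star w • (ζ 3 0 * ζ 3 1)) = _
    rw [hs, hz' 2 0, hz 2 1, hs, ← hO, smul_mul_assoc, mul_assoc, ← hB]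
    module
  rw [FC_eq, map_smul, Fin.sum_univ_three, map_add, map_add, h0, h1, h2]
  module

/-- In dimension three the volume form identifies ζ_k with ζbar_{k+1}∧ζbar_{k+2}, indices modulo 3,
compatibly with SU(3). D is this identification times λ + μi, and zero on α. -/
theorem exists_derivation_D (lam mu : ℝ) :
    ∃ D : Ext 3 →ₗ[ℝ] Ext 3, HasDegreeOne (extGrading 3) D ∧ GradedLeibniz (extGrading 3) D ∧
      D (α 3) = 0 ∧ D (F 3) = (((3 * lam) • Ωm 3 - (3 * mu) • Ωp 3 : Inv 3) : Ext 3) ∧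
      D (Ωp 3) = (((2 * lam) • (F 3 * F 3) : Inv 3) : Ext 3) ∧
      D (Ωm 3) = (((2 * mu) • (F 3 * F 3) : Inv 3) : Ext 3) := by
  obtain ⟨D, hD1, hD, hα, hζ⟩ := exists_derivation_ζ (zero_mem (extGrading 3 2))
    (X := fun k => ((lam : ℂ) + mu * Complex.I) • (ζbar 3 (k + 1) * ζbar 3 (k + 2)))
    fun k => ((isHomogeneous_ζbar _).mul (isHomogeneous_ζbar _)).smul lam mu
  have hO : cMap D (OmegaForm 3) =
      cplx ((2 * lam) • (FForm 3 * FForm 3)) ((2 * mu) • (FForm 3 * FForm 3)) := by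
    rw [cMap_OmegaForm_three hD hζ, cplx_eq, one_tmul_smul, one_tmul_smul, one_tmul_mul, ← FC.eq_1,
      ← sq]
    push_cast
    module
  obtain ⟨hp, hm⟩ := re_im_of_cMap_OmegaForm hO
  refine ⟨D, hD1, hD, hα, one_tmul_injective ?_, hp, hm⟩
  have h := cMap_FC_three hD hζ
  rw [FC, cMap_tmul] at h
  rw [coe_F, h, Subalgebra.coe_sub, Subalgebra.coe_smul, Subalgebra.coe_smul,
    TensorProduct.tmul_sub, one_tmul_smul, one_tmul_smul, coe_Ωp, coe_Ωm, one_tmul_re, one_tmul_im]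
  have hI := Complex.I_mul_I
  simp only [star_add, star_mul', Complex.star_def, Complex.conj_ofReal, Complex.conj_I]
  push_cast
  match_scalars
  · linear_combination (3 / 2 * mu : ℂ) * hI
  · linear_combination (3 / 2 * mu : ℂ) * hI

/-- F∧F is closed since F∧Ω⁺ = F∧Ω⁻ = 0, and in f²(F) the coefficients 3λ·2μ and 3μ·2λ cancel. -/
theorem reverse_typeD (hn : n = 3) {f : Inv n →ₗ[ℝ] Inv n} (hf : GradedLeibniz (invGrading n) f)
    {lam mu : ℝ} (h : TypeD f lam mu) :
    IsDifferentialOperator (invGrading n) f ∧ ExtendsToDerivation f := by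
  subst hn
  obtain ⟨hα, hF, hp, hm⟩ := typeD_iff.1 h
  obtain ⟨D, hD1, hD, hDα, hDF, hDp, hDm⟩ := exists_derivation_D lam mu
  have hFF : f (F 3 * F 3) = 0 := by
    rw [hf 2 _ F_mem, neg_one_sq, one_mul, ← F_mul_comm, hF, mul_sub, mul_smul_comm, mul_smul_comm,
      F_mul_Ωp, F_mul_Ωm]
    simp
  refine isDifferentialOperator_of_derivation (by omega) hf hD1 hD (by rw [hDα, hα]; simp)
    (by rw [hDF, hF]) (by rw [hDp, hp]) (by rw [hDm, hm]) (by rw [hα, map_zero]) ?_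
    (by rw [hp, map_smul, hFF, smul_zero]) (by rw [hm, map_smul, hFF, smul_zero])
  rw [hF, map_sub, map_smul, map_smul, hp, hm]
  module

/-! ### The action of the normalizer -/

theorem act_mem_extGrading (g : T n ≃ₗᵢ[ℝ] T n) {p : ℕ} {a : Ext n} (ha : a ∈ extGrading n p) :
    act g a ∈ extGrading n p := by
  change a ∈ LinearMap.range (ExteriorAlgebra.ι ℝ (M := T n)) ^ p at ha
  induction ha using Submodule.pow_induction_on_left' with
  | algebraMap r =>
    rw [AlgHom.commutes, Algebra.algebraMap_eq_smul_one]
    exact Submodule.smul_mem _ _ SetLike.GradedOne.one_mem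
  | add x y i hx hy ihx ihy => rw [map_add]; exact add_mem ihx ihy
  | mem_mul w hw i x hx ih =>
    obtain ⟨v, rfl⟩ := hw
    rw [map_mul, act_ι, show i.succ = 1 + i by omega]
    exact extGrading_mul (ι_mem_extGrading _) ih

@[simp] theorem coe_normAct (g : N n) (a : Inv n) :
    (normAct g a : Ext n) = act (g : T n ≃ₗᵢ[ℝ] T n) a := rfl

theorem normAct_mul (g : N n) (a b : Inv n) : normAct g (a * b) = normAct g a * normAct g b :=
  Subtype.ext (by simp)

theorem act_act_inv (g : T n ≃ₗᵢ[ℝ] T n) (a : Ext n) : act g (act g⁻¹ a) = a := by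
  rw [← act_mul, mul_inv_cancel]
  have : act (1 : T n ≃ₗᵢ[ℝ] T n) = AlgHom.id ℝ (Ext n) := ExteriorAlgebra.map_id
  rw [this]; rfl

theorem act_inv_act (g : T n ≃ₗᵢ[ℝ] T n) (a : Ext n) : act g⁻¹ (act g a) = a := by
  simpa using act_act_inv g⁻¹ a

theorem normAct_normAct_inv (g : N n) (a : Inv n) : normAct g (normAct g⁻¹ a) = a :=
  Subtype.ext (act_act_inv _ _)

theorem normAct_inv_normAct (g : N n) (a : Inv n) : normAct g⁻¹ (normAct g a) = a :=
  Subtype.ext (act_inv_act _ _)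

theorem conj_apply (g : N n) (f : Inv n →ₗ[ℝ] Inv n) (a : Inv n) :
    conj g f a = normAct g (f (normAct g⁻¹ a)) := rfl

theorem conj_inv_conj (g : N n) (f : Inv n →ₗ[ℝ] Inv n) : conj g⁻¹ (conj g f) = f := by
  ext1 a
  rw [conj_apply, conj_apply, inv_inv, normAct_inv_normAct, normAct_inv_normAct]

theorem normAct_mem_invGrading (g : N n) {p : ℕ} {a : Inv n} (ha : a ∈ invGrading n p) :
    normAct g a ∈ invGrading n p := act_mem_extGrading _ ha

theorem gradedLeibniz_conj (g : N n) {f : Inv n →ₗ[ℝ] Inv n}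
    (hf : GradedLeibniz (invGrading n) f) : GradedLeibniz (invGrading n) (conj g f) := by
  intro p a ha b
  rw [conj_apply, normAct_mul, hf p _ (normAct_mem_invGrading _ ha), map_add, normAct_mul,
    normAct_normAct_inv]
  rcases Nat.even_or_odd p with h | h
  · rw [h.neg_one_pow, one_mul, one_mul, normAct_mul, normAct_normAct_inv]; rfl
  · rw [h.neg_one_pow, neg_one_mul, neg_one_mul, map_neg, normAct_mul, normAct_normAct_inv]; rfl

theorem isDifferentialOperator_conj (g : N n) {f : Inv n →ₗ[ℝ] Inv n}
    (hf : IsDifferentialOperator (invGrading n) f) :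
    IsDifferentialOperator (invGrading n) (conj g f) where
  sq_zero a := by
    rw [conj_apply, conj_apply, normAct_inv_normAct, hf.sq_zero, map_zero]
  leibniz := gradedLeibniz_conj g hf.leibniz
  degree_one p a ha :=
    normAct_mem_invGrading g (hf.degree_one p _ (normAct_mem_invGrading g⁻¹ ha))

theorem extendsToDerivation_conj (g : N n) {f : Inv n →ₗ[ℝ] Inv n} (hf : ExtendsToDerivation f) :
    ExtendsToDerivation (conj g f) := by
  obtain ⟨D, hD1, hD, hDf⟩ := hf
  let h : T n ≃ₗᵢ[ℝ] T n := g
  have hE : ∀ a, (((act h).toLinearMap ∘ₗ D ∘ₗ (act h⁻¹).toLinearMap : Ext n →ₗ[ℝ] Ext n) a) =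
      act h (D (act h⁻¹ a)) := fun a => rfl
  refine ⟨(act h).toLinearMap ∘ₗ D ∘ₗ (act h⁻¹).toLinearMap, ?_, ?_, ?_⟩
  · intro p a ha
    rw [hE]
    exact act_mem_extGrading _ (hD1 p _ (act_mem_extGrading _ ha))
  · intro p a ha b
    rw [hE, hE, hE, map_mul, hD p _ (act_mem_extGrading _ ha), map_add, map_mul, map_mul, map_mul,
      act_act_inv, act_act_inv, map_pow, map_neg, map_one]
  · intro a
    rw [hE]
    exact congrArg (act h) (hDf (normAct g⁻¹ a))

/-! ### Quaternionic rotations for `n = 2` -/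

/-- The real linear map `w ↦ a w + b J w` of `ℂ²`, where `J (w₁, w₂) = (-conj w₂, conj w₁)`. -/
def quatMap (a b : ℂ) : (Fin 2 → ℂ) →ₗ[ℝ] (Fin 2 → ℂ) where
  toFun w := ![a * w 0 - b * star (w 1), a * w 1 + b * star (w 0)]
  map_add' v w := by
    ext k; fin_cases k <;> simp <;> ring
  map_smul' r w := by
    ext k; fin_cases k <;> simp <;> ring

theorem quatMap_apply (a b : ℂ) (w : Fin 2 → ℂ) :
    quatMap a b w = ![a * w 0 - b * star (w 1), a * w 1 + b * star (w 0)] := rfl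

/-- A unitary 2×2 matrix of determinant 1 has its adjugate as conjugate transpose. The resulting
relations between its entries are exactly commutation with J. -/
theorem quatMap_mulVec {U : Matrix (Fin 2) (Fin 2) ℂ}
    (hU : U ∈ Matrix.specialUnitaryGroup (Fin 2) ℂ) (a b : ℂ) (w : Fin 2 → ℂ) :
    quatMap a b (U.mulVec w) = U.mulVec (quatMap a b w) := by
  have hinv : star U = U.adjugate := by
    have h1 : U * star U = 1 := Matrix.mem_unitaryGroup_iff.1 hU.1
    have h2 : U.adjugate * U = 1 := by
      rw [Matrix.adjugate_mul, (Matrix.mem_specialUnitaryGroup_iff.1 hU).2, one_smul]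
    calc star U = U.adjugate * U * star U := by rw [h2, one_mul]
      _ = U.adjugate := by rw [mul_assoc, h1, mul_one]
  rw [Matrix.adjugate_fin_two] at hinv
  have h00 : star (U 0 0) = U 1 1 := by simpa [Matrix.star_apply] using congrFun₂ hinv 0 0
  have h10 : star (U 1 0) = -U 0 1 := by simpa [Matrix.star_apply] using congrFun₂ hinv 0 1
  have h01 : star (U 0 1) = -U 1 0 := by simpa [Matrix.star_apply] using congrFun₂ hinv 1 0
  have h11 : star (U 1 1) = U 0 0 := by simpa [Matrix.star_apply] using congrFun₂ hinv 1 1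
  ext k
  fin_cases k
  · simp only [quatMap_apply, Matrix.mulVec, dotProduct, Fin.sum_univ_two, star_add, star_mul',
      h10, h11, Fin.zero_eta, Matrix.cons_val_zero, Matrix.cons_val_one]
    ring
  · simp only [quatMap_apply, Matrix.mulVec, dotProduct, Fin.sum_univ_two, star_add, star_mul',
      h00, h01, Fin.mk_one, Matrix.cons_val_zero, Matrix.cons_val_one]
    ring

theorem exists_quat_isometry {a b : ℂ} (hab : Complex.normSq a + Complex.normSq b = 1) :
    ∃ g : T 2 ≃ₗᵢ[ℝ] T 2, ∀ v, z (g v) = quatMap a b (z v) ∧ g v (Sum.inr ()) = v (Sum.inr ()) := by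
  refine exists_isometry (quatMap a b) fun w => ?_
  simp only [Fin.sum_univ_two, quatMap_apply, Matrix.cons_val_zero, Matrix.cons_val_one]
  simp only [Complex.normSq_apply] at hab ⊢
  simp
  linear_combination ((w 0).re ^ 2 + (w 0).im ^ 2 + (w 1).re ^ 2 + (w 1).im ^ 2) * hab

theorem mem_normalizer_of_quat {a b : ℂ} {g : T 2 ≃ₗᵢ[ℝ] T 2}
    (hg : ∀ v, z (g v) = quatMap a b (z v) ∧ g v (Sum.inr ()) = v (Sum.inr ())) :
    g ∈ Subgroup.normalizer (SU 2 : Set (T 2 ≃ₗᵢ[ℝ] T 2)) := by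
  have hcomm : ∀ h ∈ SU 2, g * h = h * g := by
    rintro h ⟨U, hU, hh⟩
    refine LinearIsometryEquiv.ext fun v => ext_z ?_ ?_
    · change z (g (h v)) = z (h (g v))
      rw [(hg _).1, (hh _).1, (hh _).1, (hg _).1, quatMap_mulVec hU]
    · change g (h v) (Sum.inr ()) = h (g v) (Sum.inr ())
      rw [(hg _).2, (hh _).2, (hh _).2, (hg _).2]
  rw [Subgroup.mem_set_normalizer_iff]
  intro h
  constructor
  · intro hh
    have h1 : g * h * g⁻¹ = h := by rw [hcomm h hh, mul_inv_cancel_right]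
    change g * h * g⁻¹ ∈ SU 2
    rwa [h1]
  -- Here it is g h g⁻¹ that is known to lie in SU(2). It commutes with g, which forces it to equal
  -- h.
  · intro hh
    have h1 : g * h * g⁻¹ = h := by
      have h2 := hcomm _ hh
      have h3 : g * h * g⁻¹ * g = g * h := by group
      rw [h3] at h2
      exact mul_left_cancel h2
    rw [h1] at hh
    exact hh

/-- The determinant of an isometry is ±1, so no determinant needs computing for the rotations below
if they are written as squares. -/
theorem mul_self_mem_SO (h : T n ≃ₗᵢ[ℝ] T n) : h * h ∈ SO n := by
  have h1 : |LinearMap.det (h.toLinearEquiv : T n →ₗ[ℝ] T n)| = 1 := by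
    rw [← LinearMap.normDet_eq_abs_det]
    exact LinearIsometry.normDet_eq_one h.toLinearIsometry
  have h2 : ((h * h).toLinearEquiv : T n →ₗ[ℝ] T n) =
      (h.toLinearEquiv : T n →ₗ[ℝ] T n) ∘ₗ (h.toLinearEquiv : T n →ₗ[ℝ] T n) := rfl
  change LinearMap.det ((h * h).toLinearEquiv : T n →ₗ[ℝ] T n) = 1
  rw [h2, LinearMap.det_comp, ← abs_mul_abs_self, h1, one_mul]

/-- A unit imaginary quaternion u satisfies u² = -1 and hence is the square of (1 + u)/√2; as a
square it has determinant 1. -/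
theorem exists_half_turn {x y t : ℝ} (h : x ^ 2 + y ^ 2 + t ^ 2 = 1) : ∃ g ∈ N 2, ∀ v,
    z (g v) = quatMap (x * Complex.I) (y + t * Complex.I) (z v) ∧
      g v (Sum.inr ()) = v (Sum.inr ()) := by
  set r : ℝ := √2 / 2
  have hr : r * r = 1 / 2 := by
    have := Real.mul_self_sqrt (show (0 : ℝ) ≤ 2 by norm_num)
    simp only [r]
    linarith
  have hrC : (r : ℂ) * r = 1 / 2 := by
    have := congrArg Complex.ofReal hr
    push_cast at this
    exact this
  have hC : (x : ℂ) ^ 2 + y ^ 2 + t ^ 2 = 1 := by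
    have := congrArg Complex.ofReal h
    push_cast at this
    exact this
  obtain ⟨k, hk⟩ := exists_quat_isometry (a := r * (1 + x * Complex.I))
    (b := r * (y + t * Complex.I)) (by
      simp [Complex.normSq_apply]
      linear_combination (1 + x ^ 2 + y ^ 2 + t ^ 2) * hr + h / 2)
  have hg : ∀ v, z ((k * k) v) = quatMap (x * Complex.I) (y + t * Complex.I) (z v) ∧
      (k * k) v (Sum.inr ()) = v (Sum.inr ()) := by
    intro v
    constructor
    · change z (k (k v)) = _
      rw [(hk _).1, (hk _).1]
      have hI := Complex.I_mul_I
      ext i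
      fin_cases i
      · simp [quatMap_apply]
        linear_combination (2 * x * Complex.I * z v 0
          - 2 * (t * Complex.I + y) * (starRingEnd ℂ) (z v 1)) * hrC
          + r ^ 2 * z v 0 * (x ^ 2 + t ^ 2) * hI - r ^ 2 * z v 0 * hC
      · simp [quatMap_apply]
        linear_combination (2 * x * Complex.I * z v 1
          + 2 * (t * Complex.I + y) * (starRingEnd ℂ) (z v 0)) * hrC
          + r ^ 2 * z v 1 * (x ^ 2 + t ^ 2) * hI - r ^ 2 * z v 1 * hC
    · change k (k v) _ = _
      rw [(hk _).2, (hk _).2]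
  exact ⟨k * k, ⟨mul_self_mem_SO k, mem_normalizer_of_quat hg⟩, hg⟩

/-! ### The action of the quaternionic rotations on two-forms -/

theorem actC_of_quat {a b : ℂ} {g : T 2 ≃ₗᵢ[ℝ] T 2}
    (hg : ∀ v, z (g v) = quatMap a b (z v) ∧ g v (Sum.inr ()) = v (Sum.inr ())) :
    actC g (ζ 2 0) = star a • ζ 2 0 + b • ζbar 2 1 ∧
    actC g (ζ 2 1) = star a • ζ 2 1 + (-b) • ζbar 2 0 ∧
    actC g (ζbar 2 0) = a • ζbar 2 0 + star b • ζ 2 1 ∧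
    actC g (ζbar 2 1) = a • ζbar 2 1 + (-star b) • ζ 2 0 := by
  have h0 : ∀ i, (1 : ℂ) ⊗ₜ[ℝ] act g (θ 2 (Sum.inl i)) =
      (2⁻¹ : ℂ) • ((star (quatMap a b (z (e 2 (Sum.inl i))) 0) • ζ 2 0 +
        quatMap a b (z (e 2 (Sum.inl i))) 0 • ζbar 2 0) +
        (star (quatMap a b (z (e 2 (Sum.inl i))) 1) • ζ 2 1 +
        quatMap a b (z (e 2 (Sum.inl i))) 1 • ζbar 2 1)) := by
    intro i
    rw [θ, act_ι, ι_expand, (hg _).1, (hg _).2, Fin.sum_univ_two]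
    simp [e]
  have q00 : quatMap a b (z (e 2 (Sum.inl (0, 0)))) = ![a, b] := by
    rw [z_e0, quatMap_apply]; simp
  have q10 : quatMap a b (z (e 2 (Sum.inl (1, 0)))) = ![-b, a] := by
    rw [z_e0, quatMap_apply]; simp
  have q01 : quatMap a b (z (e 2 (Sum.inl (0, 1)))) = ![a * Complex.I, -(b * Complex.I)] := by
    rw [z_e1, quatMap_apply]; simp
  have q11 : quatMap a b (z (e 2 (Sum.inl (1, 1)))) = ![b * Complex.I, a * Complex.I] := by
    rw [z_e1, quatMap_apply]; simp
  have hI := Complex.I_mul_I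
  refine ⟨?_, ?_, ?_, ?_⟩
  · nth_rewrite 1 [ζ_eq]
    rw [map_add, map_smul, actC_one_tmul, actC_one_tmul, h0, h0, q00, q01]
    simp only [Matrix.cons_val_zero, Matrix.cons_val_one, star_mul', star_neg, Complex.star_def,
      Complex.conj_I]
    match_scalars
    · linear_combination (-(starRingEnd ℂ) a / 2) * hI
    · linear_combination (a / 2) * hI
    · linear_combination ((starRingEnd ℂ) b / 2) * hI
    · linear_combination (-b / 2) * hI
  · nth_rewrite 1 [ζ_eq]
    rw [map_add, map_smul, actC_one_tmul, actC_one_tmul, h0, h0, q10, q11]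
    simp only [Matrix.cons_val_zero, Matrix.cons_val_one, star_mul', star_neg, Complex.star_def,
      Complex.conj_I]
    match_scalars
    · linear_combination (-(starRingEnd ℂ) b / 2) * hI
    · linear_combination (b / 2) * hI
    · linear_combination (-(starRingEnd ℂ) a / 2) * hI
    · linear_combination (a / 2) * hI
  · nth_rewrite 1 [ζbar_eq]
    rw [map_sub, map_smul, actC_one_tmul, actC_one_tmul, h0, h0, q00, q01]
    simp only [Matrix.cons_val_zero, Matrix.cons_val_one, star_mul', star_neg, Complex.star_def,
      Complex.conj_I]
    match_scalars
    · linear_combination ((starRingEnd ℂ) a / 2) * hI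
    · linear_combination (-a / 2) * hI
    · linear_combination (-(starRingEnd ℂ) b / 2) * hI
    · linear_combination (b / 2) * hI
  · nth_rewrite 1 [ζbar_eq]
    rw [map_sub, map_smul, actC_one_tmul, actC_one_tmul, h0, h0, q10, q11]
    simp only [Matrix.cons_val_zero, Matrix.cons_val_one, star_mul', star_neg, Complex.star_def,
      Complex.conj_I]
    match_scalars
    · linear_combination ((starRingEnd ℂ) b / 2) * hI
    · linear_combination (-b / 2) * hI
    · linear_combination ((starRingEnd ℂ) a / 2) * hI
    · linear_combination (-a / 2) * hI

/-! ### Real eigenvectors and rotations of the invariant two-forms -/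

theorem exists_root_cubic (a b c : ℝ) : ∃ s : ℝ, s ^ 3 + a * s ^ 2 + b * s + c = 0 := by
  -- At ±K the cubic term dominates, since K³ = (1 + |a| + |b| + |c|)K² and K ≥ 1; so the signs at
  -- the two ends differ.
  set K : ℝ := 1 + |a| + |b| + |c| with hK
  have ha := abs_le.1 (le_refl |a|)
  have hb := abs_le.1 (le_refl |b|)
  have hc := abs_le.1 (le_refl |c|)
  have ha0 := abs_nonneg a
  have hb0 := abs_nonneg b
  have hc0 := abs_nonneg c
  have hK1 : 1 ≤ K := by linarith
  have hK2 : K ≤ K ^ 2 := by nlinarith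
  have h3 : K ^ 3 = K ^ 2 + |a| * K ^ 2 + |b| * K ^ 2 + |c| * K ^ 2 := by
    rw [hK]; ring
  have hbK : |b| * K ≤ |b| * K ^ 2 := mul_le_mul_of_nonneg_left hK2 hb0
  have hcK : |c| ≤ |c| * K ^ 2 := by nlinarith
  have h1 : -(|a| * K ^ 2) ≤ a * K ^ 2 ∧ a * K ^ 2 ≤ |a| * K ^ 2 := by
    constructor <;> nlinarith [sq_nonneg K]
  have h2 : -(|b| * K) ≤ b * K ∧ b * K ≤ |b| * K := by
    constructor <;> nlinarith
  have hcont : Continuous fun s : ℝ => s ^ 3 + a * s ^ 2 + b * s + c := by fun_prop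
  obtain ⟨s, -, hs⟩ := intermediate_value_Icc (show -K ≤ K by linarith) hcont.continuousOn
    (show (0 : ℝ) ∈ Set.Icc _ _ from ⟨by nlinarith, by nlinarith⟩)
  exact ⟨s, hs⟩

theorem exists_eigenvector (M : Matrix (Fin 3) (Fin 3) ℝ) :
    ∃ (s : ℝ) (v : Fin 3 → ℝ), v ≠ 0 ∧ M.mulVec v = s • v := by
  obtain ⟨s, hs⟩ := exists_root_cubic (-(M 0 0 + M 1 1 + M 2 2))
    (M 0 0 * M 1 1 - M 0 1 * M 1 0 + M 0 0 * M 2 2 - M 0 2 * M 2 0 + M 1 1 * M 2 2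
      - M 1 2 * M 2 1) (-M.det)
  have h : (M - s • (1 : Matrix (Fin 3) (Fin 3) ℝ)).det = 0 := by
    rw [Matrix.det_fin_three] at hs ⊢
    simp
    linear_combination -hs
  obtain ⟨v, hv, h⟩ := Matrix.exists_mulVec_eq_zero_iff.2 h
  refine ⟨s, v, hv, ?_⟩
  rw [Matrix.sub_mulVec, Matrix.smul_mulVec, Matrix.one_mulVec, sub_eq_zero] at h
  exact h


theorem actC_FC_of_quat {a b : ℂ} {g : T 2 ≃ₗᵢ[ℝ] T 2}
    (hg : ∀ v, z (g v) = quatMap a b (z v) ∧ g v (Sum.inr ()) = v (Sum.inr ())) :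
    actC g (FC 2) = (a * star a - b * star b) • FC 2 + (Complex.I * (star a * star b)) • OmegaForm 2
      + (-(Complex.I * (a * b))) • OmegaBar 2 := by
  obtain ⟨h1, h2, h3, h4⟩ := actC_of_quat hg
  have hs : ∀ (c : ℂ) (x y : ExtC 2), x * c • y = c • (x * y) := fun c x y => mul_smul_comm _ _ _
  have e1 : ζ 2 1 * ζ 2 0 = (-1 : ℂ) • (ζ 2 0 * ζ 2 1) :=
    oneForms_anticomm (ζ_mem_oneForms _) (ζ_mem_oneForms _)
  have e2 : ζbar 2 1 * ζbar 2 0 = (-1 : ℂ) • (ζbar 2 0 * ζbar 2 1) :=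
    oneForms_anticomm (ζbar_mem_oneForms _) (ζbar_mem_oneForms _)
  rw [FC_eq, map_smul, Fin.sum_univ_two, map_add, ζζ, ζζ, map_mul, map_mul, h1, h2, h3, h4,
    OmegaForm_eq, OmegaBar]
  simp only [List.ofFn_succ, List.ofFn_zero, List.prod_cons, List.prod_nil, mul_one,
    Fin.succ_zero_eq_one, add_mul, mul_add, smul_mul_assoc, hs, e1, e2, ζbar_mul_ζ]
  module

/-- The invariant two-form `v₀ F + v₁ Ω⁺ + v₂ Ω⁻`. -/
def twoForm (n : ℕ) : (Fin 3 → ℝ) →ₗ[ℝ] Inv n where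
  toFun v := v 0 • F n + v 1 • Ωp n + v 2 • Ωm n
  map_add' v w := by
    simp only [Pi.add_apply]
    module
  map_smul' r v := by
    simp only [Pi.smul_apply, smul_eq_mul, RingHom.id_apply]
    module

theorem twoForm_apply (v : Fin 3 → ℝ) :
    twoForm n v = v 0 • F n + v 1 • Ωp n + v 2 • Ωm n := rfl

/-- In the 3-space of F, Ω⁺, Ω⁻ the imaginary quaternion sends F to its image under the half turn
about the axis (x, y, t), namely twice the projection on the axis minus F. -/
theorem exists_normalizer_rotation_of_unit {x y t : ℝ} (h : x ^ 2 + y ^ 2 + t ^ 2 = 1) :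
    ∃ g : N 2, normAct g (α 2) = α 2 ∧
      normAct g (F 2) = twoForm 2 ![2 * x ^ 2 - 1, 2 * x * y, 2 * x * t] := by
  obtain ⟨g, hgN, hg⟩ := exists_half_turn h
  refine ⟨⟨g, hgN⟩, Subtype.ext ?_, Subtype.ext (one_tmul_injective ?_)⟩
  · change act g (alphaForm 2) = alphaForm 2
    have h1 : g (e 2 (Sum.inr ())) = e 2 (Sum.inr ()) := by
      have hz : z (e 2 (Sum.inr ())) = 0 := by
        ext l; simp [z, e]
      refine ext_z ?_ (hg _).2
      rw [(hg _).1, hz, map_zero]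
    rw [alphaForm, θ, act_ι, h1]
  · have hC : (x : ℂ) ^ 2 + y ^ 2 + t ^ 2 = 1 := by
      have := congrArg Complex.ofReal h
      push_cast at this
      exact this
    have hI := Complex.I_mul_I
    have h1 : (1 : ℂ) ⊗ₜ[ℝ] act g (FForm 2) = actC g (FC 2) := (actC_one_tmul _ _).symm
    change (1 : ℂ) ⊗ₜ[ℝ] act g (FForm 2) = (1 : ℂ) ⊗ₜ[ℝ] ((2 * x ^ 2 - 1) • FForm 2 +
      (2 * x * y) • reForm 2 (OmegaForm 2) + (2 * x * t) • imForm 2 (OmegaForm 2))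
    rw [h1, actC_FC_of_quat hg, TensorProduct.tmul_add, TensorProduct.tmul_add, one_tmul_smul,
      one_tmul_smul, one_tmul_smul, one_tmul_re, one_tmul_im, ← FC.eq_1]
    simp only [star_mul', star_add, Complex.star_def, Complex.conj_I, Complex.conj_ofReal]
    push_cast
    match_scalars
    · linear_combination (t ^ 2 - x ^ 2) * hI - hC
    · linear_combination (-(x : ℂ) * y + x * t * Complex.I) * hI
    · linear_combination (-(x : ℂ) * y - x * t * Complex.I) * hI

/-- A half turn about the bisector of F and the normalized r v exchanges the two directions. Only
the line of v matters, so r may have either sign. -/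
theorem exists_normalizer_rotation {v : Fin 3 → ℝ} (hv : v ≠ 0) :
    ∃ (g : N 2) (r : ℝ), r ≠ 0 ∧ normAct g (α 2) = α 2 ∧ normAct g (F 2) = r • twoForm 2 v := by
  have hs : 0 < v 0 ^ 2 + v 1 ^ 2 + v 2 ^ 2 := by
    by_contra! h
    refine hv (funext fun i => ?_)
    fin_cases i <;> simp <;> nlinarith [sq_nonneg (v 0), sq_nonneg (v 1), sq_nonneg (v 2)]
  obtain ⟨r, hr, hr1, hr0⟩ : ∃ r : ℝ, r ≠ 0 ∧ r ^ 2 * (v 0 ^ 2 + v 1 ^ 2 + v 2 ^ 2) = 1 ∧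
      0 ≤ r * v 0 := by
    have hq := Real.sq_sqrt hs.le
    have hq0 := Real.sqrt_pos.2 hs
    rcases le_total 0 (v 0) with h | h
    -- The sign of r is that making r v₀ nonnegative, so that r v is not opposite to F and x below
    -- is nonzero.
    · exact ⟨(√(v 0 ^ 2 + v 1 ^ 2 + v 2 ^ 2))⁻¹, by positivity, by
        rw [inv_pow, hq, inv_mul_cancel₀ hs.ne'], by positivity⟩
    · refine ⟨-(√(v 0 ^ 2 + v 1 ^ 2 + v 2 ^ 2))⁻¹, by simpa using hq0.ne', by
        rw [neg_sq, inv_pow, hq, inv_mul_cancel₀ hs.ne'], ?_⟩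
      rw [neg_mul, ← mul_neg]
      exact mul_nonneg (by positivity) (by linarith)
  -- By the half-angle formula, x is the first coordinate of the unit bisector; the other two follow
  -- from 2xy = r v₁ and 2xt = r v₂.
  set x := √((1 + r * v 0) / 2)
  have hx : x ^ 2 = (1 + r * v 0) / 2 := Real.sq_sqrt (by positivity)
  have hx0 : x ≠ 0 := (Real.sqrt_pos.2 (by positivity)).ne'
  obtain ⟨g, hgα, hgF⟩ := exists_normalizer_rotation_of_unit (x := x) (y := r * v 1 / (2 * x))
    (t := r * v 2 / (2 * x)) (by
      field_simp
      have h4 : x ^ 4 = ((1 + r * v 0) / 2) ^ 2 := by rw [← hx]; ring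
      linear_combination 4 * h4 - 4 * hx + hr1)
  refine ⟨g, r, hr, hgα, ?_⟩
  rw [hgF, ← map_smul]
  congr 1
  ext i
  fin_cases i
  · simp
    linarith
  · simp
    field_simp
  · simp
    field_simp

/-! ### Operators for `n = 2` -/

theorem exists_twoForm_of_degree_two {y : Inv 2} (hy : y ∈ invGrading 2 2) :
    ∃ v, y = twoForm 2 v := by
  obtain ⟨c, a, b, h, -⟩ := mem_span_of_degree_two le_rfl hy
  exact ⟨![c, a, b], h⟩

theorem exists_α_mul_twoForm_of_degree_three {y : Inv 2} (hy : y ∈ invGrading 2 3) :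
    ∃ v, y = α 2 * twoForm 2 v := by
  have hle : Submodule.span ℝ (stdInv 2 '' {i | stdDeg 2 i = 3}) ≤
      Submodule.span ℝ {α 2 * F 2, α 2 * Ωp 2, α 2 * Ωm 2} := by
    rw [Submodule.span_le]
    rintro _ ⟨⟨ε, i⟩, hi, rfl⟩
    refine Submodule.subset_span ?_
    simp only [stdDeg, Set.mem_ofPred_eq] at hi
    rcases ε with _ | _ <;> rcases i with k | b <;> simp at hi
    · omega
    · left; simp [stdInv, show k = 1 by omega]
    · cases b <;> simp [stdInv]
  have := hle (mem_span_of_mem_invGrading (by omega) hy)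
  rw [Submodule.mem_span_triple] at this
  obtain ⟨c, a, b, h⟩ := this
  refine ⟨![c, a, b], ?_⟩
  rw [← h, twoForm_apply, mul_add, mul_add, mul_smul_comm, mul_smul_comm, mul_smul_comm]
  rfl

/-- For n = 2 all invariant three-forms are α times invariant two-forms, so f on two-forms is
encoded by an endomorphism of ℝ³. -/
theorem exists_matrix {f : Inv 2 →ₗ[ℝ] Inv 2} (hf : HasDegreeOne (invGrading 2) f) :
    ∃ M : Matrix (Fin 3) (Fin 3) ℝ, ∀ v, f (twoForm 2 v) = α 2 * twoForm 2 (M.mulVec v) := by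
  have h : ∀ i : Fin 3, ∃ w, f (twoForm 2 (Pi.single i 1)) = α 2 * twoForm 2 w := fun i => by
    refine exists_α_mul_twoForm_of_degree_three (hf 2 _ ?_)
    rw [twoForm_apply]
    exact add_mem (add_mem (Submodule.smul_mem _ _ F_mem) (Submodule.smul_mem _ _ Ωp_mem))
      (Submodule.smul_mem _ _ Ωm_mem)
  choose w hw using h
  refine ⟨Matrix.of fun i j => w j i, fun v => ?_⟩
  have h1 : f ∘ₗ twoForm 2 = LinearMap.mulLeft ℝ (α 2) ∘ₗ twoForm 2 ∘ₗ
      Matrix.mulVecLin (Matrix.of fun i j => w j i) := by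
    refine LinearMap.pi_ext' fun i => LinearMap.ext_ring ?_
    change f (twoForm 2 (Pi.single i 1)) = α 2 * twoForm 2
      ((Matrix.of fun i j => w j i).mulVec (Pi.single i 1))
    rw [hw, Matrix.mulVec_single_one]
    rfl
  exact LinearMap.congr_fun h1 v

theorem exists_conj_typeA_or_typeB {f : Inv 2 →ₗ[ℝ] Inv 2}
    (hf : IsDifferentialOperator (invGrading 2) f) (hext : ExtendsToDerivation f) :
    ∃ g : N 2, ∃ lam mu : ℝ, TypeA (conj g f) lam mu ∨ TypeB (conj g f) lam mu := by
  obtain ⟨c, hα⟩ := exists_twoForm_of_degree_two (hf.degree_one _ _ α_mem)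
  obtain ⟨M, hM⟩ := exists_matrix hf.degree_one
  -- The two-form v plays the part of F. If f(α) ≠ 0 it is f(α) itself, closed because f² = 0; if
  -- f(α) = 0, any real eigenvector of M serves.
  obtain ⟨v, r, s, hv, hαv, hfv⟩ : ∃ (v : Fin 3 → ℝ) (r s : ℝ), v ≠ 0 ∧
      f (α 2) = r • twoForm 2 v ∧ f (twoForm 2 v) = s • (α 2 * twoForm 2 v) := by
    by_cases hc : c = 0
    · obtain ⟨s, v, hv, h⟩ := exists_eigenvector M
      refine ⟨v, 0, s, hv, ?_, ?_⟩
      · rw [hα, hc, map_zero, zero_smul]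
      · rw [hM, h, map_smul, mul_smul_comm]
    · refine ⟨c, 1, 0, hc, ?_, ?_⟩
      · rw [hα, one_smul]
      · rw [← hα, hf.sq_zero, zero_smul]
  obtain ⟨g, q, hq, hgα, hgF⟩ := exists_normalizer_rotation hv
  have h1 : normAct g⁻¹ (α 2) = α 2 := by
    nth_rewrite 1 [← hgα]
    exact normAct_inv_normAct _ _
  have h2 : normAct g⁻¹ (twoForm 2 v) = q⁻¹ • F 2 := by
    rw [← normAct_inv_normAct g (F 2), hgF, map_smul, smul_smul, inv_mul_cancel₀ hq, one_smul]
  have hA : conj g⁻¹ f (α 2) = (r * q⁻¹) • F 2 := by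
    rw [conj_apply, inv_inv, hgα, hαv, map_smul, h2, smul_smul]
  have hF : conj g⁻¹ f (F 2) = (2 * (s / 2)) • (α 2 * F 2) := by
    rw [conj_apply, inv_inv, hgF, map_smul, hfv, map_smul, map_smul, normAct_mul, h1, h2,
      mul_smul_comm, smul_smul, smul_smul]
    congr 1
    field_simp
  refine ⟨g⁻¹, ?_⟩
  rcases typeA_or_typeB le_rfl (isDifferentialOperator_conj g⁻¹ hf)
    (extendsToDerivation_conj g⁻¹ hext) hA hF with ⟨lam, mu, h⟩ | ⟨lam, mu, h⟩
  · exact ⟨lam, mu, Or.inl h⟩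
  · exact ⟨lam, mu, Or.inr h⟩

end OddSU

end

/-! ### The classification -/

theorem mainTheorem10 (n : ℕ) (hn : 2 ≤ n) (f : OddSU.Inv n →ₗ[ℝ] OddSU.Inv n)
    (hf : OddSU.GradedLeibniz (OddSU.invGrading n) f) :
    (OddSU.IsDifferentialOperator (OddSU.invGrading n) f ∧ OddSU.ExtendsToDerivation f) ↔
      ((∃ lam mu : ℝ, OddSU.TypeA f lam mu) ∨
        (∃ lam mu : ℝ, OddSU.TypeB f lam mu) ∨
        (n = 2 ∧ ∃ g : OddSU.N n, ∃ lam mu : ℝ,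
          OddSU.TypeA (OddSU.conj g f) lam mu ∨ OddSU.TypeB (OddSU.conj g f) lam mu) ∨
        (n = 3 ∧ ∃ lam mu : ℝ, OddSU.TypeD f lam mu)) := by
  constructor
  · rintro ⟨hdiff, hext⟩
    rcases hn.eq_or_lt with rfl | hn
    · exact Or.inr (Or.inr (Or.inl ⟨rfl, OddSU.exists_conj_typeA_or_typeB hdiff hext⟩))
    · rcases OddSU.forward_of_three_le hn hdiff hext with h | h | h
      · exact Or.inl h
      · exact Or.inr (Or.inl h)
      · exact Or.inr (Or.inr (Or.inr h))
  · rintro (⟨lam, mu, h⟩ | ⟨lam, mu, h⟩ | ⟨-, g, lam, mu, h⟩ | ⟨h3, lam, mu, h⟩)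
    · exact OddSU.reverse_typeA hn hf h
    · exact OddSU.reverse_typeB hn hf h
    · have hgf := OddSU.gradedLeibniz_conj g hf
      obtain ⟨hdiff, hext⟩ : OddSU.IsDifferentialOperator (OddSU.invGrading n) (OddSU.conj g f) ∧
          OddSU.ExtendsToDerivation (OddSU.conj g f) := by
        rcases h with h | h
        · exact OddSU.reverse_typeA hn hgf h
        · exact OddSU.reverse_typeB hn hgf h
      -- Both properties are invariant under the normalizer, so they return from g·f to f by
      -- conjugating with g⁻¹.
      have hdiff' := OddSU.isDifferentialOperator_conj g⁻¹ hdiff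
      have hext' := OddSU.extendsToDerivation_conj g⁻¹ hext
      rw [OddSU.conj_inv_conj] at hdiff' hext'
      exact ⟨hdiff', hext'⟩
    · exact OddSU.reverse_typeD h3 hf h
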